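/- Let $f\in\mathbb Q^2\setminus\mathbb Z^2$ and let $R=[r^1,\dots,r^k]\in\mathbb Q^{2\times k}$ have nonzero columns with $\mathrm{cone}\{r^1,\dots,r^k\}=\mathbb R^2$. Put $P(R,f)=\{(x,s)\in\mathbb Z^2\times\mathbb R^k_+ : x=f+Rs\}$ and let $P(R,f)^0\subseteq\mathbb R^2\times\mathbb R^k_+$ be its linear relaxation. For $\mathcal Q\subseteq\mathbb R^2\times\mathbb R^k$, its split closure is the intersection over all $\pi\in\mathbb Z^2,\pi_0\in\mathbb Z$ of $\mathrm{conv}\big((\mathcal Q\cap\{\pi^Tx\le\pi_0\})\cup(\mathcal Q\cap\{\pi^Tx\ge\pi_0+1\})\big)$, and the split rank of an inequality is the least $n\ge 0$ such that it is valid for the $n$-fold split closure of $P(R,f)^0$ ($+\infty$ if there is none). For $\alpha\in\mathbb R^k_+$ the induced set of $\sum_i\alpha_is_i\ge1$ is $L_\alpha=\mathrm{conv}(\{f+r^i/\alpha_i:\alpha_i>0\}\cup\{f\})+\mathrm{cone}\{r^i:\alpha_i=0\}$. For a closed convex lattice-free set $B$ (no integer point in its interior) with $f\in\mathrm{int}\,B$,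 let $\phi(B)_i=0$ if $r^i$ is in the recession cone of $B$ and otherwise let $\phi(B)_i$ be the $\lambda>0$ with $f+r^i/\lambda\in\partial B$; write $\phi(B)$ also for the inequality $\sum_i\phi(B)_is_i\ge1$. A lattice-free triangle is of type $T^1$ if its vertices are integral and each side has exactly one integer point in its relative interior; of type $T^{2A}$ if it has a non-integral vertex whose opposite side contains at least two integer points and whose two incident sides each have exactly one integer point in their relative interior; of type $T^{2B}$ if it has a non-integral vertex whose opposite side contains at least two integer points and of whose two incident sides one has exactly one and the other no integer point in its relative interior, and it is contained in a triangle of type $T^{2A}$. A convex quadrilateral is of type $Q^1$ if it is a subset of a triangle of type $T^1$ or $T^{2A}$ and, in some order of its sides, the first contains at least two integer points, the second and the third at least one each, and the fourth none in its relative interior. **Proposition.** (1) Let $\sum_i\alpha_is_i\ge1$, $\alpha\ge 0$, be valid for $\mathrm{conv}(P(R,f))$ and let $L_\alpha$ be a quadrilateral of type $Q^1$. Then its split rank is finite. If moreover $L_\alpha$ lies in a triangle of type $T^1$, then there are a unimodular $M\in\mathbb Z^{2\times2}$, a vector $w\in\mathbb Z^2$, a matrix $R'\in\mathbb Q^{2\times4}$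 and $\alpha'\in\mathbb R^4$ such that, with $f'=M(f+w)$, the data $(f',R',\alpha')$ are in the standard position described in (2), $M(L_\alpha+w)\subseteq L_{\alpha'}$, the split rank of $\alpha$ is at most that of $\alpha'$ (with respect to $P(R',f')^0$), and it is at most one more than the maximum of the split ranks of $\phi(U)$ and $\phi(V)$, for the triangles $U,V$ constructed in (2) from $(f',R')$. (2) Let $k=4$, $\alpha>0$, and let $(f,R,\alpha)$ be in standard position: $f+r^1/\alpha_1=(0,2)$, $f+r^2/\alpha_2=(1+\delta,1-\delta)$, $f+r^3/\alpha_3=(\gamma,0)$, $f+r^4/\alpha_4=(0,0)$ for some $0<\delta<1<\gamma<2$, and $r^2_2<0$, $r^3_1+r^3_2>0$. Let $x^2$ be the point of the ray from $f$ along $r^2$ with second coordinate $0$, and $p^1$ the point of the ray along $r^1$ on the line through $x^2$ and $(1,1)$; let $x^3$ be the point of the ray along $r^3$ on the line $x_1+x_2=2$, and $p^4$ the point of the ray along $r^4$ on the line through $x^3$ and $(1,0)$. These points exist; put $U=\mathrm{conv}\{p^1,x^2,(0,0)\}$ and $V=\mathrm{conv}\{(0,2),x^3,p^4\}$. Then $U$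 and $V$ are triangles of type $T^{2B}$ with $f$ in their interiors, $L_{\phi(U)}=U$, $L_{\phi(V)}=V$, and $\phi(U)$, $\phi(V)$ have finite split rank. The inequality $\sum_i\alpha_is_i\ge1$ is valid for $\mathrm{conv}\big((Q\cap\{x_1\le0\})\cup(Q\cap\{x_1\ge1\})\big)$, where $Q$ is the set of points of $P(R,f)^0$ satisfying $\phi(U)$ and $\phi(V)$; and its split rank is at most one more than the maximum of the split ranks of $\phi(U)$ and $\phi(V)$. -/

import Mathlib

open Set

noncomputable section

/-! ### Mixed integer sets, split closures and split rank -/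

/-- The set obtained from `Q ⊆ ℝ^p × ℝ^q` by the split disjunction
`π x ≤ π₀ ∨ π x ≥ π₀ + 1`: the convex hull of the two pieces of `Q`. -/
def splitSet {p q : ℕ} (Q : Set ((Fin p → ℝ) × (Fin q → ℝ))) (π : Fin p → ℤ) (π₀ : ℤ) :
    Set ((Fin p → ℝ) × (Fin q → ℝ)) :=
  convexHull ℝ
    ((Q ∩ {z | ∑ i, (π i : ℝ) * z.1 i ≤ (π₀ : ℝ)}) ∪
      (Q ∩ {z | (π₀ : ℝ) + 1 ≤ ∑ i, (π i : ℝ) * z.1 i}))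

/-- The first split closure. -/
def splitClosure {p q : ℕ} (Q : Set ((Fin p → ℝ) × (Fin q → ℝ))) :
    Set ((Fin p → ℝ) × (Fin q → ℝ)) :=
  ⋂ (π : Fin p → ℤ) (π₀ : ℤ), splitSet Q π π₀

/-- The `n`-th split closure; the `0`-th one is `Q` itself. -/
def iterSplitClosure {p q : ℕ} (n : ℕ) (Q : Set ((Fin p → ℝ) × (Fin q → ℝ))) :
    Set ((Fin p → ℝ) × (Fin q → ℝ)) :=
  splitClosure^[n] Q

/-- The inequality `a x + b y ≤ γ` holds on all of `Q`. -/
def ValidOn {p q : ℕ} (Q : Set ((Fin p → ℝ) × (Fin q → ℝ)))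
    (a : Fin p → ℝ) (b : Fin q → ℝ) (γ : ℝ) : Prop :=
  ∀ z ∈ Q, ∑ i, a i * z.1 i + ∑ j, b j * z.2 j ≤ γ

/-- The split rank of `a x + b y ≤ γ` with respect to `Q`: the least `n` such that the inequality
is valid for the `n`-th split closure of `Q`, and `⊤` if there is no such `n`. -/
def splitRank {p q : ℕ} (Q : Set ((Fin p → ℝ) × (Fin q → ℝ)))
    (a : Fin p → ℝ) (b : Fin q → ℝ) (γ : ℝ) : ℕ∞ :=
  ⨅ (n : ℕ) (_ : ValidOn (iterSplitClosure n Q) a b γ), (n : ℕ∞)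

/-! ### The sets `P(R, f)` and the inequalities `∑ αᵢ sᵢ ≥ 1` -/

/-- The linear relaxation `{(x, s) | x = f + R s, s ≥ 0}`; the columns of `R` are
`R 0, …, R (k - 1)`. -/
def relaxP {k : ℕ} (f : Fin 2 → ℝ) (R : Fin k → Fin 2 → ℝ) :
    Set ((Fin 2 → ℝ) × (Fin k → ℝ)) :=
  {z | z.1 = f + ∑ i, z.2 i • R i ∧ ∀ i, 0 ≤ z.2 i}

/-- The integer points of the plane. -/
def latticePoints : Set (Fin 2 → ℝ) := {x | ∃ z : Fin 2 → ℤ, x = fun i => (z i : ℝ)}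

/-- The vector `x` has rational coordinates. -/
def IsRationalVec (x : Fin 2 → ℝ) : Prop := ∃ z : Fin 2 → ℚ, x = fun i => (z i : ℝ)

/-- The mixed integer set `P(R, f)`. -/
def mixedP {k : ℕ} (f : Fin 2 → ℝ) (R : Fin k → Fin 2 → ℝ) :
    Set ((Fin 2 → ℝ) × (Fin k → ℝ)) :=
  {z | z ∈ relaxP f R ∧ z.1 ∈ latticePoints}

/-- The inequality `∑ αᵢ sᵢ ≥ 1`, written as `0 x + (-α) s ≤ -1`, is valid on `Q`. -/
def CutValidOn {k : ℕ} (Q : Set ((Fin 2 → ℝ) × (Fin k → ℝ))) (α : Fin k → ℝ) : Prop :=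
  ValidOn Q 0 (-α) (-1)

/-- The split rank of `∑ αᵢ sᵢ ≥ 1` with respect to the linear relaxation of `P(R, f)`. -/
def cutRank {k : ℕ} (f : Fin 2 → ℝ) (R : Fin k → Fin 2 → ℝ) (α : Fin k → ℝ) : ℕ∞ :=
  splitRank (relaxP f R) 0 (-α) (-1)

/-- Standing assumptions on the data: `f` is rational and not integral, the columns of `R` are
rational and nonzero, and they generate the whole plane as a cone. -/
structure IsPlaneData {k : ℕ} (f : Fin 2 → ℝ) (R : Fin k → Fin 2 → ℝ) : Prop where
  f_rational : IsRationalVec f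
  f_notMem : f ∉ latticePoints
  R_rational : ∀ i, IsRationalVec (R i)
  R_ne_zero : ∀ i, R i ≠ 0
  cone_eq_top : PointedCone.hull ℝ (range R) = ⊤

/-- The induced set
`L_α = conv ({f + rⁱ / αᵢ | αᵢ > 0} ∪ {f}) + cone {rⁱ | αᵢ = 0}`. -/
def inducedSet {k : ℕ} (f : Fin 2 → ℝ) (R : Fin k → Fin 2 → ℝ) (α : Fin k → ℝ) :
    Set (Fin 2 → ℝ) :=
  {x | ∃ y ∈ convexHull ℝ ({y | ∃ i, 0 < α i ∧ y = f + (α i)⁻¹ • R i} ∪ {f}),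
    ∃ d ∈ PointedCone.hull ℝ {r | ∃ i, α i = 0 ∧ r = R i}, x = y + d}

/-- The recession cone of a convex set. -/
def recCone (B : Set (Fin 2 → ℝ)) : Set (Fin 2 → ℝ) :=
  {d | ∀ x ∈ B, ∀ t : ℝ, 0 ≤ t → x + t • d ∈ B}

open Classical in
/-- The coefficient vector `φ(B)` of the intersection cut given by a closed convex set `B` with
`f` in its interior. If `rⁱ` is not in the recession cone of `B`, then the set below has exactly
one element. -/
def phi {k : ℕ} (f : Fin 2 → ℝ) (R : Fin k → Fin 2 → ℝ) (B : Set (Fin 2 → ℝ)) : Fin k → ℝ :=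
  fun i => if R i ∈ recCone B then 0
    else sInf {t : ℝ | 0 < t ∧ f + t⁻¹ • R i ∈ frontier B}

/-! ### Lattice-free triangles and quadrilaterals -/

/-- No integer point in the interior. -/
def LatticeFree (S : Set (Fin 2 → ℝ)) : Prop := Disjoint (interior S) latticePoints

/-- The segment `[a, b]` has exactly one integer point in its relative interior. -/
def OneInside (a b : Fin 2 → ℝ) : Prop := ∃! p, p ∈ openSegment ℝ a b ∩ latticePoints

/-- `v` lists the three vertices of the triangle `S`. -/
def IsTriangle (S : Set (Fin 2 → ℝ)) (v : Fin 3 → Fin 2 → ℝ) : Prop :=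
  AffineIndependent ℝ v ∧ S = convexHull ℝ (range v)

/-- Triangles of type `T¹`. -/
def IsT1 (S : Set (Fin 2 → ℝ)) : Prop :=
  LatticeFree S ∧ ∃ v, IsTriangle S v ∧ (∀ i, v i ∈ latticePoints) ∧
    OneInside (v 0) (v 1) ∧ OneInside (v 1) (v 2) ∧ OneInside (v 2) (v 0)

/-- Triangles of type `T²ᴬ`: `v 0` is the distinguished non-integral vertex. -/
def IsT2A (S : Set (Fin 2 → ℝ)) : Prop :=
  LatticeFree S ∧ ∃ v, IsTriangle S v ∧ v 0 ∉ latticePoints ∧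
    (segment ℝ (v 1) (v 2) ∩ latticePoints).Nontrivial ∧
    OneInside (v 0) (v 1) ∧ OneInside (v 0) (v 2)

/-- Triangles of type `T²ᴮ`: `v 0` is the distinguished non-integral vertex. -/
def IsT2B (S : Set (Fin 2 → ℝ)) : Prop :=
  LatticeFree S ∧ (∃ v, IsTriangle S v ∧ v 0 ∉ latticePoints ∧
    (segment ℝ (v 1) (v 2) ∩ latticePoints).Nontrivial ∧
    OneInside (v 0) (v 1) ∧ openSegment ℝ (v 0) (v 2) ∩ latticePoints = ∅) ∧
  ∃ T, IsT2A T ∧ S ⊆ T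

/-- Twice the signed area of the triangle `a b c`. -/
def orient (a b c : Fin 2 → ℝ) : ℝ :=
  (b 0 - a 0) * (c 1 - a 1) - (b 1 - a 1) * (c 0 - a 0)

/-- `v` lists the four vertices of the convex quadrilateral `S` in counterclockwise order
(indices are cyclic): there is a strict left turn at every vertex. -/
def IsQuadrilateral (S : Set (Fin 2 → ℝ)) (v : Fin 4 → Fin 2 → ℝ) : Prop :=
  (∀ i, 0 < orient (v i) (v (i + 1)) (v (i + 2))) ∧ S = convexHull ℝ (range v)

/-- Quadrilaterals of type `Q¹`. Side `i` joins `v i` and `v (i + 1)`; the sides are named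
`σ 0, σ 1, σ 2, σ 3` in an arbitrary order. -/
def IsQ1 (S : Set (Fin 2 → ℝ)) : Prop :=
  (∃ T, (IsT1 T ∨ IsT2A T) ∧ S ⊆ T) ∧
  ∃ v, IsQuadrilateral S v ∧ ∃ σ : Equiv.Perm (Fin 4),
    (segment ℝ (v (σ 0)) (v (σ 0 + 1)) ∩ latticePoints).Nontrivial ∧
    (segment ℝ (v (σ 1)) (v (σ 1 + 1)) ∩ latticePoints).Nonempty ∧
    (segment ℝ (v (σ 2)) (v (σ 2 + 1)) ∩ latticePoints).Nonempty ∧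
    openSegment ℝ (v (σ 3)) (v (σ 3 + 1)) ∩ latticePoints = ∅

/-! ### The standard quadrilateral inside a `T¹` triangle and the two auxiliary triangles -/

/-- Integral translation by `w` followed by the linear map given by the integral matrix `M`. -/
def intAffine (M : Matrix (Fin 2) (Fin 2) ℤ) (w : Fin 2 → ℤ) (x : Fin 2 → ℝ) : Fin 2 → ℝ :=
  (M.map (fun z : ℤ => (z : ℝ))).mulVec (x + fun i => (w i : ℝ))

/-- Standard position: the points `f + rⁱ / αᵢ` are `(0,2)`, `(1+δ,1-δ)`, `(γ,0)`, `(0,0)`, the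
second ray meets the line `x₂ = 0` beyond its point and the third ray meets the line
`x₁ + x₂ = 2` beyond its point. -/
structure IsStandardQ1 (f : Fin 2 → ℝ) (R : Fin 4 → Fin 2 → ℝ) (α : Fin 4 → ℝ) : Prop where
  data : IsPlaneData f R
  pos : ∀ i, 0 < α i
  vertices : ∃ δ γ : ℝ, 0 < δ ∧ δ < 1 ∧ 1 < γ ∧ γ < 2 ∧
    f + (α 0)⁻¹ • R 0 = ![0, 2] ∧ f + (α 1)⁻¹ • R 1 = ![1 + δ, 1 - δ] ∧
    f + (α 2)⁻¹ • R 2 = ![γ, 0] ∧ f + (α 3)⁻¹ • R 3 = ![0, 0]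
  second : R 1 1 < 0
  third : 0 < R 2 0 + R 2 1

/-- `U` is the triangle with vertices `p¹, x², (0,0)`, where `x²` is the point of the second ray
on the line `x₂ = 0` and `p¹` is the point of the first ray on the line through `x²` and `(1,1)`. -/
def IsTriangleU (f : Fin 2 → ℝ) (R : Fin 4 → Fin 2 → ℝ) (U : Set (Fin 2 → ℝ)) : Prop :=
  ∃ x₂ p₁ : Fin 2 → ℝ,
    (∃ t : ℝ, 0 < t ∧ x₂ = f + t • R 1) ∧ x₂ 1 = 0 ∧
    (∃ t : ℝ, 0 < t ∧ p₁ = f + t • R 0) ∧ p₁ ∈ affineSpan ℝ {x₂, ![1, 1]} ∧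
    U = convexHull ℝ {p₁, x₂, ![0, 0]}

/-- `V` is the triangle with vertices `(0,2), x³, p⁴`, where `x³` is the point of the third ray
on the line `x₁ + x₂ = 2` and `p⁴` is the point of the fourth ray on the line through `x³` and
`(1,0)`. -/
def IsTriangleV (f : Fin 2 → ℝ) (R : Fin 4 → Fin 2 → ℝ) (V : Set (Fin 2 → ℝ)) : Prop :=
  ∃ x₃ p₄ : Fin 2 → ℝ,
    (∃ t : ℝ, 0 < t ∧ x₃ = f + t • R 2) ∧ x₃ 0 + x₃ 1 = 2 ∧
    (∃ t : ℝ, 0 < t ∧ p₄ = f + t • R 3) ∧ p₄ ∈ affineSpan ℝ {x₃, ![1, 0]} ∧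
    V = convexHull ℝ {![0, 2], x₃, p₄}

end

/-!
Let `T` be a triangle of type `T²ᴬ` containing the points `f + rⁱ / αᵢ`. In suitable lattice
coordinates its long side lies on `x₀ = 0` and the other two sides pass through `(1, 1)` and
`(1, 0)`. For each side functional `g` of `T`, the relaxation satisfies `1 - ∑ αᵢ sᵢ ≤ c g(x)` for
some `c > 0`, so the value of `1 - ∑ αᵢ sᵢ` over `x` lies below a pyramid with base `T`. The points
that attain the plane over one of the sides through `(1, 1)` and `(1, 0)` and respect the other two
planes project into a cone, and the lattice points of this cone lie on or beyond that side because
`T` is lattice-free. Hence finitely many Chvátal and split steps cut the cone off along the side,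
which lowers the slope of the plane by a fixed amount. The slope of the side itself may be
irrational, and is then approached by rational slopes from both sides. Once the two planes are
below a common one on `x₀ = 1`, a split on `x₁` followed by one on `x₀` gives the cut. Triangles of
type `T²ᴮ` lie in triangles of type `T²ᴬ`, so their cuts have finite rank too.

In standard position all points `f + rⁱ / αᵢ` satisfy `0 ≤ x₀`, so that the relaxation implies the
cut on `x₀ ≤ 0`; on `1 ≤ x₀` it follows from `φ(U)` and `φ(V)` together. A quadrilateral in a
triangle of type `T¹` misses one of the vertices of the triangle. Normalise the triangle to
`(0, 0)`, `(2, 0)`, `(0, 2)` with `(2, 0)` missing: a line `x₀ = γ` with `γ < 2` rational then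
encloses the quadrilateral in one in standard position, and enlarging the induced set does not
decrease the split rank.
-/

/-! ### Split closures -/

/-- The space `ℝ^p × ℝ^q` of `p` integer and `q` continuous variables. -/
abbrev MixedSpace (p q : ℕ) : Type := (Fin p → ℝ) × (Fin q → ℝ)

section SplitClosure

variable {p q : ℕ} {Q Q' S : Set (MixedSpace p q)}

lemma splitSet_mono (h : Q ⊆ Q') (π : Fin p → ℤ) (π₀ : ℤ) : splitSet Q π π₀ ⊆ splitSet Q' π π₀ :=
  convexHull_mono (union_subset_union (inter_subset_inter_left _ h) (inter_subset_inter_left _ h))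

lemma splitClosure_subset_splitSet (Q : Set (MixedSpace p q)) (π : Fin p → ℤ)
    (π₀ : ℤ) : splitClosure Q ⊆ splitSet Q π π₀ :=
  fun _ hz => mem_iInter₂.1 hz π π₀

lemma splitClosure_subset (hQ : Convex ℝ Q) : splitClosure Q ⊆ Q :=
  (splitClosure_subset_splitSet Q 0 0).trans
    (convexHull_min (union_subset inter_subset_left inter_subset_left) hQ)

lemma convex_splitClosure (Q : Set (MixedSpace p q)) : Convex ℝ (splitClosure Q) :=
  convex_iInter₂ fun _ _ => convex_convexHull ℝ _

lemma iterSplitClosure_succ (n : ℕ) (Q : Set (MixedSpace p q)) :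
    iterSplitClosure (n + 1) Q = splitClosure (iterSplitClosure n Q) :=
  Function.iterate_succ_apply' _ _ _

lemma iterSplitClosure_add (m n : ℕ) (Q : Set (MixedSpace p q)) :
    iterSplitClosure (m + n) Q = iterSplitClosure m (iterSplitClosure n Q) :=
  Function.iterate_add_apply _ _ _ _

lemma convex_iterSplitClosure (hQ : Convex ℝ Q) : ∀ n, Convex ℝ (iterSplitClosure n Q)
  | 0 => hQ
  | n + 1 => by rw [iterSplitClosure_succ]; exact convex_splitClosure _

lemma iterSplitClosure_antitone (hQ : Convex ℝ Q) : Antitone fun n => iterSplitClosure n Q :=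
  antitone_nat_of_succ_le fun n => by
    change iterSplitClosure (n + 1) Q ⊆ iterSplitClosure n Q
    rw [iterSplitClosure_succ]
    exact splitClosure_subset (convex_iterSplitClosure hQ n)

lemma iterSplitClosure_subset (hQ : Convex ℝ Q) (n : ℕ) : iterSplitClosure n Q ⊆ Q :=
  iterSplitClosure_antitone hQ (Nat.zero_le n)

end SplitClosure

/-! ### Integral functionals and integral maps -/

section Integral

variable {p q p' q' : ℕ}

/-- Affine functionals `(x, s) ↦ π x + c` with `π` and `c` integral. For such a functional `X` and
an integer `j`, the disjunction `X ≤ j ∨ X ≥ j + 1` is a split disjunction. -/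
def IsIntegralFunctional (X : MixedSpace p q →ᵃ[ℝ] ℝ) : Prop :=
  ∃ (π : Fin p → ℤ) (c : ℤ), ∀ z, X z = ∑ i, (π i : ℝ) * z.1 i + c

namespace IsIntegralFunctional

variable {X Y : MixedSpace p q →ᵃ[ℝ] ℝ} {Q S : Set (MixedSpace p q)}

lemma const (m : ℤ) :
    IsIntegralFunctional (AffineMap.const ℝ (MixedSpace p q) (m : ℝ)) :=
  ⟨0, m, by simp⟩

lemma zsmul_add_zsmul (hX : IsIntegralFunctional X) (hY : IsIntegralFunctional Y) (m n : ℤ) :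
    IsIntegralFunctional ((m : ℝ) • X + (n : ℝ) • Y) := by
  obtain ⟨π, c, hX⟩ := hX
  obtain ⟨ρ, d, hY⟩ := hY
  refine ⟨fun i => m * π i + n * ρ i, m * c + n * d, fun z => ?_⟩
  simp only [AffineMap.coe_add, AffineMap.coe_smul, Pi.add_apply, Pi.smul_apply, smul_eq_mul, hX,
    hY, Int.cast_add, Int.cast_mul, add_mul, mul_add, Finset.sum_add_distrib, Finset.mul_sum,
    mul_assoc]
  ring

lemma const_sub (hX : IsIntegralFunctional X) (m : ℤ) :
    IsIntegralFunctional (AffineMap.const ℝ _ (m : ℝ) - X) := by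
  simpa [sub_eq_add_neg] using (const m).zsmul_add_zsmul hX 1 (-1)

lemma splitClosure_subset (hX : IsIntegralFunctional X) (j : ℤ) (hS : Convex ℝ S)
    (hle : ∀ z ∈ Q, X z ≤ j → z ∈ S) (hge : ∀ z ∈ Q, (j : ℝ) + 1 ≤ X z → z ∈ S) :
    splitClosure Q ⊆ S := by
  obtain ⟨π, c, hX⟩ := hX
  simp only [hX] at hle hge
  refine (splitClosure_subset_splitSet Q π (j - c)).trans (convexHull_min (union_subset ?_ ?_) hS)
  · rintro z ⟨hz, hzπ : _ ≤ ((j - c : ℤ) : ℝ)⟩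
    push_cast at hzπ
    exact hle z hz (by linarith)
  · rintro z ⟨hz, hzπ : ((j - c : ℤ) : ℝ) + 1 ≤ _⟩
    push_cast at hzπ
    exact hge z hz (by linarith)

end IsIntegralFunctional

/-- Affine maps of mixed integer spaces along which integral functionals, hence split disjunctions,
pull back. -/
def IsIntegralMap (F : MixedSpace p q →ᵃ[ℝ] MixedSpace p' q') : Prop :=
  ∀ X, IsIntegralFunctional X → IsIntegralFunctional (X.comp F)

namespace IsIntegralMap

variable {F : MixedSpace p q →ᵃ[ℝ] MixedSpace p' q'}
  {Q : Set (MixedSpace p q)} {Q' : Set (MixedSpace p' q')}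

lemma mapsTo_splitClosure (hF : IsIntegralMap F) (h : MapsTo F Q Q') :
    MapsTo F (splitClosure Q) (splitClosure Q') := by
  refine fun z hz => mem_iInter₂.2 fun π π₀ => ?_
  let X : MixedSpace p' q' →ᵃ[ℝ] ℝ :=
    ((∑ i, (π i : ℝ) • LinearMap.proj i) ∘ₗ LinearMap.fst ℝ _ _).toAffineMap
  have hX : ∀ y, X y = ∑ i, (π i : ℝ) * y.1 i := by simp [X]
  have hXF : IsIntegralFunctional (X.comp F) := hF X ⟨π, 0, by simp [hX]⟩
  refine hXF.splitClosure_subset (S := F ⁻¹' splitSet Q' π π₀) π₀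
    ((convex_convexHull ℝ _).affine_preimage F) (fun y hy hle => ?_) (fun y hy hge => ?_) hz
  · exact subset_convexHull ℝ _ (Or.inl ⟨h hy, (hX (F y)).symm.trans_le hle⟩)
  · exact subset_convexHull ℝ _ (Or.inr ⟨h hy, hge.trans_eq (hX (F y))⟩)

lemma mapsTo_iterSplitClosure (hF : IsIntegralMap F) (h : MapsTo F Q Q') :
    ∀ n, MapsTo F (iterSplitClosure n Q) (iterSplitClosure n Q')
  | 0 => h
  | n + 1 => by
    simp only [iterSplitClosure_succ]
    exact hF.mapsTo_splitClosure (hF.mapsTo_iterSplitClosure h n)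

end IsIntegralMap

end Integral

/-! ### The split rank of a cut -/

section CutRank

variable {k k' : ℕ} {f f' : Fin 2 → ℝ} {R : Fin k → Fin 2 → ℝ} {R' : Fin k' → Fin 2 → ℝ}
  {α β γ : Fin k → ℝ} {α' : Fin k' → ℝ} {n : ℕ}

lemma convex_relaxP (f : Fin 2 → ℝ) (R : Fin k → Fin 2 → ℝ) : Convex ℝ (relaxP f R) := by
  let G : MixedSpace 2 k →ₗ[ℝ] Fin 2 → ℝ :=
    LinearMap.fst ℝ _ _ - (∑ i, (LinearMap.proj i).smulRight (R i)) ∘ₗ LinearMap.snd ℝ _ _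
  have hrelax : relaxP f R = G ⁻¹' {f} ∩ LinearMap.snd ℝ _ _ ⁻¹' {s | 0 ≤ s} := by
    ext z
    simp [relaxP, G, sub_eq_iff_eq_add, Pi.le_def]
  rw [hrelax]
  exact ((convex_singleton f).linear_preimage G).inter ((convex_Ici 0).linear_preimage _)

lemma relaxP_apply {z : MixedSpace 2 k} (hz : z ∈ relaxP f R) (j : Fin 2) :
    z.1 j = f j + ∑ i, z.2 i * R i j := by
  rw [hz.1]
  simp [Finset.sum_apply]

lemma cutValidOn_iff {Q : Set (MixedSpace 2 k)} :
    CutValidOn Q α ↔ ∀ z ∈ Q, 1 ≤ ∑ i, α i * z.2 i := by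
  simp only [CutValidOn, ValidOn, Pi.zero_apply, zero_mul, Finset.sum_const_zero, zero_add,
    Pi.neg_apply, neg_mul, Finset.sum_neg_distrib, neg_le_neg_iff]

lemma CutValidOn.mono {Q Q' : Set (MixedSpace 2 k)} (h : CutValidOn Q' α)
    (hQ : Q ⊆ Q') : CutValidOn Q α := fun z hz => h z (hQ hz)

lemma cutRank_le_iff :
    cutRank f R α ≤ n ↔ CutValidOn (iterSplitClosure n (relaxP f R)) α := by
  refine ⟨fun h => ?_, fun h => iInf₂_le n h⟩
  have hlt : cutRank f R α < (n + 1 : ℕ) := h.trans_lt (by exact_mod_cast n.lt_succ_self)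
  obtain ⟨m, hm⟩ := iInf_lt_iff.1 hlt
  obtain ⟨hv, hm⟩ := iInf_lt_iff.1 hm
  exact CutValidOn.mono hv
    (iterSplitClosure_antitone (convex_relaxP f R) (Nat.lt_succ_iff.1 (by exact_mod_cast hm)))

lemma cutRank_le_of_forall
    (h : ∀ n, CutValidOn (iterSplitClosure n (relaxP f' R')) α' →
      CutValidOn (iterSplitClosure n (relaxP f R)) α) : cutRank f R α ≤ cutRank f' R' α' :=
  le_iInf₂ fun n hn => cutRank_le_iff.2 (h n hn)

lemma cutRank_lt_top (h : CutValidOn (iterSplitClosure n (relaxP f R)) α) : cutRank f R α < ⊤ :=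
  (cutRank_le_iff.2 h).trans_lt (WithTop.coe_lt_top n)

lemma cutRank_le_max_add_one (π : Fin 2 → ℤ) (π₀ : ℤ)
    (h : CutValidOn (splitSet {z | z ∈ relaxP f R ∧ 1 ≤ ∑ i, β i * z.2 i ∧
      1 ≤ ∑ i, γ i * z.2 i} π π₀) α) :
    cutRank f R α ≤ max (cutRank f R β) (cutRank f R γ) + 1 := by
  rcases eq_or_ne (max (cutRank f R β) (cutRank f R γ)) ⊤ with htop | htop
  · simp [htop]
  obtain ⟨n, hn⟩ := ENat.ne_top_iff_exists.1 htop
  have hβ := cutValidOn_iff.1 (cutRank_le_iff.1 (hn ▸ le_max_left _ _))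
  have hγ := cutValidOn_iff.1 (cutRank_le_iff.1 (hn ▸ le_max_right _ _))
  rw [← hn]
  refine (cutRank_le_iff (n := n + 1)).2 (h.mono ?_)
  rw [iterSplitClosure_succ]
  refine (splitClosure_subset_splitSet _ π π₀).trans (splitSet_mono (fun z hz => ?_) π π₀)
  exact ⟨iterSplitClosure_subset (convex_relaxP f R) n hz, hβ z hz, hγ z hz⟩

end CutRank

/-! ### Lifting a facet by cutting planes -/

section Lifting

variable {p q : ℕ} {S : Set (MixedSpace p q → ℝ)} {A B L : MixedSpace p q → ℝ}

/-- Let `v` be the slack of an inequality that is valid on a convex set `Q`. If a positive multiple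
of every function in `S` can be subtracted from the slack without losing validity, then so can a
positive multiple of `L` after `k` split closures; `k` and the multiple of `L` depend neither on `Q`
nor on the inequality. -/
def Liftable (S : Set (MixedSpace p q → ℝ)) (L : MixedSpace p q → ℝ) : Prop :=
  ∃ k : ℕ, ∀ κ > 0, ∃ κ' > 0, ∀ (Q : Set (MixedSpace p q)) (v : MixedSpace p q →ᵃ[ℝ] ℝ),
    Convex ℝ Q → (∀ z ∈ Q, 0 ≤ v z) → (∀ L₀ ∈ S, ∀ z ∈ Q, κ * L₀ z ≤ v z) →
    ∀ z ∈ iterSplitClosure k Q, κ' * L z ≤ v z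

lemma mul_le_of_le_of_mul_le {c c' l v : ℝ} (hc' : 0 ≤ c') (hle : c' ≤ c) (hv : 0 ≤ v)
    (h : c * l ≤ v) : c' * l ≤ v := by
  rcases le_total 0 l with hl | hl
  · exact (mul_le_mul_of_nonneg_right hle hl).trans h
  · exact (mul_nonpos_of_nonneg_of_nonpos hc' hl).trans hv

namespace Liftable

lemma of_le_add {A B : MixedSpace p q → ℝ} (hA : A ∈ S) (hB : B ∈ S) {a b : ℝ} (ha : 0 ≤ a)
    (hb : 0 ≤ b) (h : ∀ z, L z ≤ a * A z + b * B z) : Liftable S L := by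
  refine ⟨0, fun κ hκ => ⟨κ / (a + b + 1), by positivity, fun Q v _ hv hS z hz => ?_⟩⟩
  have hsum : κ * (a * A z + b * B z) ≤ (a + b) * v z := by
    linear_combination a * hS A hA z hz + b * hS B hB z hz
  have hL : κ * L z ≤ (a + b + 1) * v z := by
    linear_combination κ * h z + hsum + hv z hz
  rw [div_mul_eq_mul_div, div_le_iff₀ (by positivity)]
  linarith

lemma of_split {X L : MixedSpace p q →ᵃ[ℝ] ℝ} (hX : IsIntegralFunctional X) (j : ℤ) (hA : A ∈ S)
    (hB : B ∈ S) (hLA : ∀ z, X z ≤ j → L z ≤ A z) (hLB : ∀ z, (j : ℝ) + 1 ≤ X z → L z ≤ B z) :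
    Liftable S L := by
  refine ⟨1, fun κ hκ => ⟨κ, hκ, fun Q v _ _ hS => ?_⟩⟩
  have hconv : Convex ℝ {z | κ * L z ≤ v z} := by
    simpa [preimage, sub_nonneg] using (convex_Ici (0 : ℝ)).affine_preimage (v - κ • L)
  exact hX.splitClosure_subset j hconv
    (fun z hz hj => (mul_le_mul_of_nonneg_left (hLA z hj) hκ.le).trans (hS A hA z hz))
    fun z hz hj => (mul_le_mul_of_nonneg_left (hLB z hj) hκ.le).trans (hS B hB z hz)

lemma trans (hA : Liftable S A) (hB : Liftable S B) (h : Liftable {A, B} L) : Liftable S L := by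
  obtain ⟨kA, hA⟩ := hA
  obtain ⟨kB, hB⟩ := hB
  obtain ⟨k, h⟩ := h
  refine ⟨k + max kA kB, fun κ hκ => ?_⟩
  obtain ⟨κA, hκA, hA⟩ := hA κ hκ
  obtain ⟨κB, hκB, hB⟩ := hB κ hκ
  have hmin : 0 < min κA κB := lt_min hκA hκB
  obtain ⟨κ', hκ', h⟩ := h (min κA κB) hmin
  refine ⟨κ', hκ', fun Q v hQ hv hS => ?_⟩
  have hv' : ∀ z ∈ iterSplitClosure (max kA kB) Q, 0 ≤ v z := fun z hz =>
    hv z (iterSplitClosure_subset hQ _ hz)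
  rw [iterSplitClosure_add]
  refine h _ v (convex_iterSplitClosure hQ _) hv' ?_
  rintro _ (rfl | rfl) z hz
  · exact mul_le_of_le_of_mul_le hmin.le (min_le_left _ _) (hv' z hz)
      (hA Q v hQ hv hS z (iterSplitClosure_antitone hQ (le_max_left _ _) hz))
  · exact mul_le_of_le_of_mul_le hmin.le (min_le_right _ _) (hv' z hz)
      (hB Q v hQ hv hS z (iterSplitClosure_antitone hQ (le_max_right _ _) hz))

lemma mono (hA : Liftable S A) {a : ℝ} (ha : 0 ≤ a) (h : ∀ z, L z ≤ a * A z) : Liftable S L :=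
  hA.trans hA (of_le_add (mem_insert A {A}) (mem_insert A {A}) ha le_rfl fun z => by
    simpa using h z)

lemma comb (hA : Liftable S A) (hB : Liftable S B) {a b : ℝ} (ha : 0 ≤ a) (hb : 0 ≤ b)
    (h : ∀ z, L z ≤ a * A z + b * B z) : Liftable S L :=
  hA.trans hB (of_le_add (mem_insert A {B}) (mem_insert_of_mem A rfl) ha hb h)

lemma split {X L : MixedSpace p q →ᵃ[ℝ] ℝ} (hX : IsIntegralFunctional X) (j : ℤ)
    (hA : Liftable S A) (hB : Liftable S B) (hLA : ∀ z, X z ≤ j → L z ≤ A z)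
    (hLB : ∀ z, (j : ℝ) + 1 ≤ X z → L z ≤ B z) : Liftable S L :=
  hA.trans hB (of_split hX j (mem_insert A {B}) (mem_insert_of_mem A rfl) hLA hLB)

lemma chvatal {X : MixedSpace p q →ᵃ[ℝ] ℝ} (hX : IsIntegralFunctional X) {j : ℤ} {ε : ℝ}
    (hε : 0 < ε) (h : Liftable S fun z => j + ε - X z) :
    Liftable S fun z => j + 1 - X z := by
  have hA : Liftable S fun z => (1 + 1 / ε) * (j + ε - X z) :=
    h.mono (by positivity) fun z => le_rfl
  have hB : Liftable S fun _ => (0 : ℝ) := h.mono le_rfl fun z => by simp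
  refine split (L := AffineMap.const ℝ _ ((j : ℝ) + 1) - X) hX j hA hB (fun z hz => ?_)
    fun z hz => ?_
  · have hjX : 0 ≤ (j - X z) / ε := div_nonneg (sub_nonneg.2 hz) hε.le
    calc (j : ℝ) + 1 - X z ≤ (j + ε - X z) + ((j - X z) / ε + 1) := by linarith
      _ = (1 + 1 / ε) * (j + ε - X z) := by field_simp; ring
  · exact sub_nonpos.2 hz

end Liftable

end Lifting

/-! ### Cutting planes for a planar cone -/

section Cone

variable {p q : ℕ} {S : Set (MixedSpace p q → ℝ)} {X Y : MixedSpace p q →ᵃ[ℝ] ℝ}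

/-- The halfplane `a + b x + e y ≤ 0` misses `(j, i)`, so near the line `x = j` it misses the
half-line `y ≤ i`, and combining it with `x ≥ j` improves the latter there. -/
lemma exists_pos_le_add_of_le {a b e : ℝ} {i j : ℤ} (he : e ≤ 0) (h : 0 < a + b * j + e * i) :
    ∃ ε > 0, ∃ c₁ ≥ 0, ∃ c₂ ≥ 0, ∀ x y : ℝ, y ≤ i →
      j + ε - x ≤ c₁ * (a + b * x + e * y) + c₂ * (j - x) := by
  have hN : 0 < |b| + 1 - b := by linarith [le_abs_self b]
  refine ⟨(a + b * j + e * i) / (|b| + 1 - b), by positivity, 1 / (|b| + 1 - b), by positivity,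
    (|b| + 1) / (|b| + 1 - b), by positivity, fun x y hy => ?_⟩
  have hey : e * i ≤ e * y := mul_le_mul_of_nonpos_left hy he
  rw [← sub_nonneg]
  calc (0 : ℝ) ≤ (e * y - e * i) / (|b| + 1 - b) := div_nonneg (sub_nonneg.2 hey) hN.le
    _ = _ := by field_simp; ring

lemma Liftable.succ_sub {a₁ b₁ e₁ a₂ b₂ e₂ : ℝ} (hX : IsIntegralFunctional X)
    (hY : IsIntegralFunctional Y) (he₁ : 0 < e₁) (he₂ : e₂ ≤ 0)
    (h₁ : Liftable S fun z => a₁ + b₁ * X z + e₁ * Y z)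
    (h₂ : Liftable S fun z => a₂ + b₂ * X z + e₂ * Y z) {j : ℤ}
    (hj : ∀ i : ℤ, a₁ + b₁ * j + e₁ * i ≤ 0 → 0 < a₂ + b₂ * j + e₂ * i)
    (h : Liftable S fun z => j - X z) : Liftable S fun z => j + 1 - X z := by
  -- `i` is the last lattice point on the line `X = j` satisfying the first inequality
  obtain ⟨i, hi, hi'⟩ : ∃ i : ℤ, a₁ + b₁ * j + e₁ * i ≤ 0 ∧ 0 < a₁ + b₁ * j + e₁ * (i + 1) := by
    have hlo := (le_div_iff₀ he₁).1 (Int.floor_le (-(a₁ + b₁ * j) / e₁))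
    have hhi := (div_lt_iff₀ he₁).1 (Int.lt_floor_add_one (-(a₁ + b₁ * j) / e₁))
    exact ⟨⌊-(a₁ + b₁ * j) / e₁⌋, by linarith, by linarith⟩
  obtain ⟨ε₂, hε₂, c₂, hc₂, d₂, hd₂, hbelow⟩ := exists_pos_le_add_of_le he₂ (hj i hi)
  obtain ⟨ε₁, hε₁, c₁, hc₁, d₁, hd₁, habove⟩ :=
    exists_pos_le_add_of_le (a := a₁) (b := b₁) (i := -(i + 1)) (j := j) (neg_nonpos.2 he₁.le)
      (by push_cast; linarith)
  refine Liftable.chvatal hX (lt_min hε₁ hε₂) ?_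
  refine Liftable.split (L := AffineMap.const ℝ _ (j + min ε₁ ε₂) - X) hY i
    (h₂.comb h hc₂ hd₂ fun z => le_rfl) (h₁.comb h hc₁ hd₁ fun z => le_rfl)
    (fun z hz => ?_) fun z hz => ?_
  · exact (sub_le_sub_right (add_le_add_right (min_le_right _ _) _) _).trans (hbelow _ _ hz)
  · have hz' := habove (X z) (-Y z) (by push_cast; linarith)
    rw [neg_mul_neg] at hz'
    exact (sub_le_sub_right (add_le_add_right (min_le_left _ _) _) _).trans hz'

/-- `X` is bounded below on the cone cut out by the two inequalities, so Chvátal steps reach the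
bound `m` of its lattice points. -/
lemma Liftable.sub_of_cone {a₁ b₁ e₁ a₂ b₂ e₂ : ℝ} (hX : IsIntegralFunctional X)
    (hY : IsIntegralFunctional Y) (he₁ : 0 < e₁) (he₂ : e₂ < 0) (hdet : e₁ * b₂ < e₂ * b₁)
    (h₁ : Liftable S fun z => a₁ + b₁ * X z + e₁ * Y z)
    (h₂ : Liftable S fun z => a₂ + b₂ * X z + e₂ * Y z) {m : ℤ}
    (hlat : ∀ j i : ℤ, a₁ + b₁ * j + e₁ * i ≤ 0 → a₂ + b₂ * j + e₂ * i ≤ 0 → m ≤ j) :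
    Liftable S fun z => m - X z := by
  set τ := e₂ * b₁ - e₁ * b₂ with hτ
  have hτ₀ : 0 < τ := sub_pos.2 hdet
  set x₀ := (e₁ * a₂ - e₂ * a₁) / τ with hx₀
  have hvertex : Liftable S fun z => x₀ - X z := by
    refine h₁.comb h₂ (a := -e₂ / τ) (b := e₁ / τ) (div_nonneg (by linarith) hτ₀.le)
      (by positivity) fun z => le_of_eq ?_
    rw [hx₀]
    field_simp
    rw [hτ]
    ring
  suffices H : ∀ j : ℤ, min ⌊x₀⌋ m ≤ j → j ≤ m → Liftable S fun z => (j : ℝ) - X z from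
    H m (min_le_right _ _) le_rfl
  intro j hj
  induction j, hj using Int.leInduction with
  | base =>
    intro _
    refine hvertex.mono zero_le_one fun z => ?_
    have hfloor : ((min ⌊x₀⌋ m : ℤ) : ℝ) ≤ x₀ :=
      (Int.cast_le.2 (min_le_left _ _)).trans (Int.floor_le _)
    linarith
  | succ j _ ih =>
    intro hjm
    have hstep := Liftable.succ_sub hX hY he₁ he₂.le h₁ h₂ (j := j) (fun i hi => ?_)
      (ih (by omega))
    · exact_mod_cast hstep
    · by_contra! hi'
      exact absurd (hlat j i hi hi') (by omega)

/-- The coordinates `m X + n Y` and `v X - u Y`, where `u m + v n = 1`, reduce this to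
`Liftable.sub_of_cone`. -/
lemma Liftable.sub_of_cone_of_isCoprime {a₁ b₁ e₁ a₂ b₂ e₂ : ℝ} (hX : IsIntegralFunctional X)
    (hY : IsIntegralFunctional Y) {m n : ℤ} (hmn : IsCoprime m n) (h₁pos : 0 < b₁ * n - e₁ * m)
    (h₂neg : b₂ * n - e₂ * m < 0) (hdet : b₁ * e₂ < e₁ * b₂)
    (h₁ : Liftable S fun z => a₁ + b₁ * X z + e₁ * Y z)
    (h₂ : Liftable S fun z => a₂ + b₂ * X z + e₂ * Y z) {m₀ : ℤ}
    (hlat : ∀ j i : ℤ, a₁ + b₁ * j + e₁ * i ≤ 0 → a₂ + b₂ * j + e₂ * i ≤ 0 →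
      m₀ ≤ m * j + n * i) :
    Liftable S fun z => m₀ - (m * X z + n * Y z) := by
  obtain ⟨u, v, huv⟩ := hmn
  have huvℝ : (u : ℝ) * m + v * n = 1 := by exact_mod_cast huv
  have hcoord : ∀ a b e x y : ℝ, a + b * x + e * y = a + (b * u + e * v) * (m * x + n * y) +
      (b * n - e * m) * (v * x + (-u : ℤ) * y) := fun a b e x y => by
    push_cast
    linear_combination (-b * x - e * y) * huvℝ
  refine Liftable.sub_of_cone (hX.zsmul_add_zsmul hY m n) (hX.zsmul_add_zsmul hY v (-u))
    h₁pos h₂neg (b₁ := b₁ * u + e₁ * v) (b₂ := b₂ * u + e₂ * v) ?_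
    (by simp only [hcoord a₁ b₁ e₁] at h₁; exact h₁)
    (by simp only [hcoord a₂ b₂ e₂] at h₂; exact h₂)
    fun j i hj₁ hj₂ => ?_
  · linear_combination hdet + (b₁ * e₂ - e₁ * b₂) * huvℝ
  · have hji := hlat (u * j + n * i) (v * j - m * i) (by push_cast; linarith)
      (by push_cast; linarith)
    calc m₀ ≤ m * (u * j + n * i) + n * (v * j - m * i) := hji
      _ = (u * m + v * n) * j := by ring
      _ = j := by rw [huv, one_mul]

end Cone

/-! ### Rational approximation of an irrational side -/

lemma exists_rat_le_forall_le (β : ℝ) {N : ℤ} (hN : 0 < N) :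
    ∃ r : ℚ, (r : ℝ) ≤ β ∧ ∀ i m : ℤ, 0 < i → i ≤ N → (m : ℝ) ≤ β * i → (m : ℝ) ≤ r * i := by
  obtain ⟨d, hd, hmax⟩ := Finset.exists_max_image (Finset.Icc 1 N) (fun i => (⌊β * i⌋ : ℚ) / i)
    ⟨1, Finset.mem_Icc.2 ⟨le_rfl, hN⟩⟩
  have hd₀ : (0 : ℝ) < d := by exact_mod_cast (Finset.mem_Icc.1 hd).1
  refine ⟨(⌊β * d⌋ : ℚ) / d, ?_, fun i m hi hiN hm => ?_⟩
  · push_cast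
    exact (div_le_iff₀ hd₀).2 (Int.floor_le _)
  · have hi₀ : (0 : ℚ) < i := by exact_mod_cast hi
    have hfloor := (div_le_iff₀ hi₀).1 (hmax i (Finset.mem_Icc.2 ⟨hi, hiN⟩))
    calc (m : ℝ) ≤ (⌊β * i⌋ : ℝ) := Int.cast_le.2 (Int.le_floor.2 hm)
      _ ≤ _ := by exact_mod_cast hfloor

/-- Beyond a large denominator `N` the slope is so close to `β` that the cone of slope `c`
separates the two, and below `N` a best lower approximation has the same lattice points. -/
lemma exists_rat_near_forall_nonneg (β H : ℝ) {c ε : ℝ} (hc : 0 < c) (hε : 0 < ε) :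
    ∃ r : ℚ, (r : ℝ) ≤ β ∧ β - ε < r ∧ ∀ i m : ℤ, 0 < i → 0 ≤ m + β * i →
      c * (i - H) ≤ m + β * i → (0 : ℝ) ≤ m + r * i := by
  obtain ⟨N, hN⟩ := exists_nat_gt (max (1 / ε) (max (2 / c) (2 * H)))
  obtain ⟨hNε, hN⟩ := max_lt_iff.1 hN
  obtain ⟨hNc, hNH⟩ := max_lt_iff.1 hN
  have hN₀ : (0 : ℝ) < N := (by positivity : 0 < 1 / ε).trans hNε
  have hN₁ : (0 : ℤ) < N := by exact_mod_cast hN₀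
  rw [div_lt_iff₀ hε] at hNε
  rw [div_lt_iff₀ hc] at hNc
  obtain ⟨r, hrβ, hr⟩ := exists_rat_le_forall_le β hN₁
  have hrN : (β - r) * N < 1 := by
    have hfloor := hr N ⌊β * N⌋ hN₁ le_rfl (by exact_mod_cast Int.floor_le _)
    have := Int.lt_floor_add_one (β * N)
    push_cast at hfloor
    linarith
  refine ⟨r, hrβ, by nlinarith, fun i m hi hβ hcone => ?_⟩
  rcases le_or_gt i N with hiN | hiN
  · have := hr i (-m) hi hiN (by push_cast; linarith)
    push_cast at this
    linarith
  · have hiN' : (N : ℝ) < i := by exact_mod_cast hiN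
    have hrc : β - r < c / 2 := by
      by_contra! hle
      nlinarith
    have hclose : (β - r) * i ≤ c / 2 * i := mul_le_mul_of_nonneg_right hrc.le (by linarith)
    have hfar : c * (2 * H) ≤ c * i := mul_le_mul_of_nonneg_left (by linarith) hc.le
    linarith

/-! ### Cutting planes for a lattice-free triangle -/

section Triangle

variable {p q : ℕ} {S : Set (MixedSpace p q → ℝ)} {X Y : MixedSpace p q →ᵃ[ℝ] ℝ}

lemma Liftable.side_of_rat {β c₁ c₂ h : ℝ} (hX : IsIntegralFunctional X)
    (hY : IsIntegralFunctional Y)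
    (h₁ : Liftable S fun z => 1 - Y z - β * (X z - 1) + c₁ * (X z - h))
    (h₂ : Liftable S fun z => 1 - Y z - β * (X z - 1) - c₂ * X z) {r : ℚ} (hr₁ : β - c₁ < r)
    (hr₂ : r < β + c₂)
    (hlat : ∀ i m : ℤ, -m - β * (i - 1) + c₁ * (i - h) ≤ 0 → -m - β * (i - 1) - c₂ * i ≤ 0 →
      (0 : ℝ) ≤ m + r * (i - 1)) :
    Liftable S fun z => 1 - Y z - r * (X z - 1) := by
  have hden : (0 : ℝ) < r.den := by exact_mod_cast r.den_pos
  have hnum : (r.num : ℝ) = r * r.den := by exact_mod_cast (Rat.mul_den_eq_num r).symm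
  have hcone : Liftable S fun z => ((r.num + r.den : ℤ) : ℝ) -
      (r.num * X z + (r.den : ℤ) * Y z) := by
    refine Liftable.sub_of_cone_of_isCoprime hX hY (Rat.isCoprime_num_den r)
      (a₁ := 1 + β - c₁ * h) (b₁ := c₁ - β) (e₁ := -1) (a₂ := 1 + β) (b₂ := -β - c₂) (e₂ := -1)
      ?_ ?_ (by linarith) ?_ ?_ fun i m hi₁ hi₂ => ?_
    · push_cast
      rw [hnum]
      linarith [mul_pos (sub_pos.2 hr₁) hden]
    · push_cast
      rw [hnum]
      linarith [mul_pos (sub_pos.2 hr₂) hden]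
    · convert h₁ using 2 with z
      ring
    · convert h₂ using 2 with z
      ring
    · have hside := hlat i (m - 1) (by push_cast; linarith) (by push_cast; linarith)
      have : ((r.num + r.den : ℤ) : ℝ) ≤ (r.num * i + r.den * m : ℤ) := by
        push_cast at hside ⊢
        rw [hnum]
        linarith [mul_nonneg hside hden.le]
      exact_mod_cast this
  refine hcone.mono (a := 1 / r.den) (by positivity) fun z => le_of_eq ?_
  push_cast
  rw [hnum]
  field_simp
  ring

/-- The slope `β` is a convex combination of rational slopes `r ≤ β ≤ r'` whose sides through
`(1, 1)` are still valid for the lattice points of the cone. -/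
lemma Liftable.side_of_cone {β c₁ c₂ h : ℝ} (hX : IsIntegralFunctional X)
    (hY : IsIntegralFunctional Y) (hc₁ : 0 < c₁) (hc₂ : 0 < c₂)
    (h₁ : Liftable S fun z => 1 - Y z - β * (X z - 1) + c₁ * (X z - h))
    (h₂ : Liftable S fun z => 1 - Y z - β * (X z - 1) - c₂ * X z)
    (hlat : ∀ i m : ℤ, -m - β * (i - 1) + c₁ * (i - h) ≤ 0 → -m - β * (i - 1) - c₂ * i ≤ 0 →
      0 ≤ m + β * (i - 1)) :
    Liftable S fun z => 1 - Y z - β * (X z - 1) := by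
  obtain ⟨r, hrβ, hr, hcone⟩ := exists_rat_near_forall_nonneg β (h - 1) hc₁ hc₁
  obtain ⟨s, hsβ, hs, hcone'⟩ := exists_rat_near_forall_nonneg (-β) 1 hc₂ hc₂
  have hlower : Liftable S fun z => 1 - Y z - r * (X z - 1) := by
    refine .side_of_rat hX hY h₁ h₂ hr (by linarith) fun i m hi₁ hi₂ => ?_
    rcases le_or_gt i 1 with hi | hi
    · have : (i : ℝ) - 1 ≤ 0 := sub_nonpos.2 (by exact_mod_cast hi)
      linarith [hlat i m hi₁ hi₂, mul_le_mul_of_nonpos_right hrβ this]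
    · exact_mod_cast hcone (i - 1) m (by omega) (by push_cast; linarith [hlat i m hi₁ hi₂])
        (by push_cast; linarith)
  have hupper : Liftable S fun z => 1 - Y z - (-s : ℚ) * (X z - 1) := by
    refine .side_of_rat hX hY h₁ h₂ (by push_cast; linarith) (by push_cast; linarith)
      fun i m hi₁ hi₂ => ?_
    rcases le_or_gt 1 i with hi | hi
    · have : 0 ≤ (i : ℝ) - 1 := sub_nonneg.2 (by exact_mod_cast hi)
      push_cast
      linarith [hlat i m hi₁ hi₂, mul_le_mul_of_nonneg_right hsβ this]
    · have := hcone' (1 - i) m (by omega) (by push_cast; linarith [hlat i m hi₁ hi₂])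
        (by push_cast; linarith)
      push_cast at this ⊢
      linarith
  push_cast at hupper
  rcases (by linarith : (r : ℝ) ≤ -s).eq_or_lt with hrs | hrs
  · rwa [show (r : ℝ) = β by linarith] at hlower
  · have hd : (0 : ℝ) < -s - r := sub_pos.2 hrs
    refine hlower.comb hupper (a := (-s - β) / (-s - r)) (b := (β - r) / (-s - r))
      (div_nonneg (by linarith) hd.le) (div_nonneg (by linarith) hd.le) fun z => le_of_eq ?_
    field_simp
    ring

/-- The cone is cut out by two sides of the pyramid over a triangle and a plane of slope `s`
through the third side. -/
lemma liftable_of_triangle (hX : IsIntegralFunctional X) (hY : IsIntegralFunctional Y)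
    {a β s₁ s₂ s : ℝ} (ha : 0 < a) (hβ : 0 < β) (hs₁ : 0 < s₁) (hs₂ : 0 < s₂) (hs : 0 < s) :
    Liftable {fun z => s * (1 - Y z - β * (X z - 1)) - s₁ * (Y z - a * (X z - 1)),
      fun z => s * (1 - Y z - β * (X z - 1)) - s₂ * X z} fun z => 1 - Y z - β * (X z - 1) := by
  refine Liftable.side_of_cone hX hY (c₁ := s₁ * (a + β) / (s + s₁)) (c₂ := s₂ / s)
    (h := 1 + 1 / (a + β)) (by positivity) (by positivity)
    (.of_le_add (mem_insert _ _) (mem_insert _ _) (a := 1 / (s + s₁)) (b := 0) (by positivity)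
      le_rfl fun z => le_of_eq (by field_simp; ring))
    (.of_le_add (mem_insert_of_mem _ rfl) (mem_insert _ _) (a := 1 / s) (b := 0) (by positivity)
      le_rfl fun z => le_of_eq (by field_simp; ring)) fun i m hi₁ hi₂ => ?_
  by_contra! hout
  have hW : 0 < s * (-m - β * (i - 1)) := mul_pos hs (by linarith)
  have hside₁ : s * (-m - β * (i - 1)) - s₁ * (m + 1 - a * (i - 1)) ≤ 0 := by
    have := mul_nonpos_of_nonneg_of_nonpos (by linarith : 0 ≤ s + s₁) hi₁
    field_simp at this
    linarith
  have hside₂ : s * (-m - β * (i - 1)) - s₂ * i ≤ 0 := by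
    have := mul_nonpos_of_nonneg_of_nonpos hs.le hi₂
    field_simp at this
    linarith
  -- `(i, m + 1)` would be a lattice point in the interior of the triangle
  have hi : (0 : ℝ) < i := pos_of_mul_pos_right (by linarith : 0 < s₂ * (i : ℝ)) hs₂.le
  have hm : 0 < (m : ℝ) + 1 - a * (i - 1) :=
    pos_of_mul_pos_right (by linarith : 0 < s₁ * ((m : ℝ) + 1 - a * (i - 1))) hs₁.le
  have hi₀ : (0 : ℝ) ≤ i - 1 := by
    have : 0 < i := by exact_mod_cast hi
    exact sub_nonneg.2 (by exact_mod_cast this)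
  have hm₀ : m < 0 := by
    exact_mod_cast (by linarith [mul_nonneg hβ.le hi₀] : (m : ℝ) < 0)
  have hm₁ : -1 < m := by
    exact_mod_cast (by linarith [mul_nonneg ha.le hi₀] : (-1 : ℝ) < m)
  omega

end Triangle

/-! ### The pyramid over a lattice-free triangle -/

section Pyramid

variable {p q : ℕ} {Q : Set (MixedSpace p q)} {X Y W v : MixedSpace p q →ᵃ[ℝ] ℝ}

lemma convex_setOf_le (u v : MixedSpace p q →ᵃ[ℝ] ℝ) : Convex ℝ {z | u z ≤ v z} := by
  simpa [preimage, sub_nonneg] using (convex_Ici (0 : ℝ)).affine_preimage (v - u)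

lemma mul_sub_le_slack {κ s s' s₀ t W g v : ℝ} (ht₀ : 0 ≤ t) (ht₁ : t ≤ 1) (htκ : t * s₀ ≤ κ)
    (hs : 0 ≤ s) (hss' : s ≤ s') (hs' : s' ≤ s₀ - κ) (h' : 1 - s' * W ≤ v) (h₀ : 1 - s₀ * W ≤ v)
    (hg : 1 - g ≤ v) : t * (s * W - g) ≤ v - (1 - s' * W) := by
  have htg : t * (1 - g) ≤ t * v := mul_le_mul_of_nonneg_left hg ht₀
  rcases le_total 0 W with hW | hW
  · have hsW : t * (s * W) ≤ t * (s' * W) :=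
      mul_le_mul_of_nonneg_left (mul_le_mul_of_nonneg_right hss' hW) ht₀
    have htv : (1 - t) * (1 - s' * W) ≤ (1 - t) * v :=
      mul_le_mul_of_nonneg_left h' (sub_nonneg.2 ht₁)
    linarith
  · have htv : (1 - t) * (1 - s₀ * W) ≤ (1 - t) * v :=
      mul_le_mul_of_nonneg_left h₀ (sub_nonneg.2 ht₁)
    have hκW : (κ - t * s₀) * W ≤ 0 := mul_nonpos_of_nonneg_of_nonpos (sub_nonneg.2 htκ) hW
    have hs'W : (s₀ - κ - s') * W ≤ 0 := mul_nonpos_of_nonneg_of_nonpos (sub_nonneg.2 hs') hW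
    have htsW : t * s * W ≤ 0 := mul_nonpos_of_nonneg_of_nonpos (mul_nonneg ht₀ hs) hW
    linarith

lemma exists_le_of_forall_sub {P : ℝ → Prop} {s t κ : ℝ} (hκ : 0 < κ) (ht : P t)
    (hstep : ∀ x, s < x → x ≤ t → P x → P (x - κ)) : ∃ x ≤ s, P x := by
  have hiter : ∀ N : ℕ, ∃ x ≤ max s (t - N * κ), P x := by
    intro N
    induction N with
    | zero => exact ⟨t, by simp, ht⟩
    | succ N ih =>
      obtain ⟨x, hx, hPx⟩ := ih
      rcases le_or_gt x s with hxs | hxs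
      · exact ⟨x, hxs.trans (le_max_left _ _), hPx⟩
      · have hxN := (le_max_iff.1 hx).resolve_left hxs.not_ge
        have hN : 0 ≤ N * κ := by positivity
        refine ⟨x - κ, le_max_of_le_right ?_, hstep x hxs (by linarith) hPx⟩
        push_cast
        linarith
  obtain ⟨N, hN⟩ := exists_nat_gt ((t - s) / κ)
  obtain ⟨x, hx, hPx⟩ := hiter N
  exact ⟨x, hx.trans (max_le le_rfl (by linarith [(div_lt_iff₀ hκ).1 hN])), hPx⟩

/-- Once the slope is below `s₀` by a fixed amount, each further block of split closures lowers it
by a constant `κ'`, as long as it exceeds `s`. -/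
lemma exists_iterSplitClosure_slope_le {G : Set (MixedSpace p q → ℝ)}
    (hG : ∀ s > 0, Liftable ((fun g z => s * W z - g z) '' G) W) (hQ : Convex ℝ Q) {s₀ s : ℝ}
    (h₀ : ∀ z ∈ Q, 1 - s₀ * W z ≤ v z) (h : ∀ g ∈ G, ∀ z ∈ Q, 1 - g z ≤ v z) (hs : 0 < s)
    (hss₀ : s ≤ s₀) : ∃ n, ∀ z ∈ iterSplitClosure n Q, 1 - s * W z ≤ v z := by
  have hs₀ : 0 < s₀ := hs.trans_le hss₀
  let slack (t : ℝ) : MixedSpace p q →ᵃ[ℝ] ℝ := v - (AffineMap.const ℝ _ 1 - t • W)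
  have hslack : ∀ t z, slack t z = v z - (1 - t * W z) := fun t z => by simp [slack]
  obtain ⟨k, hk⟩ := hG s₀ hs₀
  obtain ⟨κ, hκ, hk⟩ := hk 1 one_pos
  have hfirst : ∀ z ∈ iterSplitClosure k Q, 1 - (s₀ - κ) * W z ≤ v z := fun z hz => by
    have := hk Q (slack s₀) hQ (fun z hz => by simpa [hslack] using h₀ z hz)
      (forall_mem_image.2 fun g hg z hz => by rw [hslack]; linarith [h g hg z hz]) z hz
    rw [hslack] at this
    linarith
  obtain ⟨k', hk'⟩ := hG s hs
  obtain ⟨κ', hκ', hk'⟩ := hk' (min (κ / s₀) 1) (lt_min (by positivity) one_pos)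
  have hstep : ∀ n s', s < s' → s' ≤ s₀ - κ → (∀ z ∈ iterSplitClosure n Q, 1 - s' * W z ≤ v z) →
      ∀ z ∈ iterSplitClosure (k' + n) Q, 1 - (s' - κ') * W z ≤ v z := by
    intro n s' hss' hs' hv z hz
    rw [iterSplitClosure_add] at hz
    have hsub := iterSplitClosure_subset hQ n
    have := hk' _ (slack s') (convex_iterSplitClosure hQ n)
      (fun z hz => by simpa [hslack] using hv z hz) (forall_mem_image.2 fun g hg z hz =>
        (mul_sub_le_slack (by positivity) (min_le_right _ _)
          ((le_div_iff₀ hs₀).1 (min_le_left _ _)) hs.le hss'.le hs' (hv z hz) (h₀ z (hsub hz))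
          (h g hg z (hsub hz))).trans_eq (hslack s' z).symm) z hz
    rw [hslack] at this
    linarith
  obtain ⟨s', hs's, n, hv⟩ := exists_le_of_forall_sub
    (P := fun s' => ∃ n, ∀ z ∈ iterSplitClosure n Q, 1 - s' * W z ≤ v z) hκ' ⟨k, hfirst⟩
    fun s' hss' hs' ⟨n, hv⟩ => ⟨k' + n, hstep n s' hss' hs' hv⟩
  refine ⟨n, fun z hz => ?_⟩
  rcases le_total 0 (W z) with hW | hW
  · linarith [hv z hz, mul_le_mul_of_nonneg_right hs's hW]
  · linarith [h₀ z (iterSplitClosure_subset hQ n hz), mul_le_mul_of_nonpos_right hss₀ hW]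

lemma exists_iterSplitClosure_le_of_one_le (hX : IsIntegralFunctional X)
    (hY : IsIntegralFunctional Y) {a β s₀ s₁ s₂ c : ℝ} (ha : 0 < a) (hβ : 0 < β) (hs₁ : 0 < s₁)
    (hs₂ : 0 < s₂) (hc : 0 < c) (hcβ : c ≤ s₀ * β) (hQ : Convex ℝ Q)
    (h₀ : ∀ z ∈ Q, 1 - s₀ * (1 - Y z - β * (X z - 1)) ≤ v z)
    (h₁ : ∀ z ∈ Q, 1 - s₁ * (Y z - a * (X z - 1)) ≤ v z) (h₂ : ∀ z ∈ Q, 1 - s₂ * X z ≤ v z) :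
    ∃ n, ∀ z ∈ iterSplitClosure n Q, 1 ≤ Y z → 1 + c * (X z - 1) ≤ v z := by
  let W : MixedSpace p q →ᵃ[ℝ] ℝ :=
    AffineMap.const ℝ _ 1 - Y - β • (X - AffineMap.const ℝ _ 1)
  obtain ⟨n, hn⟩ := exists_iterSplitClosure_slope_le (W := W)
    (G := {fun z => s₁ * (Y z - a * (X z - 1)), fun z => s₂ * X z})
    (fun s hs => by rw [image_pair]; exact liftable_of_triangle hX hY ha hβ hs₁ hs₂ hs)
    hQ h₀ (by rintro _ (rfl | rfl); exacts [h₁, h₂]) (div_pos hc hβ) ((div_le_iff₀ hβ).2 hcβ)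
  refine ⟨n, fun z hz hYz => ?_⟩
  have hnz : 1 - c / β * (1 - Y z - β * (X z - 1)) ≤ v z := hn z hz
  have hcY : c / β * (1 - Y z) ≤ 0 :=
    mul_nonpos_of_nonneg_of_nonpos (by positivity) (sub_nonpos.2 hYz)
  have hcX : c / β * (β * (X z - 1)) = c * (X z - 1) := by field_simp
  linarith

/-- The sides through `(1, 1)` and `(1, 0)` are flattened until they agree on the line `X = 1` with
a common plane `1 + c (X - 1)`, which the split on `Y` then makes valid; a split on `X` flattens
this plane. -/
theorem exists_iterSplitClosure_one_le (hX : IsIntegralFunctional X) (hY : IsIntegralFunctional Y)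
    {a β s₀ s₁ s₂ : ℝ} (ha : 0 < a) (hβ : 0 < β) (hs₀ : 0 < s₀) (hs₁ : 0 < s₁) (hs₂ : 0 < s₂)
    (hQ : Convex ℝ Q) (h₀ : ∀ z ∈ Q, 1 - s₀ * (1 - Y z - β * (X z - 1)) ≤ v z)
    (h₁ : ∀ z ∈ Q, 1 - s₁ * (Y z - a * (X z - 1)) ≤ v z) (h₂ : ∀ z ∈ Q, 1 - s₂ * X z ≤ v z) :
    ∃ n, ∀ z ∈ iterSplitClosure n Q, 1 ≤ v z := by
  obtain ⟨c, hc, hcβ, hca⟩ : ∃ c > 0, c ≤ s₀ * β ∧ c ≤ s₁ * a :=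
    ⟨_, lt_min (mul_pos hs₀ hβ) (mul_pos hs₁ ha), min_le_left _ _, min_le_right _ _⟩
  obtain ⟨n₁, hn₁⟩ :=
    exists_iterSplitClosure_le_of_one_le hX hY ha hβ hs₁ hs₂ hc hcβ hQ h₀ h₁ h₂
  -- the reflection `Y ↦ 1 - Y` exchanges the two sides
  obtain ⟨n₂, hn₂⟩ := exists_iterSplitClosure_le_of_one_le hX (hY.const_sub 1) hβ ha hs₀ hs₂ hc hca
    hQ (fun z hz => by simpa using h₁ z hz)
    (fun z hz => by simpa [sub_right_comm] using h₀ z hz) h₂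
  have hplane : ∀ z ∈ iterSplitClosure (max n₁ n₂ + 1) Q, 1 + c * (X z - 1) ≤ v z := by
    rw [iterSplitClosure_succ]
    have hconv := convex_setOf_le (AffineMap.const ℝ _ 1 + c • (X - AffineMap.const ℝ _ 1)) v
    refine hY.splitClosure_subset 0 hconv (fun z hz hYz => ?_) fun z hz hYz => ?_
    · exact hn₂ z (iterSplitClosure_antitone hQ (le_max_right _ _) hz) (by simpa using hYz)
    · exact hn₁ z (iterSplitClosure_antitone hQ (le_max_left _ _) hz) (by simpa using hYz)
  refine ⟨max n₁ n₂ + 1 + 1, ?_⟩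
  rw [iterSplitClosure_succ]
  refine hX.splitClosure_subset 0 ((convex_Ici (1 : ℝ)).affine_preimage v) (fun z hz hXz => ?_)
    fun z hz hXz => ?_
  · have hXz' : s₂ * X z ≤ 0 := mul_nonpos_of_nonneg_of_nonpos hs₂.le (by simpa using hXz)
    exact (by linarith : 1 ≤ 1 - s₂ * X z).trans (h₂ z (iterSplitClosure_subset hQ _ hz))
  · have hXz' : 0 ≤ c * (X z - 1) := mul_nonneg hc.le (by simpa using hXz)
    exact (by linarith : 1 ≤ 1 + c * (X z - 1)).trans (hplane z hz)

end Pyramid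

/-! ### Lattice automorphisms of the plane -/

/-- The plane `ℝ²` with its sup-norm topology; its integer points are `latticePoints`. -/
abbrev Plane : Type := Fin 2 → ℝ

lemma intCast_mem_latticePoints (z : Fin 2 → ℤ) : (fun i => (z i : ℝ)) ∈ latticePoints := ⟨z, rfl⟩

/-- Affine automorphisms of the plane that preserve the integer lattice. -/
def IsUnimodular (φ : Plane ≃ᵃ[ℝ] Plane) : Prop :=
  ∀ x, φ x ∈ latticePoints ↔ x ∈ latticePoints

lemma IsTriangle.image {S : Set Plane} {v : Fin 3 → Plane} (h : IsTriangle S v)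
    (φ : Plane ≃ᵃ[ℝ] Plane) : IsTriangle (φ '' S) (φ ∘ v) := by
  refine ⟨h.1.map' φ.toAffineMap φ.injective, ?_⟩
  rw [h.2, range_comp]
  exact AffineMap.image_convexHull φ.toAffineMap _

namespace IsUnimodular

variable {φ ψ : Plane ≃ᵃ[ℝ] Plane} {S : Set Plane} {a b : Plane}

lemma symm (hφ : IsUnimodular φ) : IsUnimodular φ.symm := fun x => by
  rw [← hφ, AffineEquiv.apply_symm_apply]

lemma trans (hφ : IsUnimodular φ) (hψ : IsUnimodular ψ) : IsUnimodular (φ.trans ψ) :=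
  fun x => (hψ (φ x)).trans (hφ x)

lemma image_latticePoints (hφ : IsUnimodular φ) : φ '' latticePoints = latticePoints := by
  ext x
  exact ⟨by rintro ⟨y, hy, rfl⟩; exact (hφ y).2 hy,
    fun hx => ⟨φ.symm x, (hφ.symm x).2 hx, φ.apply_symm_apply x⟩⟩

lemma latticeFree (hφ : IsUnimodular φ) (h : LatticeFree S) : LatticeFree (φ '' S) := by
  have himage : φ '' interior S = interior (φ '' S) :=
    φ.toContinuousAffineEquiv.toHomeomorph.image_interior S
  rw [LatticeFree, ← himage, ← hφ.image_latticePoints]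
  exact disjoint_image_of_injective φ.injective h

lemma image_openSegment_inter (hφ : IsUnimodular φ) (a b : Plane) :
    φ '' (openSegment ℝ a b ∩ latticePoints) = openSegment ℝ (φ a) (φ b) ∩ latticePoints := by
  rw [image_inter φ.injective, hφ.image_latticePoints]
  exact congrArg (· ∩ latticePoints) (image_openSegment ℝ φ.toAffineMap a b)

lemma image_segment_inter (hφ : IsUnimodular φ) (a b : Plane) :
    φ '' (segment ℝ a b ∩ latticePoints) = segment ℝ (φ a) (φ b) ∩ latticePoints := by
  rw [image_inter φ.injective, hφ.image_latticePoints]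
  exact congrArg (· ∩ latticePoints) (image_segment ℝ φ.toAffineMap a b)

lemma oneInside (hφ : IsUnimodular φ) (h : OneInside a b) : OneInside (φ a) (φ b) := by
  obtain ⟨p, hp, hunique⟩ := h
  rw [OneInside, ← hφ.image_openSegment_inter]
  refine ⟨φ p, mem_image_of_mem _ hp, ?_⟩
  rintro _ ⟨q, hq, rfl⟩
  rw [hunique q hq]

lemma isT2A (hφ : IsUnimodular φ) (h : IsT2A S) : IsT2A (φ '' S) := by
  obtain ⟨hS, v, hv, h₀, h₁₂, h₀₁, h₀₂⟩ := h
  exact ⟨hφ.latticeFree hS, φ ∘ v, hv.image φ, fun h => h₀ ((hφ _).1 h),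
    hφ.image_segment_inter _ _ ▸ h₁₂.image φ.injective, hφ.oneInside h₀₁, hφ.oneInside h₀₂⟩

lemma isT2B (hφ : IsUnimodular φ) (h : IsT2B S) : IsT2B (φ '' S) := by
  obtain ⟨hS, ⟨v, hv, h₀, h₁₂, h₀₁, h₀₂⟩, T, hT, hST⟩ := h
  refine ⟨hφ.latticeFree hS, ⟨φ ∘ v, hv.image φ, fun h => h₀ ((hφ _).1 h),
    hφ.image_segment_inter _ _ ▸ h₁₂.image φ.injective, hφ.oneInside h₀₁, ?_⟩, _, hφ.isT2A hT,
    image_mono hST⟩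
  exact (hφ.image_openSegment_inter _ _).symm.trans (by rw [h₀₂, image_empty])

lemma exists_intCast (hφ : IsUnimodular φ) (z : Fin 2 → ℤ) :
    ∃ w : Fin 2 → ℤ, φ (fun i => (z i : ℝ)) = fun i => (w i : ℝ) :=
  (hφ _).2 (intCast_mem_latticePoints z)

lemma exists_map_eq_toMatrix' (hφ : IsUnimodular φ) : ∃ M : Matrix (Fin 2) (Fin 2) ℤ,
    M.map (fun z : ℤ => (z : ℝ)) = LinearMap.toMatrix' (φ.linear : Plane →ₗ[ℝ] Plane) := by
  obtain ⟨c, hc⟩ := hφ.exists_intCast 0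
  choose w hw using fun j => hφ.exists_intCast (Pi.single j 1)
  refine ⟨.of fun i j => w j i - c i, Matrix.ext fun i j => ?_⟩
  have hzero : φ 0 = fun i => (c i : ℝ) := by simpa [Pi.zero_def] using hc
  have hunit : φ (Pi.single j 1) = fun i => (w j i : ℝ) := by
    rw [← hw j]
    congr 1
    ext l
    simp [Pi.single_apply]
  have hlinear : φ.linear (Pi.single j 1) = φ (Pi.single j 1) - φ 0 := by
    simpa using φ.toAffineMap.linearMap_vsub (Pi.single j 1) 0
  simp [LinearMap.toMatrix'_apply, hlinear, hzero, hunit]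

lemma exists_intAffine (hφ : IsUnimodular φ) :
    ∃ (M : Matrix (Fin 2) (Fin 2) ℤ) (w : Fin 2 → ℤ), IsUnit M.det ∧ φ = intAffine M w := by
  obtain ⟨M, hM⟩ := hφ.exists_map_eq_toMatrix'
  obtain ⟨N, hN⟩ := hφ.symm.exists_map_eq_toMatrix'
  obtain ⟨d, hd⟩ := hφ.symm.exists_intCast 0
  have hsymm : φ.symm 0 = fun i => (d i : ℝ) := by simpa [Pi.zero_def] using hd
  refine ⟨M, -d, Matrix.isUnit_det_of_right_inverse (B := N) ?_, funext fun x => ?_⟩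
  · refine Matrix.map_injective (Int.cast_injective (α := ℝ)) ?_
    have hcomp : (φ.linear : Plane →ₗ[ℝ] Plane) ∘ₗ φ.symm.linear = LinearMap.id :=
      LinearMap.ext φ.linear.apply_symm_apply
    calc (M * N).map (Int.castRingHom ℝ) = M.map (Int.castRingHom ℝ) * N.map (Int.castRingHom ℝ) :=
          Matrix.map_mul
      _ = LinearMap.toMatrix' LinearMap.id := by
          rw [← hcomp, LinearMap.toMatrix'_comp]; exact congrArg₂ _ hM hN
      _ = (1 : Matrix (Fin 2) (Fin 2) ℤ).map (Int.castRingHom ℝ) := by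
          rw [LinearMap.toMatrix'_id, Matrix.map_one _ (map_zero _) (map_one _)]
  · calc φ x = φ.linear (x - φ.symm 0) := by
          simpa using (φ.toAffineMap.linearMap_vsub x (φ.symm 0)).symm
      _ = intAffine M (-d) x := by
          rw [intAffine, hM, LinearMap.toMatrix'_mulVec, hsymm]
          exact congrArg _ (funext fun i => by simp [sub_eq_add_neg])

end IsUnimodular

lemma exists_isUnimodular {M : Matrix (Fin 2) (Fin 2) ℤ} (hM : IsUnit M.det) (c : Fin 2 → ℤ) :
    ∃ φ : Plane ≃ᵃ[ℝ] Plane, IsUnimodular φ ∧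
      ∀ x i, φ x i = M i 0 * x 0 + M i 1 * x 1 + c i := by
  let A : Matrix (Fin 2) (Fin 2) ℝ := (Int.castRingHom ℝ).mapMatrix M
  let B : Matrix (Fin 2) (Fin 2) ℝ := (Int.castRingHom ℝ).mapMatrix M⁻¹
  have hAB : A * B = 1 := by rw [← map_mul, M.mul_nonsing_inv hM, map_one]
  have hBA : B * A = 1 := by rw [← map_mul, M.nonsing_inv_mul hM, map_one]
  let φ : Plane ≃ᵃ[ℝ] Plane := (Matrix.toLin'OfInv hBA hAB).toAffineEquiv.trans
    (AffineEquiv.constVAdd ℝ Plane fun i => (c i : ℝ))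
  have hφ : ∀ x i, φ x i = M i 0 * x 0 + M i 1 * x 1 + c i := fun x i => by
    simp [φ, A, Matrix.mulVec, dotProduct, Fin.sum_univ_two, add_comm]
  refine ⟨φ, fun x => ⟨fun ⟨z, hz⟩ => ⟨M⁻¹.mulVec (z - c), φ.injective ?_⟩, ?_⟩, hφ⟩
  · have hinv : M.mulVec (M⁻¹.mulVec (z - c)) = z - c := by
      rw [Matrix.mulVec_mulVec, M.mul_nonsing_inv hM, Matrix.one_mulVec]
    ext i
    have hinv_apply := congrArg (Int.cast (R := ℝ)) (congrFun hinv i)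
    rw [hz, hφ]
    generalize M⁻¹.mulVec (z - c) = y at hinv_apply ⊢
    simp only [Matrix.mulVec, dotProduct, Fin.sum_univ_two, Pi.sub_apply] at hinv_apply
    push_cast at hinv_apply
    linarith
  · rintro ⟨z, rfl⟩
    refine ⟨fun i => M i 0 * z 0 + M i 1 * z 1 + c i, funext fun i => ?_⟩
    simp [hφ]

/-! ### Affine functionals -/

section AffineFunctional

variable {E : Type*} [NormedAddCommGroup E] [NormedSpace ℝ E] {g : E →ᵃ[ℝ] ℝ} {S : Set E} {x f : E}

lemma nonneg_of_mem_convexHull (h : ∀ y ∈ S, 0 ≤ g y) (hx : x ∈ convexHull ℝ S) : 0 ≤ g x :=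
  convexHull_min h ((convex_Ici 0).affine_preimage g) hx

lemma pos_of_mem_interior [FiniteDimensional ℝ E] (hg : Function.Surjective g)
    (h : ∀ y ∈ S, 0 ≤ g y) (hx : x ∈ interior S) : 0 < g x := by
  have hopen : IsOpenMap g := by
    rw [← AffineMap.isOpenMap_linear_iff]
    exact g.linear.isOpenMap_of_finiteDimensional (g.linear_surjective_iff.2 hg)
  have hsubset : g '' interior S ⊆ interior (Ici 0) :=
    (hopen.image_interior_subset S).trans (interior_mono (image_subset_iff.2 h))
  rw [interior_Ici] at hsubset
  exact hsubset (mem_image_of_mem g hx)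

lemma affineMap_apply_add (g : E →ᵃ[ℝ] ℝ) (x d : E) : g (x + d) = g x + g.linear d := by
  rw [add_comm x, ← vadd_eq_add, g.map_vadd, vadd_eq_add, add_comm]

lemma linear_nonneg_of_hull_eq_top {ι : Type*} {R : ι → E} {l : E →ₗ[ℝ] ℝ}
    (hR : PointedCone.hull ℝ (range R) = ⊤) (h : ∀ i, 0 ≤ l (R i)) (d : E) : 0 ≤ l d := by
  have hle : PointedCone.hull ℝ (range R) ≤ (PointedCone.positive ℝ ℝ).comap l :=
    Submodule.span_le.2 (by rintro _ ⟨i, rfl⟩; exact h i)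
  have hd : d ∈ PointedCone.hull ℝ (range R) := hR ▸ Submodule.mem_top
  exact hle hd

lemma pos_of_hull_eq_top {ι : Type*} {R : ι → E} {α : ι → ℝ}
    (hR : PointedCone.hull ℝ (range R) = ⊤) (hα : ∀ i, 0 < α i) (hg : Function.Surjective g)
    (h : ∀ i, 0 ≤ g (f + (α i)⁻¹ • R i)) : 0 < g f := by
  by_contra! hf
  have hlinear : ∀ i, 0 ≤ g.linear (R i) := fun i => by
    have hi := h i
    rw [affineMap_apply_add, map_smul, smul_eq_mul] at hi
    exact nonneg_of_mul_nonneg_right (by linarith) (inv_pos.2 (hα i))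
  obtain ⟨x, hx⟩ := hg (g f - 1)
  have hd := linear_nonneg_of_hull_eq_top hR hlinear (x - f)
  rw [← add_sub_cancel f x, affineMap_apply_add] at hx
  linarith

end AffineFunctional

section Cut

variable {k : ℕ} {f : Plane} {R : Fin k → Plane} {α : Fin k → ℝ}

lemma affineMap_fst_eq (hα : ∀ i, 0 < α i) (g : Plane →ᵃ[ℝ] ℝ) {z : MixedSpace 2 k}
    (hz : z ∈ relaxP f R) :
    g z.1 = g f * (1 - ∑ i, α i * z.2 i) + ∑ i, α i * z.2 i * g (f + (α i)⁻¹ • R i) := by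
  have hray : ∀ i, α i * z.2 i * g (f + (α i)⁻¹ • R i) =
      g f * (α i * z.2 i) + z.2 i * g.linear (R i) := fun i => by
    have hi := (hα i).ne'
    rw [affineMap_apply_add, map_smul, smul_eq_mul]
    field_simp
  rw [Finset.sum_congr rfl fun i _ => hray i, Finset.sum_add_distrib, ← Finset.mul_sum, hz.1,
    affineMap_apply_add, map_sum]
  simp only [map_smul, smul_eq_mul]
  ring

lemma sub_mul_sum_le (hα : ∀ i, 0 < α i) {g : Plane →ᵃ[ℝ] ℝ}
    (h : ∀ i, 0 ≤ g (f + (α i)⁻¹ • R i)) {z : MixedSpace 2 k} (hz : z ∈ relaxP f R) :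
    g f * (1 - ∑ i, α i * z.2 i) ≤ g z.1 := by
  rw [affineMap_fst_eq hα g hz]
  exact le_add_of_nonneg_right
    (Finset.sum_nonneg fun i _ => mul_nonneg (mul_nonneg (hα i).le (hz.2 i)) (h i))

end Cut

/-- The affine functional `x ↦ a x₀ + b x₁ + c` on the plane. -/
def planeForm (a b c : ℝ) : Plane →ᵃ[ℝ] ℝ :=
  (a • LinearMap.proj 0 + b • LinearMap.proj 1 : Plane →ₗ[ℝ] ℝ).toAffineMap +
    AffineMap.const ℝ Plane c

lemma planeForm_apply (a b c : ℝ) (x : Plane) : planeForm a b c x = a * x 0 + b * x 1 + c := by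
  simp [planeForm]

lemma planeForm_surjective {a b : ℝ} (hab : a ≠ 0 ∨ b ≠ 0) (c : ℝ) :
    Function.Surjective (planeForm a b c) := fun t => by
  rcases hab with ha | hb
  · exact ⟨![(t - c) / a, 0], by simp [planeForm_apply, mul_div_cancel₀, ha]⟩
  · exact ⟨![0, (t - c) / b], by simp [planeForm_apply, mul_div_cancel₀, hb]⟩

lemma planeForm_pos_of_hull_eq_top {k : ℕ} {f : Plane} {R : Fin k → Plane} {α : Fin k → ℝ}
    (hR : PointedCone.hull ℝ (range R) = ⊤) (hα : ∀ i, 0 < α i) {φ : Plane ≃ᵃ[ℝ] Plane}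
    {a b c : ℝ} (hab : a ≠ 0 ∨ b ≠ 0)
    (h : ∀ i, 0 ≤ planeForm a b c (φ (f + (α i)⁻¹ • R i))) : 0 < planeForm a b c (φ f) :=
  pos_of_hull_eq_top (g := (planeForm a b c).comp φ.toAffineMap) hR hα
    (by simpa using (planeForm_surjective hab c).comp φ.surjective) h

lemma IsUnimodular.isIntegralFunctional_apply {φ : Plane ≃ᵃ[ℝ] Plane} (hφ : IsUnimodular φ)
    (k : ℕ) (i : Fin 2) : IsIntegralFunctional
      ((AffineMap.proj i).comp (φ.toAffineMap.comp AffineMap.fst) : MixedSpace 2 k →ᵃ[ℝ] ℝ) := by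
  obtain ⟨M, w, -, hMw⟩ := hφ.exists_intAffine
  refine ⟨M i, ∑ j, M i j * w j, fun z => ?_⟩
  have hz : φ z.1 i = intAffine M w z.1 i := congrFun (congrFun hMw z.1) i
  simpa [intAffine, Matrix.mulVec, dotProduct, mul_add, Finset.sum_add_distrib] using hz

/-- The region between the line `x₀ = 0`, the line of slope `-β` through `(1, 1)` and the line of
slope `a` through `(1, 0)`, a triangle for `0 < a` and `0 < β`. It is the normal form of the
triangles of type `T²ᴬ`. -/
def normalTriangle (a β : ℝ) : Set Plane :=
  {x | 0 ≤ x 0 ∧ x 1 ≤ 1 - β * (x 0 - 1) ∧ a * (x 0 - 1) ≤ x 1}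

lemma mem_normalTriangle_iff {a β : ℝ} {x : Plane} :
    x ∈ normalTriangle a β ↔ 0 ≤ planeForm 1 0 0 x ∧ 0 ≤ planeForm (-β) (-1) (1 + β) x ∧
      0 ≤ planeForm (-a) 1 a x := by
  simp only [planeForm_apply]
  constructor <;> rintro ⟨h₀, h₁, h₂⟩ <;> refine ⟨?_, ?_, ?_⟩ <;> linarith

lemma convex_normalTriangle (a β : ℝ) : Convex ℝ (normalTriangle a β) := by
  have h : normalTriangle a β = planeForm 1 0 0 ⁻¹' Ici 0 ∩
      (planeForm (-β) (-1) (1 + β) ⁻¹' Ici 0 ∩ planeForm (-a) 1 a ⁻¹' Ici 0) :=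
    ext fun x => mem_normalTriangle_iff
  rw [h]
  exact ((convex_Ici 0).affine_preimage _).inter
    (((convex_Ici 0).affine_preimage _).inter ((convex_Ici 0).affine_preimage _))

/-- Up to the factor `1 / g f`, each side functional `g` of the triangle bounds `1 - ∑ αᵢ sᵢ` on the
relaxation, which puts the cut into the scope of `exists_iterSplitClosure_one_le`. -/
theorem cutRank_lt_top_of_mem_normalTriangle {k : ℕ} {f : Plane} {R : Fin k → Plane} {α : Fin k → ℝ}
    (hR : PointedCone.hull ℝ (range R) = ⊤) (hα : ∀ i, 0 < α i) {φ : Plane ≃ᵃ[ℝ] Plane}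
    (hφ : IsUnimodular φ) {a β : ℝ} (ha : 0 < a) (hβ : 0 < β)
    (h : ∀ i, φ (f + (α i)⁻¹ • R i) ∈ normalTriangle a β) : cutRank f R α < ⊤ := by
  have hbound : ∀ p q r : ℝ, p ≠ 0 ∨ q ≠ 0 →
      (∀ i, 0 ≤ planeForm p q r (φ (f + (α i)⁻¹ • R i))) →
      ∃ s > 0, ∀ z ∈ relaxP f R, 1 - s * planeForm p q r (φ z.1) ≤ ∑ i, α i * z.2 i := by
    intro p q r hpq h
    let g : Plane →ᵃ[ℝ] ℝ := (planeForm p q r).comp φ.toAffineMap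
    have hgf : 0 < g f := planeForm_pos_of_hull_eq_top hR hα hpq h
    refine ⟨(g f)⁻¹, inv_pos.2 hgf, fun z hz => ?_⟩
    have hz := sub_mul_sum_le (g := g) hα h hz
    have : 1 - ∑ i, α i * z.2 i ≤ (g f)⁻¹ * g z.1 := (le_inv_mul_iff₀ hgf).2 hz
    exact sub_le_comm.1 this
  obtain ⟨s₀, hs₀, h₀⟩ := hbound _ _ _ (by norm_num) fun i => (mem_normalTriangle_iff.1 (h i)).2.1
  obtain ⟨s₁, hs₁, h₁⟩ := hbound _ _ _ (by norm_num) fun i => (mem_normalTriangle_iff.1 (h i)).2.2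
  obtain ⟨s₂, hs₂, h₂⟩ := hbound _ _ _ (by norm_num) fun i => (mem_normalTriangle_iff.1 (h i)).1
  let v : MixedSpace 2 k →ᵃ[ℝ] ℝ :=
    ((∑ i, α i • LinearMap.proj i) ∘ₗ LinearMap.snd ℝ _ _).toAffineMap
  have hv : ∀ z, v z = ∑ i, α i * z.2 i := fun z => by simp [v]
  simp only [planeForm_apply, ← hv] at h₀ h₁ h₂
  obtain ⟨n, hn⟩ := exists_iterSplitClosure_one_le (hφ.isIntegralFunctional_apply k 0)
    (hφ.isIntegralFunctional_apply k 1) ha hβ hs₀ hs₁ hs₂ (convex_relaxP f R)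
    (fun z hz => (h₀ z hz).trans' (le_of_eq (by dsimp; ring)))
    (fun z hz => (h₁ z hz).trans' (le_of_eq (by dsimp; ring)))
    (fun z hz => (h₂ z hz).trans' (le_of_eq (by dsimp; ring)))
  exact cutRank_lt_top (n := n) (cutValidOn_iff.2 fun z hz => (hv z).symm ▸ hn z hz)

/-! ### Oriented areas -/

section Orient

variable {a b c x : Plane} {v : Fin 3 → Plane}

lemma orient_rotate (a b c : Plane) : orient a b c = orient b c a := by
  unfold orient
  ring

lemma orient_add_orient_add_orient (a b c x : Plane) :
    orient x b c + orient a x c + orient a b x = orient a b c := by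
  unfold orient
  ring

lemma orient_smul_add_orient_smul_add_orient_smul (a b c x : Plane) :
    orient x b c • a + orient a x c • b + orient a b x • c = orient a b c • x := by
  ext i
  simp only [orient, Pi.add_apply, Pi.smul_apply, smul_eq_mul]
  fin_cases i <;> simp only [Fin.zero_eta, Fin.mk_one] <;> ring

lemma orient_eq_planeForm (b c x : Plane) :
    orient x b c = planeForm (b 1 - c 1) (c 0 - b 0) (b 0 * c 1 - b 1 * c 0) x := by
  rw [orient, planeForm_apply]
  ring

lemma affineIndependent_of_orient_ne_zero (h : orient (v 0) (v 1) (v 2) ≠ 0) :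
    AffineIndependent ℝ v := by
  rw [affineIndependent_iff_not_collinear]
  intro hcollinear
  obtain ⟨d, hd⟩ := (collinear_iff_of_mem (mem_range_self 0)).1 hcollinear
  obtain ⟨r, hr⟩ := hd _ (mem_range_self 1)
  obtain ⟨s, hs⟩ := hd _ (mem_range_self 2)
  apply h
  rw [orient, hr, hs]
  simp only [vadd_eq_add, Pi.add_apply, Pi.smul_apply, smul_eq_mul]
  ring

lemma mem_convexHull_range_iff_orient (h : 0 < orient (v 0) (v 1) (v 2)) :
    x ∈ convexHull ℝ (range v) ↔
      0 ≤ orient x (v 1) (v 2) ∧ 0 ≤ orient (v 0) x (v 2) ∧ 0 ≤ orient (v 0) (v 1) x := by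
  constructor
  · intro hx
    rw [orient_rotate (v 0) x, ← orient_rotate x (v 0) (v 1)]
    simp only [orient_eq_planeForm]
    refine ⟨nonneg_of_mem_convexHull ?_ hx, nonneg_of_mem_convexHull ?_ hx,
      nonneg_of_mem_convexHull ?_ hx⟩ <;>
      rintro _ ⟨i, rfl⟩ <;> rw [← orient_eq_planeForm] <;> unfold orient at * <;>
      fin_cases i <;> simp only [Fin.zero_eta, Fin.mk_one, Fin.reduceFinMk] <;> linarith
  · rintro ⟨h₀, h₁, h₂⟩
    have hmem := (convex_convexHull ℝ (range v)).sum_mem (t := Finset.univ)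
      (w := ![orient x (v 1) (v 2) / orient (v 0) (v 1) (v 2),
        orient (v 0) x (v 2) / orient (v 0) (v 1) (v 2),
        orient (v 0) (v 1) x / orient (v 0) (v 1) (v 2)]) (z := v)
      (by
        intro i _
        fin_cases i
        exacts [div_nonneg h₀ h.le, div_nonneg h₁ h.le, div_nonneg h₂ h.le])
      (by
        simp only [Fin.sum_univ_three, Matrix.cons_val, ← add_div]
        rw [orient_add_orient_add_orient, div_self h.ne'])
      (fun i _ => subset_convexHull ℝ _ (mem_range_self i))
    simp only [Fin.sum_univ_three, Matrix.cons_val, div_eq_inv_mul, mul_smul, ← smul_add] at hmem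
    rwa [orient_smul_add_orient_smul_add_orient_smul, inv_smul_smul₀ h.ne'] at hmem

lemma mem_interior_convexHull_range_iff_orient (h : 0 < orient (v 0) (v 1) (v 2)) :
    x ∈ interior (convexHull ℝ (range v)) ↔
      0 < orient x (v 1) (v 2) ∧ 0 < orient (v 0) x (v 2) ∧ 0 < orient (v 0) (v 1) x := by
  constructor
  · have hpos : ∀ b c : Plane, b ≠ c → (∀ y ∈ convexHull ℝ (range v), 0 ≤ orient y b c) →
        x ∈ interior (convexHull ℝ (range v)) → 0 < orient x b c := fun b c hbc hy hx => by
      simp only [orient_eq_planeForm] at hy ⊢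
      refine pos_of_mem_interior (planeForm_surjective ?_ _) hy hx
      by_contra! hcon
      refine hbc (funext fun i => ?_)
      fin_cases i <;> simp only [Fin.zero_eta, Fin.mk_one] <;> linarith
    intro hx
    rw [orient_rotate (v 0) x, ← orient_rotate x (v 0) (v 1)]
    have hv := (affineIndependent_of_orient_ne_zero h.ne').injective
    refine ⟨hpos _ _ (hv.ne (by decide)) (fun y hy => ?_) hx,
      hpos _ _ (hv.ne (by decide)) (fun y hy => ?_) hx,
      hpos _ _ (hv.ne (by decide)) (fun y hy => ?_) hx⟩
    · exact ((mem_convexHull_range_iff_orient h).1 hy).1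
    · exact orient_rotate _ y _ ▸ ((mem_convexHull_range_iff_orient h).1 hy).2.1
    · exact (orient_rotate y _ _).symm ▸ ((mem_convexHull_range_iff_orient h).1 hy).2.2
  · intro hx
    refine interior_maximal (t := {y | 0 < orient y (v 1) (v 2) ∧ 0 < orient (v 0) y (v 2) ∧
      0 < orient (v 0) (v 1) y}) (fun y ⟨h₀, h₁, h₂⟩ =>
        (mem_convexHull_range_iff_orient h).2 ⟨h₀.le, h₁.le, h₂.le⟩) ?_ hx
    unfold orient
    simp only [ofPred_and]
    exact (isOpen_lt (by fun_prop) (by fun_prop)).inter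
      ((isOpen_lt (by fun_prop) (by fun_prop)).inter (isOpen_lt (by fun_prop) (by fun_prop)))

end Orient

/-! ### Triangles of type `T²ᴬ` in normal form -/

lemma exists_apply_ne_zero_of_affineIndependent {v : Fin 3 → Plane} (hv : AffineIndependent ℝ v)
    {g : Plane →ᵃ[ℝ] ℝ} (hg : Function.Surjective g) : ∃ i, g (v i) ≠ 0 := by
  by_contra! h
  have hspan : affineSpan ℝ (range v) = ⊤ :=
    hv.affineSpan_eq_top_iff_card_eq_finrank_add_one.2 (by simp)
  have hzero : g = AffineMap.const ℝ Plane 0 :=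
    AffineMap.ext_on hspan (by rintro _ ⟨i, rfl⟩; exact h i)
  obtain ⟨x, hx⟩ := hg 1
  simp [hzero] at hx

lemma exists_isUnimodular_apply_eq_zero {P P' : Fin 2 → ℤ} (hne : P ≠ P') :
    ∃ (φ : Plane ≃ᵃ[ℝ] Plane) (g : ℝ), IsUnimodular φ ∧ 1 ≤ g ∧ φ (fun i => P i) = 0 ∧
      φ (fun i => P' i) = ![0, g] := by
  have hg : 0 < Int.gcd (P' 0 - P 0) (P' 1 - P 1) := by
    rw [Int.gcd_pos_iff]
    by_contra! hcon
    refine hne (funext fun i => ?_)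
    fin_cases i
    exacts [(sub_eq_zero.1 hcon.1).symm, (sub_eq_zero.1 hcon.2).symm]
  obtain ⟨d₀, d₁, hd, hd₀, hd₁⟩ := Int.exists_gcd_one hg
  generalize Int.gcd (P' 0 - P 0) (P' 1 - P 1) = g at hg hd₀ hd₁
  obtain ⟨u, w, huw⟩ := Int.isCoprime_iff_gcd_eq_one.2 hd
  have hd₀ : (P' 0 : ℝ) = P 0 + d₀ * g := by rw [← sub_eq_iff_eq_add']; exact_mod_cast hd₀
  have hd₁ : (P' 1 : ℝ) = P 1 + d₁ * g := by rw [← sub_eq_iff_eq_add']; exact_mod_cast hd₁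
  have huw_real : (u : ℝ) * d₀ + w * d₁ = 1 := by exact_mod_cast huw
  obtain ⟨φ, hφ, hφ_apply⟩ := exists_isUnimodular (M := !![d₁, -d₀; u, w])
    (by rw [Matrix.det_fin_two_of, show d₁ * w - -d₀ * u = 1 by linear_combination huw]
        exact isUnit_one)
    ![-(d₁ * P 0 - d₀ * P 1), -(u * P 0 + w * P 1)]
  refine ⟨φ, g, hφ, by exact_mod_cast hg, ?_, ?_⟩ <;> ext i <;> rw [hφ_apply] <;> fin_cases i <;>
    simp [hd₀, hd₁]
  · ring
  · ring
  · linear_combination (g : ℝ) * huw_real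

lemma apply_zero_eq_zero_of_mem_segment {a b : Plane} {g : ℝ} (hg : 1 ≤ g)
    (h₀ : 0 ∈ segment ℝ a b) (hg_mem : ![0, g] ∈ segment ℝ a b) :
    a 0 = 0 ∧ b 0 = 0 ∧ (1 ≤ a 1 ∧ b 1 ≤ 0 ∨ 1 ≤ b 1 ∧ a 1 ≤ 0) := by
  rw [segment_eq_image'] at h₀ hg_mem
  obtain ⟨t, ⟨ht₀, ht₁⟩, ht⟩ := h₀
  obtain ⟨t', ⟨ht₀', ht₁'⟩, ht'⟩ := hg_mem
  have ht_apply := fun i => congrFun ht i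
  have ht_apply' := fun i => congrFun ht' i
  simp only [Fin.forall_fin_two, Pi.add_apply, Pi.smul_apply, Pi.sub_apply, smul_eq_mul,
    Pi.zero_apply, Matrix.cons_val_zero, Matrix.cons_val_one] at ht_apply ht_apply'
  have hheight : (t' - t) * (b 1 - a 1) = g := by linarith
  have hne : t' - t ≠ 0 := fun h => by rw [h, zero_mul] at hheight; linarith
  have hab : b 0 - a 0 = 0 := by
    have : (t' - t) * (b 0 - a 0) = 0 := by linarith
    exact (mul_eq_zero.1 this).resolve_left hne
  have ha : a 0 = 0 := by simpa [hab] using ht_apply.1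
  refine ⟨ha, by linarith, ?_⟩
  rcases le_total 0 (b 1 - a 1) with h | h
  · right
    constructor <;> nlinarith
  · left
    constructor <;> nlinarith

lemma exists_isUnimodular_reflection :
    ∃ ρ : Plane ≃ᵃ[ℝ] Plane, IsUnimodular ρ ∧ ∀ x, ρ x = ![-x 0, x 1] := by
  obtain ⟨ρ, hρ, hρ_apply⟩ := exists_isUnimodular (M := !![-1, 0; 0, 1])
    (by rw [Matrix.det_fin_two_of]; norm_num) 0
  refine ⟨ρ, hρ, fun x => funext fun i => ?_⟩
  rw [hρ_apply]
  fin_cases i <;> simp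

lemma exists_isUnimodular_apply_zero_pos {v : Fin 3 → Plane} (hv : AffineIndependent ℝ v)
    (h₁ : v 1 0 = 0) (h₂ : v 2 0 = 0) :
    ∃ ρ : Plane ≃ᵃ[ℝ] Plane, IsUnimodular ρ ∧ 0 < ρ (v 0) 0 ∧ ∀ x, x 0 = 0 → ρ x = x := by
  have h₀ : v 0 0 ≠ 0 := fun h₀ => by
    obtain ⟨i, hi⟩ := exists_apply_ne_zero_of_affineIndependent hv
      (planeForm_surjective (b := 0) (.inl one_ne_zero) 0)
    have hi' : v i 0 ≠ 0 := by simpa [planeForm_apply] using hi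
    fin_cases i
    exacts [hi' h₀, hi' h₁, hi' h₂]
  rcases h₀.lt_or_gt with h₀ | h₀
  · obtain ⟨ρ, hρ, hρ_apply⟩ := exists_isUnimodular_reflection
    refine ⟨ρ, hρ, by simpa [hρ_apply] using h₀, fun x hx => ?_⟩
    rw [hρ_apply, hx]
    ext i
    fin_cases i <;> simp [hx]
  · exact ⟨.refl ℝ Plane, fun _ => Iff.rfl, h₀, fun _ _ => rfl⟩

lemma exists_coords_of_segment {v : Fin 3 → Plane} (hv : AffineIndependent ℝ v)
    (h₁₂ : (segment ℝ (v 1) (v 2) ∩ latticePoints).Nontrivial) :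
    ∃ φ : Plane ≃ᵃ[ℝ] Plane, IsUnimodular φ ∧ φ (v 1) 0 = 0 ∧ φ (v 2) 0 = 0 ∧ 0 < φ (v 0) 0 ∧
      (1 ≤ φ (v 1) 1 ∧ φ (v 2) 1 ≤ 0 ∨ 1 ≤ φ (v 2) 1 ∧ φ (v 1) 1 ≤ 0) := by
  obtain ⟨_, ⟨hP, P, rfl⟩, _, ⟨hP', P', rfl⟩, hne⟩ := h₁₂
  obtain ⟨φ, g, hφ, hg, hφP, hφP'⟩ :=
    exists_isUnimodular_apply_eq_zero (P := P) (P' := P') (by rintro rfl; exact hne rfl)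
  have himage : φ '' segment ℝ (v 1) (v 2) = segment ℝ (φ (v 1)) (φ (v 2)) :=
    image_segment ℝ φ.toAffineMap _ _
  obtain ⟨h₁, h₂, hends⟩ := apply_zero_eq_zero_of_mem_segment hg
    (himage ▸ hφP ▸ mem_image_of_mem φ hP) (himage ▸ hφP' ▸ mem_image_of_mem φ hP')
  obtain ⟨ρ, hρ, hρ₀, hρ_apply⟩ := exists_isUnimodular_apply_zero_pos
    (hv.map' φ.toAffineMap φ.injective) h₁ h₂
  refine ⟨φ.trans ρ, hφ.trans hρ, ?_⟩
  simp only [AffineEquiv.trans_apply, hρ_apply _ h₁, hρ_apply _ h₂]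
  exact ⟨h₁, h₂, hρ₀, hends⟩

section Sides

variable {h t t₁ t₂ A B C : ℝ}

/-- The upper side contains the lattice point `(m, b)`. Hence at `x₀ = 1` it is not below `⌈b / m⌉`,
which lies above the lower side. -/
lemma exists_int_eq_add_slope (ht₁ : 1 ≤ t₁) (ht₂ : t₂ ≤ 0) {m b : ℤ} (hm : 0 < m)
    (hmb : t₁ + A * m = b) (hlt : t₂ + B * m < b)
    (hfree : ∀ j : ℤ, t₂ + B < j → t₁ + A ≤ j) : ∃ j : ℤ, t₁ + A = j := by
  have hm_real : (1 : ℝ) ≤ m := by exact_mod_cast hm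
  have hb_le : (b : ℝ) ≤ m * ⌈(b / m : ℝ)⌉ :=
    (div_le_iff₀' (by linarith)).1 (Int.le_ceil (b / m : ℝ))
  have hle_b : (m : ℝ) * ⌈(b / m : ℝ)⌉ ≤ b + m - 1 := by
    have hlt : (m : ℝ) * ⌈(b / m : ℝ)⌉ < m * (b / m + 1) := by
      gcongr
      exact Int.ceil_lt_add_one _
    rw [mul_add, mul_div_cancel₀ _ (by linarith : (m : ℝ) ≠ 0), mul_one] at hlt
    have hlt_int : m * ⌈(b / m : ℝ)⌉ < b + m := by exact_mod_cast hlt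
    exact_mod_cast Int.le_sub_one_of_lt hlt_int
  have hlower : t₂ + B < ⌈(b / m : ℝ)⌉ := by by_contra! hcon; nlinarith
  have hupper : (⌈(b / m : ℝ)⌉ : ℝ) ≤ t₁ + A := by by_contra! hcon; nlinarith
  exact ⟨_, le_antisymm (hfree _ hlower) hupper⟩

lemma lt_two_of_unique {c b : ℤ} (ht : t = c) (hb : t + C = b)
    (hvertex : ∀ j : ℤ, h = 2 → t + C * h ≠ j)
    (hunique : ∀ m n : ℤ, 0 < m → (m : ℝ) < h → t + C * m = n → m = 1) : h < 2 := by
  have htwo : t + C * 2 = (2 * b - c : ℤ) := by push_cast; linarith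
  rcases lt_trichotomy h 2 with hlt | rfl | hgt
  · exact hlt
  · exact absurd htwo (hvertex _ rfl)
  · have := hunique 2 _ two_pos (by exact_mod_cast hgt) (by exact_mod_cast htwo)
    contradiction

lemma exists_int_between (ht₁ : 1 ≤ t₁) (ht₂ : t₂ ≤ 0) (h₁ : t₁ = 1 → 2 < t₁ - t₂)
    (h₂ : t₂ = 0 → 2 < t₁ - t₂) : ∃ e : ℤ, t₂ < e ∧ e + 1 < t₁ := by
  rcases ht₁.eq_or_lt with rfl | ht₁
  · exact ⟨-1, by push_cast; linarith [h₁ rfl], by norm_num⟩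
  rcases ht₂.eq_or_lt with rfl | ht₂
  · exact ⟨1, by norm_num, by push_cast; linarith [h₂ rfl]⟩
  · exact ⟨0, by simpa, by simpa⟩

/-- In the coordinates where the long side lies on `x₀ = 0`, the other two sides are the graphs of
`t₁ + A x₀` and `t₂ + B x₀`, which meet at `x₀ = h`; their lattice points are on `x₀ = 1`. -/
lemma exists_consecutive_and_between (ht₁ : 1 ≤ t₁) (ht₂ : t₂ ≤ 0)
    (hAB : t₁ + A * h = t₂ + B * h) (hvertex : ∀ i j : ℤ, h = i → t₁ + A * h ≠ j)
    (hfree : ∀ j : ℤ, t₂ + B < j → t₁ + A ≤ j)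
    (hupper : ∃ m b : ℤ, 0 < m ∧ (m : ℝ) < h ∧ t₁ + A * m = b ∧
      ∀ i j : ℤ, 0 < i → (i : ℝ) < h → t₁ + A * i = j → i = m)
    (hlower : ∃ m b : ℤ, 0 < m ∧ (m : ℝ) < h ∧ t₂ + B * m = b ∧
      ∀ i j : ℤ, 0 < i → (i : ℝ) < h → t₂ + B * i = j → i = m) :
    ∃ b e : ℤ, t₁ + A = b + 1 ∧ t₂ + B = b ∧ t₂ < e ∧ e + 1 < t₁ := by
  obtain ⟨m, b, hm, hmh, hmb, hm_unique⟩ := hupper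
  obtain ⟨m', b', hm', hmh', hmb', hm_unique'⟩ := hlower
  have hone : 1 < h := hmh.trans_le' (by exact_mod_cast hm)
  have hgap : ∀ x, 0 < x → x < h → t₂ + B * x < t₁ + A * x := fun x hx hxh => by
    by_contra! hcon
    have : 0 < B - A := by nlinarith
    nlinarith
  obtain ⟨j, hj⟩ := exists_int_eq_add_slope ht₁ ht₂ hm hmb
    (hmb ▸ hgap m (by exact_mod_cast hm) hmh) hfree
  -- the reflection `x₁ ↦ 1 - x₁` exchanges the two sides
  obtain ⟨j', hj'⟩ := exists_int_eq_add_slope (t₁ := 1 - t₂) (t₂ := 1 - t₁) (A := -B) (B := -A)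
    (b := 1 - b') (by linarith) (by linarith) hm' (by push_cast; linarith)
    (by push_cast; linarith [hgap m' (by exact_mod_cast hm') hmh'])
    (fun i hi => by
      by_contra! hcon
      have := hfree (1 - i) (by push_cast; linarith)
      push_cast at this
      linarith)
  have hm_eq : 1 = m := hm_unique 1 j one_pos (by simpa) (by simpa)
  have hm_eq' : 1 = m' :=
    hm_unique' 1 (1 - j') one_pos (by simpa) (by push_cast; linarith)
  have hj_eq : (j : ℝ) = (1 - j') + 1 := by
    have hle := hfree (1 - j' + 1) (by push_cast; linarith)
    rw [hj] at hle
    have hlt : ((1 - j' : ℤ) : ℝ) < j := by push_cast; linarith [hgap 1 one_pos hone]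
    exact_mod_cast le_antisymm (Int.cast_le.1 hle) (Int.add_one_le_of_lt (Int.cast_lt.1 hlt))
  have hwidth : h < 2 → 2 < t₁ - t₂ := fun hh => by
    have : (t₁ - t₂) * (h - 1) = h := by
      linear_combination h * (hj + hj') - hAB + h * hj_eq
    nlinarith
  obtain ⟨e, he, he'⟩ := exists_int_between ht₁ ht₂
    (fun h₁ => hwidth (lt_two_of_unique (c := 1) (by simpa) hj (fun i hi => hvertex 2 i (by simpa))
      fun i n hi hih hn => (hm_unique i n hi hih hn).trans hm_eq.symm))
    (fun h₂ => hwidth (lt_two_of_unique (t := t₂) (C := B) (c := 0) (b := 1 - j') (by simpa)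
      (by push_cast; linarith) (fun i hi => hAB ▸ hvertex 2 i (by simpa))
      fun i n hi hih hn => (hm_unique' i n hi hih hn).trans hm_eq'.symm))
  exact ⟨1 - j', e, by push_cast; linarith, by push_cast; linarith, he, he'⟩

end Sides

lemma mem_openSegment_iff_graph {a w p : Plane} {C : ℝ} {i j : Fin 2} (hij : i ≠ j)
    (hw : w i = 0) (ha : 0 < a i) (hC : w j + C * a i = a j) :
    p ∈ openSegment ℝ a w ↔ 0 < p i ∧ p i < a i ∧ p j = w j + C * p i := by
  rw [openSegment_symm, openSegment_eq_image']
  constructor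
  · rintro ⟨θ, ⟨hθ₀, hθ₁⟩, rfl⟩
    simp only [Pi.add_apply, Pi.smul_apply, Pi.sub_apply, smul_eq_mul, hw, zero_add, sub_zero]
    exact ⟨by positivity, mul_lt_of_lt_one_left ha hθ₁, by rw [← hC]; ring⟩
  · rintro ⟨hp, hpa, hgraph⟩
    refine ⟨p i / a i, ⟨div_pos hp ha, (div_lt_one ha).2 hpa⟩, funext fun l => ?_⟩
    simp only [Pi.add_apply, Pi.smul_apply, Pi.sub_apply, smul_eq_mul]
    obtain rfl | rfl : l = i ∨ l = j := by omega
    · rw [hw, zero_add, sub_zero, div_mul_cancel₀ _ ha.ne']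
    · rw [hgraph, ← hC]
      field_simp
      ring

lemma OneInside.exists_int_graph {a w : Plane} {C : ℝ} (h : OneInside a w) (hw : w 0 = 0)
    (ha : 0 < a 0) (hC : w 1 + C * a 0 = a 1) :
    ∃ m b : ℤ, 0 < m ∧ (m : ℝ) < a 0 ∧ w 1 + C * m = b ∧
      ∀ i j : ℤ, 0 < i → (i : ℝ) < a 0 → w 1 + C * i = j → i = m := by
  obtain ⟨_, ⟨hp, p, rfl⟩, hunique⟩ := h
  obtain ⟨hm, hmh, hmb⟩ := (mem_openSegment_iff_graph zero_ne_one hw ha hC).1 hp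
  refine ⟨p 0, p 1, by exact_mod_cast hm, hmh, hmb.symm, fun i j hi hih hj => ?_⟩
  have hij := hunique (fun l => (![i, j] l : ℤ)) ⟨(mem_openSegment_iff_graph zero_ne_one hw ha hC).2
    ⟨by simpa using hi, by simpa using hih, by simpa using hj.symm⟩, ![i, j], rfl⟩
  exact Int.cast_injective (congrFun hij 0)

lemma mem_interior_convexHull_of_graphs {v : Fin 3 → Plane} {A B : ℝ} (h₁ : v 1 0 = 0)
    (h₂ : v 2 0 = 0) (h₀ : 0 < v 0 0) (h₂₁ : v 2 1 < v 1 1) (hA : v 1 1 + A * v 0 0 = v 0 1)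
    (hB : v 2 1 + B * v 0 0 = v 0 1) {x : Plane} (hx : 0 < x 0) (hBx : v 2 1 + B * x 0 < x 1)
    (hxA : x 1 < v 1 1 + A * x 0) : x ∈ interior (convexHull ℝ (range v)) := by
  have hx_pos := mul_pos hx (sub_pos.2 h₂₁)
  have hB_pos := mul_pos h₀ (sub_pos.2 hBx)
  have hA_pos := mul_pos h₀ (sub_pos.2 hxA)
  refine (mem_interior_convexHull_range_iff_orient ?_).2 ⟨?_, ?_, ?_⟩ <;>
    simp only [orient, h₁, h₂]
  · linarith [mul_pos h₀ (sub_pos.2 h₂₁)]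
  · linarith
  · linear_combination hB_pos - x 0 * hB
  · linear_combination hA_pos + x 0 * hA

lemma exists_coords_of_position {v : Fin 3 → Plane} (hfree : LatticeFree (convexHull ℝ (range v)))
    (h₁ : v 1 0 = 0) (h₂ : v 2 0 = 0) (h₀ : 0 < v 0 0) (h₁_le : 1 ≤ v 1 1) (h₂_le : v 2 1 ≤ 0)
    (hvertex : v 0 ∉ latticePoints) (hupper : OneInside (v 0) (v 1))
    (hlower : OneInside (v 0) (v 2)) :
    ∃ (ψ : Plane ≃ᵃ[ℝ] Plane) (a β : ℝ), IsUnimodular ψ ∧ 0 < a ∧ 0 < β ∧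
      MapsTo ψ (convexHull ℝ (range v)) (normalTriangle a β) := by
  obtain ⟨A, hA⟩ : ∃ A, v 1 1 + A * v 0 0 = v 0 1 := ⟨(v 0 1 - v 1 1) / v 0 0, by field_simp; ring⟩
  obtain ⟨B, hB⟩ : ∃ B, v 2 1 + B * v 0 0 = v 0 1 := ⟨(v 0 1 - v 2 1) / v 0 0, by field_simp; ring⟩
  obtain ⟨b, e, hb, hb', he, he'⟩ := exists_consecutive_and_between h₁_le h₂_le (hA.trans hB.symm)
    (fun i j hi hj => hvertex ⟨![i, j], by
      ext l; fin_cases l; exacts [hi, hA.symm.trans hj]⟩)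
    (fun j hj => by
      by_contra! hcon
      refine Disjoint.notMem_of_mem_left hfree ?_ (intCast_mem_latticePoints ![1, j])
      exact mem_interior_convexHull_of_graphs h₁ h₂ h₀ (by linarith) hA hB (by simp) (by simpa)
        (by simpa))
    (hupper.exists_int_graph h₁ h₀ hA) (hlower.exists_int_graph h₂ h₀ hB)
  -- the shear fixing the line `x₀ = 1` and sending `(0, e)` to `(0, 0)`, after `(1, b) ↦ (1, 0)`
  obtain ⟨ψ, hψ, hψ_apply⟩ := exists_isUnimodular (M := !![1, 0; e - b, 1])
    (by rw [Matrix.det_fin_two_of]; norm_num) ![0, -e]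
  have hψ₀ : ∀ x, ψ x 0 = x 0 := fun x => by simp [hψ_apply]
  have hψ₁ : ∀ x, ψ x 1 = x 1 - b + (e - b) * (x 0 - 1) := fun x => by
    simp [hψ_apply]; ring
  refine ⟨ψ, e - v 2 1, v 1 1 - 1 - e, hψ, by linarith, by linarith,
    convexHull_min ?_ (((convex_normalTriangle _ _).affine_preimage ψ.toAffineMap))⟩
  rintro _ ⟨i, rfl⟩
  change ψ (v i) ∈ normalTriangle _ _
  simp only [normalTriangle, mem_ofPred_eq, hψ₀, hψ₁]
  fin_cases i
  · refine ⟨h₀.le, ?_, ?_⟩ <;> simp only [Fin.zero_eta] <;> nlinarith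
  · simp only [Fin.mk_one, h₁]
    exact ⟨le_rfl, by linarith, by linarith⟩
  · simp only [Fin.reduceFinMk, h₂]
    exact ⟨le_rfl, by linarith, by linarith⟩

theorem IsT2A.exists_coords {T : Set Plane} (hT : IsT2A T) :
    ∃ (ψ : Plane ≃ᵃ[ℝ] Plane) (a β : ℝ), IsUnimodular ψ ∧ 0 < a ∧ 0 < β ∧
      MapsTo ψ T (normalTriangle a β) := by
  obtain ⟨hfree, v, ⟨hv, rfl⟩, hvertex, h₁₂, h₁, h₂⟩ := hT
  obtain ⟨φ, hφ, hφ₁, hφ₂, hφ₀, hends⟩ := exists_coords_of_segment hv h₁₂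
  have himage : φ '' convexHull ℝ (range v) = convexHull ℝ (range (φ ∘ v)) := by
    rw [range_comp]
    exact φ.toAffineMap.image_convexHull _
  have hfree' : LatticeFree (convexHull ℝ (range (φ ∘ v))) := himage ▸ hφ.latticeFree hfree
  have hvertex' : φ (v 0) ∉ latticePoints := fun h => hvertex ((hφ _).1 h)
  obtain ⟨ψ, a, β, hψ, ha, hβ, hmaps⟩ : ∃ (ψ : Plane ≃ᵃ[ℝ] Plane) (a β : ℝ), IsUnimodular ψ ∧
      0 < a ∧ 0 < β ∧ MapsTo ψ (convexHull ℝ (range (φ ∘ v))) (normalTriangle a β) := by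
    rcases hends with ⟨hle₁, hle₂⟩ | ⟨hle₂, hle₁⟩
    · exact exists_coords_of_position hfree' hφ₁ hφ₂ hφ₀ hle₁ hle₂ hvertex' (hφ.oneInside h₁)
        (hφ.oneInside h₂)
    · have hrange : range ((φ ∘ v) ∘ Equiv.swap 1 2) = range (φ ∘ v) :=
        (Equiv.swap 1 2).surjective.range_comp _
      rw [← hrange] at hfree' ⊢
      refine exists_coords_of_position hfree' ?_ ?_ ?_ ?_ ?_ ?_ ?_ ?_
      exacts [hφ₂, hφ₁, hφ₀, hle₂, hle₁, hvertex', hφ.oneInside h₂, hφ.oneInside h₁]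
  exact ⟨φ.trans ψ, a, β, hφ.trans hψ, ha, hβ, fun x hx => hmaps (himage ▸ mem_image_of_mem φ hx)⟩

theorem cutRank_lt_top_of_isT2A {k : ℕ} {f : Plane} {R : Fin k → Plane} {α : Fin k → ℝ}
    (hR : PointedCone.hull ℝ (range R) = ⊤) (hα : ∀ i, 0 < α i) {T : Set Plane} (hT : IsT2A T)
    (h : ∀ i, f + (α i)⁻¹ • R i ∈ T) : cutRank f R α < ⊤ := by
  obtain ⟨ψ, a, β, hψ, ha, hβ, hmaps⟩ := hT.exists_coords
  exact cutRank_lt_top_of_mem_normalTriangle hR hα hψ ha hβ fun i => hmaps (h i)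

/-! ### Intersection cuts -/

section IntersectionCut

variable {k : ℕ} {f : Plane} {R : Fin k → Plane} {α : Fin k → ℝ} {B : Set Plane}

lemma add_smul_mem_interior {d : Plane} (hB : Convex ℝ B) (hf : f ∈ interior B) {a b : ℝ}
    (ha : 0 < a) (hab : a < b) (hb : f + b • d ∈ closure B) : f + a • d ∈ interior B := by
  refine hB.openSegment_interior_closure_subset_interior hf hb ?_
  rw [openSegment_eq_image']
  refine ⟨a / b, ⟨div_pos ha (ha.trans hab), (div_lt_one (ha.trans hab)).2 hab⟩, ?_⟩
  simp only [add_sub_cancel_left, smul_smul, div_mul_cancel₀ _ (ha.trans hab).ne']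

lemma phi_eq_of_mem_frontier (hB : Convex ℝ B) (hf : f ∈ interior B) {i : Fin k} {t : ℝ}
    (ht : 0 < t) (hi : f + t⁻¹ • R i ∈ frontier B) : phi f R B i = t := by
  have hrec : R i ∉ recCone B := fun hr => by
    have htwo := hr f (interior_subset hf) (2 * t⁻¹) (by positivity)
    exact hi.2 (add_smul_mem_interior hB hf (inv_pos.2 ht)
      (by linarith [inv_pos.2 ht]) (subset_closure htwo))
  have hsingleton : {s : ℝ | 0 < s ∧ f + s⁻¹ • R i ∈ frontier B} = {t} := by
    refine eq_singleton_iff_unique_mem.2 ⟨⟨ht, hi⟩, fun s ⟨hs, hs'⟩ => ?_⟩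
    rcases lt_trichotomy s t with h | h | h
    · exact absurd (add_smul_mem_interior hB hf (inv_pos.2 ht) (inv_strictAnti₀ hs h) hs'.1) hi.2
    · exact h
    · exact absurd (add_smul_mem_interior hB hf (inv_pos.2 hs) (inv_strictAnti₀ ht h) hi.1) hs'.2
  rw [phi, if_neg hrec, hsingleton, csInf_singleton]

lemma inducedSet_of_pos (hα : ∀ i, 0 < α i) :
    inducedSet f R α = convexHull ℝ (range (fun i => f + (α i)⁻¹ • R i) ∪ {f}) := by
  have hrange : {y | ∃ i, 0 < α i ∧ y = f + (α i)⁻¹ • R i} = range fun i => f + (α i)⁻¹ • R i :=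
    ext fun y => ⟨fun ⟨i, _, h⟩ => ⟨i, h.symm⟩, fun ⟨i, h⟩ => ⟨i, hα i, h.symm⟩⟩
  have hempty : {r | ∃ i, α i = 0 ∧ r = R i} = ∅ :=
    eq_empty_of_forall_notMem fun r ⟨i, h, _⟩ => (hα i).ne' h
  have hzero : ∀ d : Plane, d ∈ PointedCone.hull ℝ (∅ : Set Plane) ↔ d = 0 := fun d => by
    rw [PointedCone.hull, Submodule.span_empty, Submodule.mem_bot]
  ext x
  simp only [inducedSet, hrange, hempty, hzero, exists_eq_left, add_zero, mem_ofPred_eq,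
    exists_eq_right']

lemma mem_inducedSet_of_pos (hα : ∀ i, 0 < α i) (i : Fin k) :
    f + (α i)⁻¹ • R i ∈ inducedSet f R α := by
  rw [inducedSet_of_pos hα]
  exact subset_convexHull ℝ _ (.inl ⟨i, rfl⟩)

lemma inducedSet_eq_of_subset_convexHull (hα : ∀ i, 0 < α i) (hB : Convex ℝ B) (hf : f ∈ B)
    (h : ∀ i, f + (α i)⁻¹ • R i ∈ B)
    (hsubset : B ⊆ convexHull ℝ (range fun i => f + (α i)⁻¹ • R i)) : inducedSet f R α = B := by
  rw [inducedSet_of_pos hα]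
  refine Subset.antisymm (convexHull_min ?_ hB)
    (hsubset.trans (convexHull_mono subset_union_left))
  rintro x (⟨i, rfl⟩ | rfl)
  exacts [h i, hf]

end IntersectionCut

/-! ### Triangles of type `T²ᴮ` with a horizontal long side -/

section LatticeCoordinates

variable {p : Plane} {i : Fin 2}

lemma notMem_latticePoints_of_mem_Ioo (n : ℤ) (h : p i ∈ Ioo (n : ℝ) (n + 1)) :
    p ∉ latticePoints := by
  rintro ⟨z, rfl⟩
  have hlower : n < z i := Int.cast_lt.1 h.1
  have hupper : z i < n + 1 := Int.cast_lt.1 (h.2.trans_eq (by push_cast; rfl))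
  omega

lemma apply_eq_one_of_mem_latticePoints (hp : p ∈ latticePoints) (h₀ : 0 < p i) (h₂ : p i < 2) :
    p i = 1 := by
  rcases lt_trichotomy (p i) 1 with h | h | h
  · exact absurd hp (notMem_latticePoints_of_mem_Ioo 0 ⟨by simpa, by simpa⟩)
  · exact h
  · exact absurd hp (notMem_latticePoints_of_mem_Ioo (i := i) 1 ⟨by simpa, by norm_num; exact h₂⟩)

end LatticeCoordinates

section Base

variable {P₁ P₂ X Z : ℝ} {x : Plane}

lemma insert_base_eq_range : ({![P₁, P₂], ![X, 0], ![Z, 0]} : Set Plane) =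
    range ![![P₁, P₂], ![Z, 0], ![X, 0]] := by
  simp only [Matrix.range_cons, Matrix.range_empty, union_empty, singleton_union]
  rw [pair_comm]

lemma orient_base_pos (hP : 0 < P₂) (hZX : Z < X) :
    0 < orient ![P₁, P₂] ![Z, 0] ![X, 0] := by
  simpa [orient] using by linarith [mul_pos hP (sub_pos.2 hZX)]

lemma mem_convexHull_base_iff (hP : 0 < P₂) (hZX : Z < X) :
    x ∈ convexHull ℝ {![P₁, P₂], ![X, 0], ![Z, 0]} ↔ 0 ≤ x 1 ∧
      0 ≤ P₂ * (X - x 0) - (X - P₁) * x 1 ∧ 0 ≤ P₂ * (x 0 - Z) - (P₁ - Z) * x 1 := by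
  rw [insert_base_eq_range, mem_convexHull_range_iff_orient (orient_base_pos hP hZX),
    ← mul_nonneg_iff_of_pos_left (b := x 1) (sub_pos.2 hZX)]
  simp only [orient, Matrix.cons_val]
  constructor <;> rintro ⟨h₀, h₁, h₂⟩ <;> refine ⟨?_, ?_, ?_⟩ <;> linarith

lemma mem_interior_convexHull_base_iff (hP : 0 < P₂) (hZX : Z < X) :
    x ∈ interior (convexHull ℝ {![P₁, P₂], ![X, 0], ![Z, 0]}) ↔ 0 < x 1 ∧
      0 < P₂ * (X - x 0) - (X - P₁) * x 1 ∧ 0 < P₂ * (x 0 - Z) - (P₁ - Z) * x 1 := by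
  rw [insert_base_eq_range, mem_interior_convexHull_range_iff_orient (orient_base_pos hP hZX),
    ← mul_pos_iff_of_pos_left (b := x 1) (sub_pos.2 hZX)]
  simp only [orient, Matrix.cons_val]
  constructor <;> rintro ⟨h₀, h₁, h₂⟩ <;> refine ⟨?_, ?_, ?_⟩ <;> linarith

lemma isTriangle_base (hP : 0 < P₂) (hZX : Z < X) :
    IsTriangle (convexHull ℝ {![P₁, P₂], ![X, 0], ![Z, 0]}) ![![P₁, P₂], ![X, 0], ![Z, 0]] := by
  refine ⟨affineIndependent_of_orient_ne_zero ?_, by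
    simp only [Matrix.range_cons, Matrix.range_empty, union_empty, singleton_union]⟩
  have := orient_base_pos (P₁ := P₁) hP hZX
  simp only [orient, Matrix.cons_val] at this ⊢
  linarith

lemma nontrivial_segment_inter_latticePoints (hX : 1 ≤ X) (hZ : Z ≤ 0) :
    (segment ℝ ![X, 0] ![Z, 0] ∩ latticePoints).Nontrivial := by
  have hmem : ∀ c : ℤ, (c : ℝ) ∈ Icc Z X →
      ![(c : ℝ), 0] ∈ segment ℝ ![X, 0] ![Z, 0] ∩ latticePoints := fun c hc => by
    have hZX : 0 < X - Z := by linarith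
    refine ⟨⟨(c - Z) / (X - Z), (X - c) / (X - Z), div_nonneg (by linarith [hc.1]) hZX.le,
      div_nonneg (by linarith [hc.2]) hZX.le, by field_simp; ring, ?_⟩, ![c, 0], ?_⟩
    · ext i
      fin_cases i
      · simp only [Fin.zero_eta, Pi.add_apply, Pi.smul_apply, Matrix.cons_val_zero, smul_eq_mul]
        field_simp
        ring
      · simp
    · ext i
      fin_cases i <;> simp
  refine ⟨_, hmem 0 ⟨by simpa, by simp; linarith⟩, _, hmem 1 ⟨by simp; linarith, by simpa⟩, ?_⟩
  exact fun h => by simpa using congrFun h 0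

lemma eq_of_mem_openSegment_base (hP₁ : 1 < P₂) (hP₂ : P₂ < 2)
    (hx : x ∈ openSegment ℝ ![P₁, P₂] ![Z, 0]) (hx' : x ∈ latticePoints) :
    x = ![Z + (P₁ - Z) / P₂, 1] := by
  obtain ⟨hx₀, hx₂, hgraph⟩ := (mem_openSegment_iff_graph (C := (P₁ - Z) / P₂) one_ne_zero (by simp)
    (by simp; linarith) (by simp; field_simp; ring)).1 hx
  have hone := apply_eq_one_of_mem_latticePoints hx' hx₀ (hx₂.trans hP₂)
  ext i
  fin_cases i
  · simpa [hone] using hgraph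
  · exact hone

lemma oneInside_base (hP₁ : 1 < P₂) (hP₂ : P₂ < 2) {c : ℤ} (hc : Z + (P₁ - Z) / P₂ = c) :
    OneInside ![P₁, P₂] ![Z, 0] := by
  refine ⟨_, ⟨?_, ![c, 1], rfl⟩, fun x hx => ?_⟩
  · rw [mem_openSegment_iff_graph (C := (P₁ - Z) / P₂) one_ne_zero (by simp)
      (by simp; linarith) (by simp; field_simp; ring)]
    simpa [← hc]
  · rw [eq_of_mem_openSegment_base hP₁ hP₂ hx.1 hx.2, hc]
    ext i
    fin_cases i <;> simp

lemma latticeFree_base (hP₁ : 1 < P₂) (hP₂ : P₂ < 2) (hX : P₁ = X - (X - 1) * P₂)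
    (hZ : P₁ = Z * (1 - P₂)) (hZX : Z < X) :
    LatticeFree (convexHull ℝ {![P₁, P₂], ![X, 0], ![Z, 0]}) := by
  refine Set.disjoint_left.2 fun x hx hx' => ?_
  obtain ⟨h₀, h₁, h₂⟩ := (mem_interior_convexHull_base_iff (by linarith) hZX).1 hx
  have hlt : x 1 < P₂ := by nlinarith
  have hone := apply_eq_one_of_mem_latticePoints hx' h₀ (hlt.trans hP₂)
  rw [hone] at h₁ h₂
  refine notMem_latticePoints_of_mem_Ioo (i := 0) 0 ⟨?_, ?_⟩ hx' <;> push_cast <;> nlinarith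

lemma notMem_latticePoints_of_pos_of_lt_one (h₀ : 0 < P₁) (h₁ : P₁ < 1) :
    ![P₁, P₂] ∉ latticePoints :=
  notMem_latticePoints_of_mem_Ioo (i := 0) 0 (by simpa using ⟨h₀, h₁⟩)

lemma isT2A_base (hP₁ : 1 < P₂) (hP₂ : P₂ < 2) (hX : P₁ = X - (X - 1) * P₂)
    (hZ : P₁ = Z * (1 - P₂)) (h₀ : 0 < P₁) (h₁ : P₁ < 1) :
    IsT2A (convexHull ℝ {![P₁, P₂], ![X, 0], ![Z, 0]}) := by
  have hZ_neg : Z < 0 := by nlinarith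
  have hX_one : 1 < X := by nlinarith
  have hP₀ : 0 < P₂ := by linarith
  refine ⟨latticeFree_base hP₁ hP₂ hX hZ (by linarith), _, isTriangle_base hP₀ (by linarith),
    notMem_latticePoints_of_pos_of_lt_one h₀ h₁,
    nontrivial_segment_inter_latticePoints hX_one.le hZ_neg.le,
    oneInside_base hP₁ hP₂ (c := 1) ?_, oneInside_base hP₁ hP₂ (c := 0) ?_⟩
  · rw [hX]; field_simp; push_cast; ring
  · rw [hZ]; field_simp; push_cast; ring

lemma isT2B_base (hX : 2 < X) (hP : P₁ = X - (X - 1) * P₂) (h₀ : 0 < P₁) (h₁ : P₁ < 1) :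
    IsT2B (convexHull ℝ {![P₁, P₂], ![X, 0], ![0, 0]}) := by
  have hP₁ : 1 < P₂ := by by_contra!; nlinarith
  have hP₂ : P₂ < 2 := by by_contra!; nlinarith
  have hP₀ : 0 < P₂ := by linarith
  obtain ⟨Z, hZ⟩ : ∃ Z, P₁ = Z * (1 - P₂) :=
    ⟨P₁ / (1 - P₂), (div_mul_cancel₀ _ (by linarith)).symm⟩
  have hT := isT2A_base hP₁ hP₂ hP hZ h₀ h₁
  have hZ_neg : Z < 0 := by nlinarith
  have hsubset : convexHull ℝ {![P₁, P₂], ![X, 0], ![0, 0]} ⊆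
      convexHull ℝ {![P₁, P₂], ![X, 0], ![Z, 0]} := fun x hx => by
    rw [mem_convexHull_base_iff hP₀ (by linarith)] at hx ⊢
    exact ⟨hx.1, hx.2.1, by nlinarith⟩
  refine ⟨hT.1.mono_left (interior_mono hsubset), ⟨_, isTriangle_base hP₀ (by linarith),
    notMem_latticePoints_of_pos_of_lt_one h₀ h₁,
    nontrivial_segment_inter_latticePoints (by linarith) le_rfl,
    oneInside_base hP₁ hP₂ (c := 1) ?_, ?_⟩, _, hT, hsubset⟩
  · rw [hP]; field_simp; push_cast; ring
  · refine eq_empty_of_forall_notMem fun x ⟨hx, hx'⟩ => ?_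
    have h := eq_of_mem_openSegment_base hP₁ hP₂ hx hx'
    rw [h, zero_add, sub_zero] at hx'
    exact notMem_latticePoints_of_pos_of_lt_one (by positivity)
      ((div_lt_one hP₀).2 (by linarith)) hx'

end Base

/-! ### The auxiliary triangles of the standard position -/

/-- A triangle of type `T²ᴮ` around `f`, spanned by the points `q i` and having all of them on its
boundary. For `q i = f + (β i)⁻¹ • R i` it is the induced set of its own intersection cut `β`. -/
structure IsRayTriangle {ι : Type*} (f : Plane) (q : ι → Plane) (U : Set Plane) : Prop where
  isT2B : IsT2B U
  mem_interior : f ∈ interior U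
  mem_frontier : ∀ i, q i ∈ frontier U
  subset_convexHull : U ⊆ convexHull ℝ (range q)

namespace IsRayTriangle

section Image

variable {ι κ : Type*} {f : Plane} {q : ι → Plane} {U : Set Plane}

lemma image (h : IsRayTriangle f q U) {φ : Plane ≃ᵃ[ℝ] Plane} (hφ : IsUnimodular φ) :
    IsRayTriangle (φ f) (φ ∘ q) (φ '' U) where
  isT2B := hφ.isT2B h.isT2B
  mem_interior := by
    have himage := φ.toContinuousAffineEquiv.toHomeomorph.image_interior U
    exact himage.subset (mem_image_of_mem φ h.mem_interior)
  mem_frontier i := by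
    have himage := φ.toContinuousAffineEquiv.toHomeomorph.image_frontier U
    exact himage.subset (mem_image_of_mem φ (h.mem_frontier i))
  subset_convexHull := by
    have himage := φ.toAffineMap.image_convexHull (range q)
    rw [range_comp]
    exact (image_mono h.subset_convexHull).trans himage.subset

lemma comp_equiv (h : IsRayTriangle f q U) (σ : κ ≃ ι) : IsRayTriangle f (q ∘ σ) U :=
  ⟨h.isT2B, h.mem_interior, fun i => h.mem_frontier (σ i), by
    rw [σ.surjective.range_comp]; exact h.subset_convexHull⟩

end Image

variable {k : ℕ} {f : Plane} {R : Fin k → Plane} {β : Fin k → ℝ} {U : Set Plane}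

lemma convex {ι : Type*} {q : ι → Plane} (h : IsRayTriangle f q U) : Convex ℝ U := by
  obtain ⟨-, ⟨v, ⟨-, rfl⟩, -⟩, -⟩ := h.isT2B
  exact convex_convexHull ℝ _

lemma mem {ι : Type*} {q : ι → Plane} (h : IsRayTriangle f q U) (i : ι) : q i ∈ U := by
  obtain ⟨-, ⟨v, ⟨-, hU⟩, -⟩, -⟩ := h.isT2B
  have hclosed : IsClosed U := hU ▸ (finite_range v).isClosed_convexHull ℝ
  exact hclosed.frontier_subset (h.mem_frontier i)

lemma phi_eq (h : IsRayTriangle f (fun i => f + (β i)⁻¹ • R i) U) (hβ : ∀ i, 0 < β i) :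
    phi f R U = β :=
  funext fun i => phi_eq_of_mem_frontier h.convex h.mem_interior (hβ i) (h.mem_frontier i)

lemma inducedSet_eq (h : IsRayTriangle f (fun i => f + (β i)⁻¹ • R i) U) (hβ : ∀ i, 0 < β i) :
    inducedSet f R β = U :=
  inducedSet_eq_of_subset_convexHull hβ h.convex (interior_subset h.mem_interior) h.mem
    h.subset_convexHull

lemma cutRank_lt_top (h : IsRayTriangle f (fun i => f + (β i)⁻¹ • R i) U) (hβ : ∀ i, 0 < β i)
    (hR : PointedCone.hull ℝ (range R) = ⊤) : cutRank f R β < ⊤ := by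
  obtain ⟨T, hT, hUT⟩ := h.isT2B.2.2
  exact cutRank_lt_top_of_isT2A hR hβ hT fun i => hUT (h.mem i)

end IsRayTriangle

/-- The relations between the factors `r < 1 < s` by which the construction of the triangle `U`
moves `(0, 2)` and `(1 + δ, 1 - δ)` along their rays from a point `f` with `f 0 = u`. -/
structure IsTilt (u δ r s : ℝ) : Prop where
  pos : 0 < r
  lt_one : r < 1
  one_lt : 1 < s
  ratio : 1 - s⁻¹ = δ * (r⁻¹ - 1)
  apex_lt_one : u * (1 - r) < 1

section Construction

variable {f : Plane} {γ δ r s P₁ P₂ X Z : ℝ} {x : Plane}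

lemma lineMap_apply_coord (a b : Plane) (t : ℝ) (i : Fin 2) :
    AffineMap.lineMap a b t i = a i + t * (b i - a i) := by
  rw [AffineMap.lineMap_apply, vsub_eq_sub, vadd_eq_add, Pi.add_apply, Pi.smul_apply, Pi.sub_apply,
    smul_eq_mul, add_comm]

lemma exists_lineMap_eq_base (hδ₀ : 0 < δ) (hδ₁ : δ < 1) (hf₁ : 1 - δ < f 1)
    (hsum : f 0 + f 1 < 2) :
    ∃ s X : ℝ, 1 < s ∧ 2 < X ∧ AffineMap.lineMap f ![1 + δ, 1 - δ] s = ![X, 0] := by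
  have hd : 0 < f 1 - (1 - δ) := by linarith
  obtain ⟨s, hs⟩ : ∃ s, s * (f 1 - (1 - δ)) = f 1 := ⟨_, div_mul_cancel₀ _ hd.ne'⟩
  have hs₁ : 1 < s := by by_contra!; nlinarith
  refine ⟨s, f 0 + s * (1 + δ - f 0), hs₁, by nlinarith, ?_⟩
  ext i
  rw [lineMap_apply_coord]
  fin_cases i
  · simp
  · simp only [Fin.mk_one, Matrix.cons_val]
    linarith

/-- The form `X - x 0 - (X - 1) * x 1` vanishes at `(X, 0)` and at `(1, 1)`, so it measures how far
`f` is from the side through the apex. -/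
lemma sideForm_pos (hδ : 0 < δ) (hs : 1 < s) (hX : 2 < X)
    (h : AffineMap.lineMap f ![1 + δ, 1 - δ] s = ![X, 0]) :
    (s - 1) * (X - f 0 - (X - 1) * f 1) = s * (δ * (X - 2)) ∧
      0 < X - f 0 - (X - 1) * f 1 := by
  have h₀ := congrFun h 0
  have h₁ := congrFun h 1
  rw [lineMap_apply_coord] at h₀ h₁
  simp only [Matrix.cons_val] at h₀ h₁
  have heq : (s - 1) * (X - f 0 - (X - 1) * f 1) = s * (δ * (X - 2)) := by
    linear_combination h₀ + (X - 1) * h₁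
  have hpos : 0 < (s - 1) * (X - f 0 - (X - 1) * f 1) :=
    heq ▸ mul_pos (by linarith) (mul_pos hδ (by linarith))
  exact ⟨heq, (pos_iff_pos_of_mul_pos hpos).1 (by linarith)⟩

lemma exists_lineMap_eq_apex (hδ : 0 < δ) (hs : 1 < s) (hX : 2 < X)
    (h : AffineMap.lineMap f ![1 + δ, 1 - δ] s = ![X, 0]) :
    ∃ r P₁ P₂ : ℝ, 0 < r ∧ r < 1 ∧ 1 - s⁻¹ = δ * (r⁻¹ - 1) ∧ P₁ = X - (X - 1) * P₂ ∧
      AffineMap.lineMap f ![0, 2] r = ![P₁, P₂] := by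
  obtain ⟨heq, hg⟩ := sideForm_pos hδ hs hX h
  generalize hgdef : X - f 0 - (X - 1) * f 1 = g at heq hg
  have hden : 0 < g + (X - 2) := by linarith
  obtain ⟨r, hr⟩ : ∃ r, r * (g + (X - 2)) = g := ⟨_, div_mul_cancel₀ _ hden.ne'⟩
  have hr₀ : 0 < r := pos_of_mul_pos_left (hr.symm ▸ hg) hden.le
  refine ⟨r, f 0 + r * (0 - f 0), f 1 + r * (2 - f 1), hr₀, by nlinarith, ?_,
    by linear_combination hr - (1 - r) * hgdef, ?_⟩
  · have hratio : r⁻¹ - 1 = (X - 2) / g := by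
      rw [eq_div_iff hg.ne']
      field_simp
      linarith
    rw [hratio]
    field_simp
    linarith
  · ext i
    rw [lineMap_apply_coord]
    fin_cases i <;> rfl

lemma mem_interior_base_of_lineMap (hf₀ : 0 < f 0) (hf₁ : 0 < f 1) (hX : 2 < X) (hP₂ : 0 < P₂)
    (hP : P₁ = X - (X - 1) * P₂) (hg : 0 < X - f 0 - (X - 1) * f 1) (hr : 0 < r)
    (h : AffineMap.lineMap f ![0, 2] r = ![P₁, P₂]) :
    f ∈ interior (convexHull ℝ {![P₁, P₂], ![X, 0], ![0, 0]}) := by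
  have h₀ := congrFun h 0
  have h₁ := congrFun h 1
  rw [lineMap_apply_coord] at h₀ h₁
  simp only [Matrix.cons_val] at h₀ h₁
  refine (mem_interior_convexHull_base_iff hP₂ (by linarith)).2 ⟨hf₁, ?_, ?_⟩
  · have hfactor : P₂ * (X - f 0) - (X - P₁) * f 1 = P₂ * (X - f 0 - (X - 1) * f 1) := by
      rw [hP]; ring
    rw [hfactor]
    positivity
  · have hfactor : P₂ * (f 0 - 0) - (P₁ - 0) * f 1 = 2 * r * f 0 := by
      rw [← h₀, ← h₁]; ring
    rw [hfactor]
    positivity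

lemma mem_frontier_base (hP₂ : 0 < P₂) (hZX : Z < X)
    (hx : x ∈ convexHull ℝ {![P₁, P₂], ![X, 0], ![Z, 0]})
    (h : x 1 = 0 ∨ P₂ * (X - x 0) = (X - P₁) * x 1) :
    x ∈ frontier (convexHull ℝ {![P₁, P₂], ![X, 0], ![Z, 0]}) := by
  refine ⟨subset_closure hx, fun hxint => ?_⟩
  obtain ⟨h₁, h₂, -⟩ := (mem_interior_convexHull_base_iff hP₂ hZX).1 hxint
  rcases h with h | h <;> linarith

lemma mem_line_base (hP : P₁ = X - (X - 1) * P₂) :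
    ![P₁, P₂] ∈ line[ℝ, (![X, 0] : Plane), ![1, 1]] := by
  have hline : ![P₁, P₂] = AffineMap.lineMap (![X, 0] : Plane) ![1, 1] P₂ := by
    ext i
    rw [lineMap_apply_coord]
    fin_cases i
    · simp only [hP, Fin.zero_eta, Matrix.cons_val]
      ring
    · simp
  rw [hline]
  exact AffineMap.lineMap_mem_affineSpan_pair _ _ _

lemma isRayTriangle_base (hγ₀ : 0 ≤ γ) (hγX : γ ≤ X) (hX : 2 < X)
    (hP : P₁ = X - (X - 1) * P₂) (hP₀ : 0 < P₁) (hP₁ : P₁ < 1) (hP₂ : 0 < P₂)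
    (hf : f ∈ interior (convexHull ℝ {![P₁, P₂], ![X, 0], ![0, 0]})) :
    IsRayTriangle f ![![P₁, P₂], ![X, 0], ![γ, 0], ![0, 0]]
      (convexHull ℝ {![P₁, P₂], ![X, 0], ![0, 0]}) where
  isT2B := isT2B_base hX hP hP₀ hP₁
  mem_interior := hf
  mem_frontier i := by
    refine mem_frontier_base hP₂ (by linarith) ?_ ?_
    · fin_cases i
      · exact subset_convexHull ℝ _ (by simp)
      · exact subset_convexHull ℝ _ (by simp)
      · rw [mem_convexHull_base_iff hP₂ (by linarith)]
        simpa using ⟨by nlinarith, by positivity⟩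
      · exact subset_convexHull ℝ _ (by simp)
    · fin_cases i <;> simp [mul_comm]
  subset_convexHull := by
    refine convexHull_mono ?_
    rintro x (rfl | rfl | rfl)
    exacts [⟨0, rfl⟩, ⟨1, rfl⟩, ⟨3, rfl⟩]

theorem exists_isRayTriangle (hδ₀ : 0 < δ) (hδ₁ : δ < 1) (hγ₀ : 0 ≤ γ) (hγ₂ : γ ≤ 2)
    (hf₀ : 0 < f 0) (hf₁ : 1 - δ < f 1) (hsum : f 0 + f 1 < 2) :
    ∃ (r s : ℝ) (p x : Plane), IsTilt (f 0) δ r s ∧ AffineMap.lineMap f ![0, 2] r = p ∧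
      AffineMap.lineMap f ![1 + δ, 1 - δ] s = x ∧ x 1 = 0 ∧ p ∈ line[ℝ, x, ![1, 1]] ∧
      IsRayTriangle f ![p, x, ![γ, 0], ![0, 0]] (convexHull ℝ {p, x, ![0, 0]}) := by
  obtain ⟨s, X, hs, hX, hx⟩ := exists_lineMap_eq_base hδ₀ hδ₁ hf₁ hsum
  obtain ⟨r, P₁, P₂, hr₀, hr₁, hratio, hP, hp⟩ := exists_lineMap_eq_apex hδ₀ hs hX hx
  have h₀ := congrFun hp 0
  have h₁ := congrFun hp 1
  rw [lineMap_apply_coord] at h₀ h₁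
  simp only [Matrix.cons_val] at h₀ h₁
  have hP₀ : 0 < P₁ := by nlinarith
  have hP₂ : 0 < P₂ := by nlinarith
  have hP_sum : P₁ + P₂ < 2 := by nlinarith
  have hP₁ : P₁ < 1 := by by_contra!; nlinarith
  have hf := mem_interior_base_of_lineMap hf₀ (by linarith) hX hP₂ hP
    (sideForm_pos hδ₀ hs hX hx).2 hr₀ hp
  exact ⟨r, s, _, _, ⟨hr₀, hr₁, hs, hratio, by linarith⟩, hp, hx, rfl, mem_line_base hP,
    isRayTriangle_base hγ₀ (by linarith) hX hP hP₀ hP₁ hP₂ hf⟩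

lemma exists_isUnimodular_flip : ∃ ψ : Plane ≃ᵃ[ℝ] Plane, IsUnimodular ψ ∧
    ∀ x, ψ x = ![x 0, 2 - x 0 - x 1] := by
  obtain ⟨ψ, hψ, hψ_apply⟩ := exists_isUnimodular (M := !![1, 0; -1, -1])
    (by rw [Matrix.det_fin_two_of]; norm_num) ![0, 2]
  refine ⟨ψ, hψ, fun x => funext fun i => ?_⟩
  rw [hψ_apply]
  fin_cases i
  · simp
  · simp only [Fin.mk_one, Matrix.of_apply, Matrix.cons_val]
    push_cast
    ring

/-- The involution `(x₀, x₁) ↦ (x₀, 2 - x₀ - x₁)` reverses the order of the corners in standard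
position and exchanges the constructions of `U` and `V`. -/
theorem exists_isRayTriangle_flip (hδ₀ : 0 ≤ 1 + δ) (hδ₁ : δ ≤ 1) (hγ₁ : 1 < γ) (hγ₂ : γ < 2)
    (hf₀ : 0 < f 0) (hf₁ : 0 < f 1) (hsum : f 0 + f 1 < γ) :
    ∃ (r s : ℝ) (p x : Plane), IsTilt (f 0) (γ - 1) r s ∧ AffineMap.lineMap f ![0, 0] r = p ∧
      AffineMap.lineMap f ![γ, 0] s = x ∧ x 0 + x 1 = 2 ∧ p ∈ line[ℝ, x, ![1, 0]] ∧
      IsRayTriangle f ![![0, 2], ![1 + δ, 1 - δ], x, p] (convexHull ℝ {![0, 2], x, p}) := by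
  obtain ⟨ψ, hψ, hψ_apply⟩ := exists_isUnimodular_flip
  have hψψ : ∀ x, ψ (ψ x) = x := fun x => by
    ext i
    fin_cases i <;> simp [hψ_apply]
  obtain ⟨r, s, p, x, htilt, hp, hx, hx₁, hline, hU⟩ :=
    exists_isRayTriangle (f := ψ f) (δ := γ - 1) (γ := 1 + δ) (by linarith) (by linarith) hδ₀
      (by linarith) (by simpa [hψ_apply]) (by simp [hψ_apply]; linarith)
      (by simp [hψ_apply]; linarith)
  have hmap : ∀ (b : Plane) (t : ℝ), ψ (AffineMap.lineMap (ψ f) b t) =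
      AffineMap.lineMap f (ψ b) t := fun b t => by
    rw [← hψψ f, hψψ (ψ f)]
    exact ψ.toAffineMap.apply_lineMap _ _ t
  have himage : ψ '' convexHull ℝ {p, x, ![0, 0]} = convexHull ℝ {![0, 2], ψ x, ψ p} := by
    have hcorner : ψ ![0, 0] = ![0, 2] := by simp [hψ_apply]
    refine (ψ.toAffineMap.image_convexHull _).trans ?_
    rw [image_insert_eq, image_pair, ψ.coe_toAffineMap, hcorner, pair_comm (ψ x), insert_comm,
      pair_comm (ψ p)]
  refine ⟨r, s, ψ p, ψ x, by simpa [hψ_apply] using htilt, ?_, ?_, by simp [hψ_apply, hx₁], ?_, ?_⟩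
  · rw [← hp, hmap]
    simp [hψ_apply]
  · have hcorner : ψ ![1 + (γ - 1), 1 - (γ - 1)] = ![γ, 0] := by
      rw [hψ_apply]
      ext i
      fin_cases i
      · simp
      · simp only [Fin.mk_one, Matrix.cons_val]
        ring
    rw [← hx, hmap, hcorner]
  · have hmem := AffineSubspace.mem_map_of_mem ψ.toAffineMap hline
    rw [AffineSubspace.map_span, image_pair] at hmem
    convert! hmem using 4
    simp [hψ_apply]
    norm_num
  · rw [← himage]
    have hV := (hU.image hψ).comp_equiv Fin.revPerm
    convert! hV using 1
    · exact (hψψ f).symm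
    · ext i j
      fin_cases i <;> fin_cases j <;> simp [hψ_apply]
      all_goals ring

end Construction

/-! ### The rank bound in standard position -/

/-- The points `f + rⁱ / αᵢ` of the standard position with parameters `δ` and `γ`. -/
def standardVertex (δ γ : ℝ) : Fin 4 → Plane := ![![0, 2], ![1 + δ, 1 - δ], ![γ, 0], ![0, 0]]

section Ray

variable {E : Type*} [AddCommGroup E] [Module ℝ E]

lemma lineMap_add_smul (f v : E) (a t : ℝ) :
    AffineMap.lineMap f (f + a • v) t = f + (t * a) • v := by
  rw [AffineMap.lineMap_apply, vsub_eq_sub, vadd_eq_add, add_sub_cancel_left, smul_smul, add_comm]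

lemma add_inv_div_smul (f v : E) (a t : ℝ) :
    f + (a / t)⁻¹ • v = AffineMap.lineMap f (f + a⁻¹ • v) t := by
  rw [lineMap_add_smul, inv_div, div_eq_mul_inv]

end Ray

namespace IsTilt

variable {u δ r s : ℝ}

lemma inv_sub_one_pos (h : IsTilt u δ r s) : 0 < r⁻¹ - 1 :=
  sub_pos.2 ((one_lt_inv₀ h.pos).2 h.lt_one)

lemma inv_sub_one_mul_lt_one (h : IsTilt u δ r s) : (r⁻¹ - 1) * (u - 1) < 1 := by
  have hr := inv_mul_cancel₀ h.pos.ne'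
  have hlt := mul_lt_mul_of_pos_left h.apex_lt_one (inv_pos.2 h.pos)
  linear_combination hlt + u * hr

end IsTilt

section Standard

variable {f : Plane} {R : Fin 4 → Plane} {α : Fin 4 → ℝ} {δ γ r s r' s' : ℝ}

/-- With `σ = 1 - (a + b + c + d)`, the hypotheses read `σ ≤ k (a - δ b)`,
`σ ≤ k' (d - (γ - 1) c)` and `(a - δ b) + (d - (γ - 1) c) ≤ σ (u - 1)`. If `0 < σ`, the second one
makes `d - (γ - 1) c` positive, and the other two contradict `k (u - 1) < 1`. -/
lemma one_le_sum_of_tilted {a b c d u k k' : ℝ} (hk : 0 < k) (hk' : 0 < k')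
    (hku : k * (u - 1) < 1) (hU : 1 ≤ (k + 1) * a + (1 - δ * k) * b + c + d)
    (hV : 1 ≤ a + b + (1 - (γ - 1) * k') * c + (k' + 1) * d)
    (hx : 1 ≤ u * (1 - (a + b + c + d)) + b * (1 + δ) + c * γ) : 1 ≤ a + b + c + d := by
  by_contra! hlt
  have hV_pos : 0 < d - (γ - 1) * c := pos_of_mul_pos_right (by linarith) hk'.le
  have hx_le : k * (a - δ * b) ≤ k * ((1 - (a + b + c + d)) * (u - 1)) :=
    mul_le_mul_of_nonneg_left (by linarith) hk.le
  have hlt_self : (1 - (a + b + c + d)) * (k * (u - 1)) < 1 - (a + b + c + d) :=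
    mul_lt_of_lt_one_right (by linarith) hku
  linarith

lemma cutValidOn_splitSet_of_isTilt (hα : ∀ i, 0 < α i)
    (hq : ∀ i, f + (α i)⁻¹ • R i = standardVertex δ γ i) (hδ : 0 ≤ 1 + δ) (hγ : 0 ≤ γ)
    (hf : 0 < f 0) (hU : IsTilt (f 0) δ r s) (hV : IsTilt (f 0) (γ - 1) r' s') :
    CutValidOn (splitSet {z | z ∈ relaxP f R ∧
      1 ≤ ∑ i, ![α 0 / r, α 1 / s, α 2, α 3] i * z.2 i ∧
      1 ≤ ∑ i, ![α 0, α 1, α 2 / s', α 3 / r'] i * z.2 i} ![1, 0] 0) α := by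
  have hconvex : Convex ℝ {z : MixedSpace 2 4 | 1 ≤ ∑ i, α i * z.2 i} :=
    convex_halfSpace_ge ⟨fun x y => by simp [mul_add, Finset.sum_add_distrib],
      fun c x => by simp [Finset.mul_sum, mul_left_comm]⟩ 1
  rw [cutValidOn_iff]
  refine convexHull_min (union_subset ?_ ?_) hconvex
  · rintro z ⟨⟨hz, -, -⟩, hz₀⟩
    have hle := sub_mul_sum_le (g := planeForm 1 0 0) hα (fun i => by
      rw [hq, planeForm_apply]
      fin_cases i <;> simp [standardVertex, hδ, hγ]) hz
    simp only [planeForm_apply, one_mul, zero_mul, add_zero] at hle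
    have hz₀ : z.1 0 ≤ 0 := by simpa [Fin.sum_univ_two] using hz₀
    exact sub_nonpos.1 (nonpos_of_mul_nonpos_right (hle.trans hz₀) hf)
  · rintro z ⟨⟨hz, hzU, hzV⟩, hz₁⟩
    have hz₁ : 1 ≤ z.1 0 := by simpa [Fin.sum_univ_two] using hz₁
    have heq := affineMap_fst_eq hα (planeForm 1 0 0) hz
    simp only [hq, planeForm_apply, one_mul, zero_mul, add_zero, Fin.sum_univ_four,
      standardVertex, Matrix.cons_val] at heq hzU hzV
    change 1 ≤ ∑ i, α i * z.2 i
    rw [Fin.sum_univ_four]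
    refine one_le_sum_of_tilted (δ := δ) (γ := γ) hU.inv_sub_one_pos hV.inv_sub_one_pos
      hU.inv_sub_one_mul_lt_one (hzU.trans_eq ?_) (hzV.trans_eq ?_) (hz₁.trans_eq (heq.trans ?_))
    · rw [← hU.ratio, sub_add_cancel, sub_sub_cancel]
      ring
    · rw [← hV.ratio, sub_add_cancel, sub_sub_cancel]
      ring
    · ring

lemma IsStandardQ1.exists_standardVertex (h : IsStandardQ1 f R α) :
    ∃ δ γ, 0 < δ ∧ δ < 1 ∧ 1 < γ ∧ γ < 2 ∧ (∀ i, f + (α i)⁻¹ • R i = standardVertex δ γ i) ∧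
      0 < f 0 ∧ 1 - δ < f 1 ∧ f 0 + f 1 < γ := by
  obtain ⟨δ, γ, hδ₀, hδ₁, hγ₁, hγ₂, h₀, h₁, h₂, h₃⟩ := h.vertices
  have hq : ∀ i, f + (α i)⁻¹ • R i = standardVertex δ γ i :=
    Fin.forall_fin_succ.2 ⟨h₀, Fin.forall_fin_succ.2 ⟨h₁, Fin.forall_fin_two.2 ⟨h₂, h₃⟩⟩⟩
  refine ⟨δ, γ, hδ₀, hδ₁, hγ₁, hγ₂, hq, ?_, ?_, ?_⟩
  · have hpos := pos_of_hull_eq_top h.data.cone_eq_top h.pos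
      (planeForm_surjective (b := 0) (.inl one_ne_zero) 0) fun i => by
        rw [hq, planeForm_apply]
        fin_cases i <;> simp [standardVertex]
        all_goals linarith
    simpa [planeForm_apply] using hpos
  · have h₁₁ : f 1 + (α 1)⁻¹ * R 1 1 = 1 - δ := congrFun h₁ 1
    linarith [mul_neg_of_pos_of_neg (inv_pos.2 (h.pos 1)) h.second]
  · have h₂₀ : f 0 + (α 2)⁻¹ * R 2 0 = γ := congrFun h₂ 0
    have h₂₁ : f 1 + (α 2)⁻¹ * R 2 1 = 0 := congrFun h₂ 1
    linarith [mul_pos (inv_pos.2 (h.pos 2)) h.third]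

lemma exists_isTriangleU (hα : ∀ i, 0 < α i)
    (hq : ∀ i, f + (α i)⁻¹ • R i = standardVertex δ γ i) (hδ₀ : 0 < δ) (hδ₁ : δ < 1) (hγ₀ : 0 ≤ γ)
    (hγ₂ : γ ≤ 2) (hf₀ : 0 < f 0) (hf₁ : 1 - δ < f 1) (hsum : f 0 + f 1 < 2) :
    ∃ r s U, IsTilt (f 0) δ r s ∧ IsTriangleU f R U ∧
      IsRayTriangle f (fun i => f + (![α 0 / r, α 1 / s, α 2, α 3] i)⁻¹ • R i) U := by
  obtain ⟨r, s, p, x, htilt, hp, hx, hx₁, hline, hU⟩ :=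
    exists_isRayTriangle hδ₀ hδ₁ hγ₀ hγ₂ hf₀ hf₁ hsum
  have hp' : AffineMap.lineMap f (f + (α 0)⁻¹ • R 0) r = p := (hq 0).symm ▸ hp
  have hx' : AffineMap.lineMap f (f + (α 1)⁻¹ • R 1) s = x := (hq 1).symm ▸ hx
  refine ⟨r, s, _, htilt, ⟨x, p, ⟨s * (α 1)⁻¹, ?_, ?_⟩, hx₁, ⟨r * (α 0)⁻¹, ?_, ?_⟩, hline, rfl⟩, ?_⟩
  · exact mul_pos (one_pos.trans htilt.one_lt) (inv_pos.2 (hα 1))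
  · rw [← hx', lineMap_add_smul]
  · exact mul_pos htilt.pos (inv_pos.2 (hα 0))
  · rw [← hp', lineMap_add_smul]
  · convert! hU using 1
    refine funext (Fin.forall_fin_succ.2 ⟨?_, Fin.forall_fin_succ.2 ⟨?_, Fin.forall_fin_two.2
      ⟨hq 2, hq 3⟩⟩⟩)
    · exact (add_inv_div_smul f (R 0) (α 0) r).trans hp'
    · exact (add_inv_div_smul f (R 1) (α 1) s).trans hx'

lemma exists_isTriangleV (hα : ∀ i, 0 < α i)
    (hq : ∀ i, f + (α i)⁻¹ • R i = standardVertex δ γ i) (hδ₀ : 0 ≤ 1 + δ) (hδ₁ : δ ≤ 1)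
    (hγ₁ : 1 < γ) (hγ₂ : γ < 2) (hf₀ : 0 < f 0) (hf₁ : 0 < f 1) (hsum : f 0 + f 1 < γ) :
    ∃ r s V, IsTilt (f 0) (γ - 1) r s ∧ IsTriangleV f R V ∧
      IsRayTriangle f (fun i => f + (![α 0, α 1, α 2 / s, α 3 / r] i)⁻¹ • R i) V := by
  obtain ⟨r, s, p, x, htilt, hp, hx, hx₁, hline, hV⟩ :=
    exists_isRayTriangle_flip hδ₀ hδ₁ hγ₁ hγ₂ hf₀ hf₁ hsum
  have hp' : AffineMap.lineMap f (f + (α 3)⁻¹ • R 3) r = p := (hq 3).symm ▸ hp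
  have hx' : AffineMap.lineMap f (f + (α 2)⁻¹ • R 2) s = x := (hq 2).symm ▸ hx
  refine ⟨r, s, _, htilt, ⟨x, p, ⟨s * (α 2)⁻¹, ?_, ?_⟩, hx₁, ⟨r * (α 3)⁻¹, ?_, ?_⟩, hline, rfl⟩, ?_⟩
  · exact mul_pos (one_pos.trans htilt.one_lt) (inv_pos.2 (hα 2))
  · rw [← hx', lineMap_add_smul]
  · exact mul_pos htilt.pos (inv_pos.2 (hα 3))
  · rw [← hp', lineMap_add_smul]
  · convert! hV using 1
    refine funext (Fin.forall_fin_succ.2 ⟨hq 0, Fin.forall_fin_succ.2 ⟨hq 1, Fin.forall_fin_two.2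
      ⟨?_, ?_⟩⟩⟩)
    · exact (add_inv_div_smul f (R 2) (α 2) s).trans hx'
    · exact (add_inv_div_smul f (R 3) (α 3) r).trans hp'

theorem IsStandardQ1.exists_triangles (h : IsStandardQ1 f R α) :
    ∃ U V : Set Plane,
      IsTriangleU f R U ∧ IsTriangleV f R V ∧
      IsT2B U ∧ IsT2B V ∧ f ∈ interior U ∧ f ∈ interior V ∧
      inducedSet f R (phi f R U) = U ∧ inducedSet f R (phi f R V) = V ∧
      cutRank f R (phi f R U) < ⊤ ∧ cutRank f R (phi f R V) < ⊤ ∧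
      CutValidOn
        (splitSet
          {z | z ∈ relaxP f R ∧ 1 ≤ ∑ i, phi f R U i * z.2 i ∧ 1 ≤ ∑ i, phi f R V i * z.2 i}
          ![1, 0] 0) α ∧
      cutRank f R α ≤ max (cutRank f R (phi f R U)) (cutRank f R (phi f R V)) + 1 := by
  obtain ⟨δ, γ, hδ₀, hδ₁, hγ₁, hγ₂, hq, hf₀, hf₁, hsum⟩ := h.exists_standardVertex
  obtain ⟨r, s, U, hrs, hU, hUray⟩ := exists_isTriangleU h.pos hq hδ₀ hδ₁ (by linarith) hγ₂.le
    hf₀ hf₁ (by linarith)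
  obtain ⟨r', s', V, hrs', hV, hVray⟩ := exists_isTriangleV h.pos hq (by linarith) hδ₁.le hγ₁ hγ₂
    hf₀ (by linarith) hsum
  have hβ : ∀ i, 0 < ![α 0 / r, α 1 / s, α 2, α 3] i := by
    simp [Fin.forall_fin_succ, h.pos, hrs.pos, one_pos.trans hrs.one_lt]
  have hβ' : ∀ i, 0 < ![α 0, α 1, α 2 / s', α 3 / r'] i := by
    simp [Fin.forall_fin_succ, h.pos, hrs'.pos, one_pos.trans hrs'.one_lt]
  have hvalid := cutValidOn_splitSet_of_isTilt h.pos hq (by linarith) (by linarith) hf₀ hrs hrs'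
  refine ⟨U, V, hU, hV, hUray.isT2B, hVray.isT2B, hUray.mem_interior, hVray.mem_interior, ?_⟩
  rw [hUray.phi_eq hβ, hVray.phi_eq hβ']
  exact ⟨hUray.inducedSet_eq hβ, hVray.inducedSet_eq hβ', hUray.cutRank_lt_top hβ
    h.data.cone_eq_top, hVray.cutRank_lt_top hβ' h.data.cone_eq_top, hvalid,
    cutRank_le_max_add_one _ _ hvalid⟩

end Standard

/-! ### Quadrilaterals inside triangles -/

lemma range_subset_extremePoints_of_convexIndependent {E ι : Type*} [NormedAddCommGroup E]
    [NormedSpace ℝ E] [Finite ι] {v : ι → E} (hv : ConvexIndependent ℝ v) :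
    range v ⊆ (convexHull ℝ (range v)).extremePoints ℝ := by
  rintro _ ⟨m, rfl⟩
  set X := (convexHull ℝ (range v)).extremePoints ℝ
  have hX : X ⊆ range v := extremePoints_convexHull_subset
  have hhull : convexHull ℝ X = convexHull ℝ (range v) := by
    rw [← closure_convexHull_extremePoints ((finite_range v).isCompact_convexHull ℝ)
      (convex_convexHull ℝ _), (((finite_range v).subset hX).isClosed_convexHull ℝ).closure_eq]
  by_contra hm
  have hsub : X ⊆ v '' (univ \ {m}) := fun x hx => by
    obtain ⟨n, rfl⟩ := hX hx
    exact ⟨n, ⟨mem_univ n, by rintro rfl; exact hm hx⟩, rfl⟩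
  refine convexIndependent_iff_notMem_convexHull_sdiff.1 hv m univ (convexHull_mono hsub ?_)
  exact hhull ▸ subset_convexHull ℝ _ (mem_range_self m)

section Quadrilateral

variable {S : Set Plane} {v : Fin 4 → Plane}

lemma IsQuadrilateral.exists_support (h : IsQuadrilateral S v) (m : Fin 4) :
    ∃ g : Plane →ᵃ[ℝ] ℝ, g (v m) = 0 ∧ ∀ n ≠ m, 0 < g (v n) := by
  -- A line through the vertex parallel to the diagonal joining its two neighbours.
  let a := v (m + 3) 1 - v (m + 1) 1
  let b := v (m + 1) 0 - v (m + 3) 0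
  refine ⟨planeForm a b (-(a * v m 0 + b * v m 1)), by rw [planeForm_apply]; ring, ?_⟩
  intro n hn
  have hturn := h.1
  simp only [orient, Fin.forall_fin_succ, Fin.isValue, zero_add] at hturn
  rw [planeForm_apply]
  fin_cases m <;> fin_cases n <;> simp [a, b] at hn hturn ⊢ <;> linarith

lemma IsQuadrilateral.convexIndependent (h : IsQuadrilateral S v) : ConvexIndependent ℝ v := by
  rw [convexIndependent_iff_notMem_convexHull_sdiff]
  intro m s hm
  obtain ⟨g, hgm, hg⟩ := h.exists_support m
  have hsub : convexHull ℝ (v '' (s \ {m})) ⊆ {x | 0 < g x} :=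
    convexHull_min (image_subset_iff.2 fun n hn => hg n hn.2) ((convex_Ioi 0).affine_preimage g)
  exact (hsub hm).ne' hgm

lemma IsQuadrilateral.exists_notMem_of_subset (h : IsQuadrilateral S v) (t : Fin 3 → Plane)
    (hS : S ⊆ convexHull ℝ (range t)) : ∃ j, t j ∉ S := by
  by_contra! ht
  have hSt : convexHull ℝ (range v) = convexHull ℝ (range t) :=
    (h.2 ▸ hS).antisymm (convexHull_min (range_subset_iff.2 (h.2 ▸ ht)) (convex_convexHull ℝ _))
  have hsub : range v ⊆ range t :=
    (range_subset_extremePoints_of_convexIndependent h.convexIndependent).trans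
      (hSt ▸ extremePoints_convexHull_subset)
  obtain ⟨e, rfl⟩ := range_subset_range_iff_exists_comp.1 hsub
  simpa using Fintype.card_le_of_injective e h.convexIndependent.injective.of_comp

end Quadrilateral

lemma pos_of_isBounded_inducedSet {k : ℕ} {f : Plane} {R : Fin k → Plane} {α : Fin k → ℝ}
    (hR : ∀ i, R i ≠ 0) (hα : ∀ i, 0 ≤ α i) (h : Bornology.IsBounded (inducedSet f R α))
    (i : Fin k) : 0 < α i := by
  refine (hα i).lt_of_ne' fun hi => ?_
  obtain ⟨C, hC⟩ := h.subset_closedBall f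
  have hnorm : 0 < ‖R i‖ := norm_pos_iff.2 (hR i)
  have hmem (t : ℝ) (ht : 0 ≤ t) : f + t • R i ∈ inducedSet f R α :=
    ⟨f, subset_convexHull ℝ _ (Or.inr rfl), t • R i,
      Submodule.smul_mem _ (⟨t, ht⟩ : {c : ℝ // 0 ≤ c}) (Submodule.subset_span ⟨i, hi, rfl⟩), rfl⟩
  have hfar := hC (hmem ((|C| + 1) / ‖R i‖) (by positivity))
  rw [Metric.mem_closedBall, dist_self_add_left, norm_smul, Real.norm_of_nonneg (by positivity),
    div_mul_cancel₀ _ hnorm.ne'] at hfar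
  linarith [le_abs_self C]

/-! ### Triangles of type `T¹` in normal form -/

lemma OneInside.symm {a b : Plane} (h : OneInside a b) : OneInside b a := by
  rwa [OneInside, openSegment_symm]

lemma eq_two_of_oneInside_vertical {g : ℤ} (hg : 0 < g) (h : OneInside ![0, (g : ℝ)] 0) :
    g = 2 := by
  have hmem (p : Plane) : p ∈ openSegment ℝ ![0, (g : ℝ)] 0 ↔ 0 < p 1 ∧ p 1 < g ∧ p 0 = 0 := by
    simpa using mem_openSegment_iff_graph (p := p) (a := ![0, (g : ℝ)]) (w := 0) (C := 0)
      one_ne_zero rfl (by simpa using hg) (by simp)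
  obtain ⟨_, ⟨hp, p, rfl⟩, hunique⟩ := h
  have hunique_int (n : ℤ) (hn : 0 < n) (hng : n < g) : n = p 1 := by
    have := hunique (fun i => (![0, n] i : ℤ))
      ⟨(hmem _).2 ⟨by simpa using hn, by simpa using hng, by simp⟩, ![0, n], rfl⟩
    simpa using congrFun this 1
  have hp₀ : 0 < p 1 := by exact_mod_cast ((hmem _).1 hp).1
  have hpg : p 1 < g := by exact_mod_cast ((hmem _).1 hp).2.1
  have h₁ := hunique_int 1 one_pos (by omega)
  have h₂ := hunique_int (g - 1) (by omega) (by omega)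
  omega

lemma apex_of_latticeFree {v : Fin 3 → Plane} (hfree : LatticeFree (convexHull ℝ (range v)))
    {h y : ℤ} (h₁ : v 1 = ![0, 2]) (h₂ : v 2 = 0) (h₀ : v 0 = ![(h : ℝ), y]) (hh : 0 < h)
    (hside : OneInside (v 0) (v 2)) : h = 2 ∧ ∃ n : ℤ, y = 2 * n := by
  have hh_real : (0 : ℝ) < h := by exact_mod_cast hh
  obtain ⟨m, -, hm, hmh, -⟩ := hside.exists_int_graph (C := y / h) (by simp [h₂])
    (by simpa [h₀] using hh) (by simp [h₀, h₂, hh.ne'])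
  have hmh : m < h := by simpa [h₀] using hmh
  -- The column `x₀ = 1` meets the triangle between heights `y / h` and `2 + (y - 2) / h`.
  have hcolumn (j : ℤ) (hj : y < j * h) : 2 * h + y - 2 ≤ j * h := by
    by_contra! hj'
    have hlower : (y / h : ℝ) < j := by
      rw [div_lt_iff₀ hh_real]
      exact_mod_cast hj
    have hupper : (j : ℝ) < 2 + (y - 2) / h := by
      rw [← sub_lt_iff_lt_add', lt_div_iff₀ hh_real]
      have : (j : ℝ) * h < 2 * h + y - 2 := by exact_mod_cast hj'
      linarith
    refine disjoint_left.1 hfree (mem_interior_convexHull_of_graphs (A := (y - 2) / h) (B := y / h)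
      ?_ ?_ ?_ ?_ ?_ ?_ (x := fun i => (![1, j] i : ℤ)) ?_ ?_ ?_) (intCast_mem_latticePoints _) <;>
      simp [h₀, h₁, h₂, hh, hh.ne', hlower, hupper]
  have hj := hcolumn (y / h + 1) (by linarith [Int.lt_ediv_add_one_mul_self y hh])
  have hdiv := Int.ediv_mul_le y hh.ne'
  have htwo : h = 2 := by linarith
  subst htwo
  exact ⟨rfl, y / 2, by linarith⟩

lemma exists_coords_of_integral_side {v : Fin 3 → Plane} (hv : AffineIndependent ℝ v)
    (hvint : ∀ i, v i ∈ latticePoints) (h₁₂ : OneInside (v 1) (v 2)) :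
    ∃ φ : Plane ≃ᵃ[ℝ] Plane, IsUnimodular φ ∧
      0 < φ (v 0) 0 ∧ φ (v 1) = ![0, 2] ∧ φ (v 2) = 0 := by
  choose z hz using hvint
  obtain ⟨φ, g, hφ, hg, hφ₂, hφ₁⟩ := exists_isUnimodular_apply_eq_zero (P := z 2) (P' := z 1)
    fun h => hv.injective.ne (by decide : (2 : Fin 3) ≠ 1) (by rw [hz, hz, h])
  rw [← hz] at hφ₁ hφ₂
  obtain ⟨p, hp⟩ : φ (v 1) ∈ latticePoints := (hφ _).2 (hz 1 ▸ intCast_mem_latticePoints _)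
  obtain rfl : g = p 1 := by simpa [hφ₁] using congrFun hp 1
  have hgap : p 1 = 2 := eq_two_of_oneInside_vertical (by exact_mod_cast hg)
    (hφ₁ ▸ hφ₂ ▸ hφ.oneInside h₁₂)
  obtain ⟨ρ, hρ, hρ₀, hρ_apply⟩ := exists_isUnimodular_apply_zero_pos
    (hv.map' φ.toAffineMap φ.injective) (by simp [hφ₁]) (by simp [hφ₂])
  refine ⟨φ.trans ρ, hφ.trans hρ, hρ₀, ?_, ?_⟩
  · rw [AffineEquiv.trans_apply, hφ₁, hρ_apply _ rfl, hgap, Int.cast_ofNat]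
  · rw [AffineEquiv.trans_apply, hφ₂, hρ_apply _ rfl]

lemma exists_isUnimodular_shear (n : ℤ) :
    ∃ σ : Plane ≃ᵃ[ℝ] Plane, IsUnimodular σ ∧ ∀ x, σ x = ![x 0, x 1 - n * x 0] := by
  obtain ⟨σ, hσ, hσ_apply⟩ := exists_isUnimodular (M := !![1, 0; -n, 1])
    (by rw [Matrix.det_fin_two_of]; norm_num) 0
  refine ⟨σ, hσ, fun x => funext fun i => ?_⟩
  rw [hσ_apply]
  fin_cases i
  · simp
  · simp only [Fin.mk_one, Matrix.of_apply, Matrix.cons_val, Pi.zero_apply]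
    push_cast
    ring

theorem exists_coords_of_integral_triangle {v : Fin 3 → Plane} (hv : AffineIndependent ℝ v)
    (hfree : LatticeFree (convexHull ℝ (range v))) (hvint : ∀ i, v i ∈ latticePoints)
    (h₁₂ : OneInside (v 1) (v 2)) (h₀₂ : OneInside (v 0) (v 2)) :
    ∃ φ : Plane ≃ᵃ[ℝ] Plane, IsUnimodular φ ∧
      φ (v 0) = ![2, 0] ∧ φ (v 1) = ![0, 2] ∧ φ (v 2) = 0 := by
  obtain ⟨φ, hφ, hφ₀, hφ₁, hφ₂⟩ := exists_coords_of_integral_side hv hvint h₁₂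
  obtain ⟨p, hp⟩ := (hφ _).2 (hvint 0)
  have hp : φ (v 0) = ![(p 0 : ℝ), p 1] := by
    rw [hp]
    ext i
    fin_cases i <;> rfl
  obtain ⟨hwidth, n, hn⟩ := apex_of_latticeFree (v := φ ∘ v)
    ((IsTriangle.image ⟨hv, rfl⟩ φ).2 ▸ hφ.latticeFree hfree) hφ₁ hφ₂ hp
    (by simpa [hp] using hφ₀) (hφ.oneInside h₀₂)
  obtain ⟨σ, hσ, hσ_apply⟩ := exists_isUnimodular_shear n
  refine ⟨φ.trans σ, hφ.trans hσ, ?_, ?_, ?_⟩ <;> rw [AffineEquiv.trans_apply, hσ_apply]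
  · simp [hp, hwidth, hn, mul_comm]
  · simp [hφ₁]
  · simp [hφ₂]

/-! ### The split rank and enlarged induced sets -/

section Enlarge

variable {k k' : ℕ} {f : Plane} {R : Fin k → Plane} {R' : Fin k' → Plane} {α : Fin k → ℝ}
  {α' : Fin k' → ℝ} {φ : Plane ≃ᵃ[ℝ] Plane}

lemma exists_mem_relaxP_of_mem_inducedSet (hα : ∀ i, 0 < α i) {x : Plane}
    (hx : x ∈ inducedSet f R α) : ∃ w, (x, w) ∈ relaxP f R ∧ ∑ i, α i * w i ≤ 1 := by
  let W : Set (MixedSpace 2 k) := relaxP f R ∩ {z | ∑ i, α i * z.2 i ≤ 1}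
  have hW : Convex ℝ W := (convex_relaxP f R).inter <| convex_halfSpace_le
    (IsLinearMap.mk (by simp [mul_add, Finset.sum_add_distrib])
      (by simp [Finset.mul_sum, mul_left_comm])) 1
  have hsub : inducedSet f R α ⊆ LinearMap.fst ℝ _ _ '' W := by
    rw [inducedSet_of_pos hα]
    refine convexHull_min (union_subset (range_subset_iff.2 fun i => ?_) ?_) (hW.linear_image _)
    · have hsingle : 0 ≤ Pi.single (M := fun _ => ℝ) i (α i)⁻¹ :=
        Pi.single_nonneg.2 (inv_nonneg.2 (hα i).le)
      have hmem : (f + (α i)⁻¹ • R i, Pi.single i (α i)⁻¹) ∈ W :=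
        ⟨⟨by simp [Pi.single_apply], hsingle⟩, by simp [Pi.single_apply, (hα i).ne']⟩
      exact ⟨_, hmem, rfl⟩
    · exact singleton_subset_iff.2 ⟨(f, 0), by simp [W, relaxP], rfl⟩
  obtain ⟨⟨_, w⟩, ⟨hw, hw₁⟩, rfl⟩ := hsub hx
  exact ⟨w, hw, hw₁⟩

lemma IsUnimodular.isIntegralMap (hφ : IsUnimodular φ)
    {F : MixedSpace 2 k →ᵃ[ℝ] MixedSpace 2 k'} (hF : ∀ z, (F z).1 = φ z.1) : IsIntegralMap F := by
  rintro X ⟨π, c, hX⟩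
  obtain ⟨ρ, d, hρ⟩ := ((hφ.isIntegralFunctional_apply k 0).zsmul_add_zsmul
    (hφ.isIntegralFunctional_apply k 1) (π 0) (π 1)).zsmul_add_zsmul (.const c) 1 1
  refine ⟨ρ, d, fun z => ?_⟩
  rw [← hρ]
  simp [hX, hF]

theorem cutRank_le_of_mem_inducedSet (hα : ∀ i, 0 < α i) (hα' : ∀ j, 0 < α' j)
    (hφ : IsUnimodular φ) (h : ∀ i, φ (f + (α i)⁻¹ • R i) ∈ inducedSet (φ f) R' α') :
    cutRank f R α ≤ cutRank (φ f) R' α' := by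
  choose w hw hsum using fun i => exists_mem_relaxP_of_mem_inducedSet hα' (h i)
  have hφw (i : Fin k) (l : Fin 2) : φ (f + (α i)⁻¹ • R i) l = φ f l + ∑ j, w i j * R' j l :=
    relaxP_apply (hw i) l
  let A : (Fin k → ℝ) →ₗ[ℝ] Fin k' → ℝ := Fintype.linearCombination ℝ fun i => α i • w i
  let F : MixedSpace 2 k →ᵃ[ℝ] MixedSpace 2 k' := φ.toAffineMap.prodMap A.toAffineMap
  have hA (s : Fin k → ℝ) (j : Fin k') : A s j = ∑ i, α i * s i * w i j := by
    simp [A, Fintype.linearCombination_apply, mul_comm, mul_left_comm]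
  have hrelax : MapsTo F (relaxP f R) (relaxP (φ f) R') := fun z hz => by
    refine ⟨funext fun l => ?_, fun j => ?_⟩
    · calc φ z.1 l
      _ = φ f l * (1 - ∑ i, α i * z.2 i) + ∑ i, α i * z.2 i * φ (f + (α i)⁻¹ • R i) l :=
        affineMap_fst_eq hα ((AffineMap.proj l).comp φ.toAffineMap) hz
      _ = φ f l + ∑ i, ∑ j, α i * z.2 i * w i j * R' j l := by
        simp only [hφw, mul_add, Finset.sum_add_distrib, ← Finset.sum_mul, mul_assoc _ (w _ _),
          ← Finset.mul_sum]
        ring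
      _ = (φ f + ∑ j, A z.2 j • R' j) l := by
        rw [Finset.sum_comm]
        simp [hA, Finset.sum_mul]
    · change 0 ≤ A z.2 j
      rw [hA]
      exact Finset.sum_nonneg fun i _ => mul_nonneg (mul_nonneg (hα i).le (hz.2 i)) ((hw i).2 j)
  refine cutRank_le_of_forall fun n hn => cutValidOn_iff.2 fun z hz => ?_
  have hz₀ := (iterSplitClosure_subset (convex_relaxP f R) n hz).2
  calc
    1 ≤ ∑ j, α' j * A z.2 j := cutValidOn_iff.1 hn _
      ((hφ.isIntegralMap fun _ => rfl).mapsTo_iterSplitClosure hrelax n hz)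
    _ = ∑ i, α i * z.2 i * ∑ j, α' j * w i j := by
      simp only [hA, Finset.mul_sum]
      rw [Finset.sum_comm]
      exact Finset.sum_congr rfl fun i _ => Finset.sum_congr rfl fun j _ => by ring
    _ ≤ ∑ i, α i * z.2 i := Finset.sum_le_sum fun i _ =>
      mul_le_of_le_one_right (mul_nonneg (hα i).le (hz₀ i)) (hsum i)

end Enlarge

/-! ### Quadrilaterals inside a `T¹` triangle -/

lemma mem_convexHull_standardVertex {γ : ℝ} (hγ₀ : 0 < γ) (hγ₂ : γ < 2) {x : Plane}
    (h₀ : 0 ≤ x 0) (hγ : x 0 ≤ γ) (h₁ : 0 ≤ x 1) (h : x 0 + x 1 ≤ 2) :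
    x ∈ convexHull ℝ (range (standardVertex (γ - 1) γ)) := by
  have hvertex (j : Fin 4) :=
    subset_convexHull ℝ _ (mem_range_self (f := standardVertex (γ - 1) γ) j)
  have hconv := convex_convexHull ℝ (range (standardVertex (γ - 1) γ))
  have hx₀ : 0 < 2 - x 0 := by linarith
  set t := x 1 / (2 - x 0)
  have hxt : t * (2 - x 0) = x 1 := div_mul_cancel₀ _ hx₀.ne'
  have ht₀ : 0 ≤ t := div_nonneg h₁ hx₀.le
  have ht₁ : 0 ≤ 1 - t := sub_nonneg.2 ((div_le_one hx₀).2 (by linarith))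
  have hleft := hconv (hvertex 0) (hvertex 3) ht₀ ht₁ (by ring)
  have hright := hconv (hvertex 1) (hvertex 2) ht₀ ht₁ (by ring)
  have hp₁ : 0 ≤ 1 - x 0 / γ := sub_nonneg.2 ((div_le_one hγ₀).2 hγ)
  convert! hconv hleft hright hp₁ (div_nonneg h₀ hγ₀.le) (by ring) using 1
  ext i
  fin_cases i
  · change x 0 = (1 - x 0 / γ) * (t * 0 + (1 - t) * 0) +
      x 0 / γ * (t * (1 + (γ - 1)) + (1 - t) * γ)
    field_simp
    ring
  · change x 1 = (1 - x 0 / γ) * (t * 2 + (1 - t) * 0) +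
      x 0 / γ * (t * (1 - (γ - 1)) + (1 - t) * 0)
    field_simp
    linear_combination -γ * hxt

lemma mem_interior_convexHull_standardVertex {γ : ℝ} (hγ₀ : 0 < γ) (hγ₂ : γ < 2) {x : Plane}
    (h₀ : 0 < x 0) (hγ : x 0 < γ) (h₁ : 0 < x 1) (h : x 0 + x 1 < 2) :
    x ∈ interior (convexHull ℝ (range (standardVertex (γ - 1) γ))) := by
  have hnear : ∀ᶠ y : Plane in nhds x, 0 < y 0 ∧ y 0 < γ ∧ 0 < y 1 ∧ y 0 + y 1 < 2 :=
    (((continuous_apply 0).tendsto x).eventually_const_lt h₀).and <|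
    (((continuous_apply 0).tendsto x).eventually_lt_const hγ).and <|
    (((continuous_apply 1).tendsto x).eventually_const_lt h₁).and <|
    Filter.Tendsto.eventually_lt_const h (Continuous.tendsto (by fun_prop) x)
  exact mem_interior_iff_mem_nhds.2 <| hnear.mono fun y hy =>
    mem_convexHull_standardVertex hγ₀ hγ₂ hy.1.le hy.2.1.le hy.2.2.1.le hy.2.2.2.le

lemma hull_sub_eq_top_of_mem_interior {E ι : Type*} [NormedAddCommGroup E] [NormedSpace ℝ E]
    {f : E} {q : ι → E} (hf : f ∈ interior (convexHull ℝ (range q))) :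
    PointedCone.hull ℝ (range fun j => q j - f) = ⊤ := by
  refine eq_top_iff.2 fun d _ => ?_
  set C := PointedCone.hull ℝ (range fun j => q j - f)
  have hsub : convexHull ℝ (range q) ⊆ (fun x => x - f) ⁻¹' C :=
    convexHull_min (range_subset_iff.2 fun j => Submodule.subset_span ⟨j, rfl⟩)
      (by simpa only [sub_eq_add_neg] using C.convex.translate_preimage_left (-f))
  have hnear : ∀ᶠ t : ℝ in nhds 0, f + t • d ∈ convexHull ℝ (range q) :=
    (Continuous.tendsto' (by fun_prop) 0 f (by simp)).eventually (mem_interior_iff_mem_nhds.1 hf)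
  obtain ⟨t, ht, ht₀⟩ :=
    ((hnear.filter_mono nhdsWithin_le_nhds).and (self_mem_nhdsWithin (s := Ioi 0))).exists
  have hd : t⁻¹ • (f + t • d - f) ∈ C := C.smul_mem (inv_pos.2 ht₀).le (hsub ht)
  rwa [add_sub_cancel_left, inv_smul_smul₀ (ne_of_gt ht₀)] at hd

lemma IsUnimodular.isRationalVec {φ : Plane ≃ᵃ[ℝ] Plane} (hφ : IsUnimodular φ) {x : Plane}
    (hx : IsRationalVec x) : IsRationalVec (φ x) := by
  obtain ⟨M, w, -, hMw⟩ := hφ.exists_intAffine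
  obtain ⟨z, rfl⟩ := hx
  refine ⟨fun i => ∑ j, M i j * (z j + w j), funext fun i => ?_⟩
  rw [hMw]
  simp [intAffine, Matrix.mulVec, dotProduct]

theorem isStandardQ1_of_coords {f : Plane} {γ : ℚ} (hf : IsRationalVec f)
    (hf' : f ∉ latticePoints) (hγ₁ : 1 < (γ : ℝ)) (hγ₂ : (γ : ℝ) < 2) (h₀ : 0 < f 0) (h₁ : 0 < f 1)
    (hsum : f 0 + f 1 < γ) (hheight : 2 - f 1 < γ) :
    IsStandardQ1 f (fun j => standardVertex (γ - 1) γ j - f) (fun _ => 1) where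
  data :=
    { f_rational := hf
      f_notMem := hf'
      R_rational := fun j => by
        obtain ⟨z, rfl⟩ := hf
        refine ⟨fun i => ![![0, 2], ![1 + (γ - 1), 1 - (γ - 1)], ![γ, 0], ![0, 0]] j i - z i, ?_⟩
        ext i
        fin_cases j <;> fin_cases i <;> simp [standardVertex]
      R_ne_zero := fun j => by
        refine sub_ne_zero.2 fun h => ?_
        have hcoord₀ := congrFun h 0
        have hcoord₁ := congrFun h 1
        fin_cases j <;> simp [standardVertex] at hcoord₀ hcoord₁ <;> linarith
      cone_eq_top := hull_sub_eq_top_of_mem_interior <|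
        mem_interior_convexHull_standardVertex (by linarith) hγ₂ h₀ (by linarith) h₁
          (by linarith) }
  pos _ := one_pos
  vertices := ⟨γ - 1, γ, by linarith, by linarith, hγ₁, hγ₂, by simp [standardVertex]⟩
  second := by
    change 1 - ((γ : ℝ) - 1) - f 1 < 0
    linarith
  third := by
    change 0 < (γ : ℝ) - f 0 + (0 - f 1)
    linarith

lemma IsT1.exists_coords {S T : Set Plane} {v : Fin 4 → Plane} (hT : IsT1 T)
    (hv : IsQuadrilateral S v) (hST : S ⊆ T) : ∃ φ : Plane ≃ᵃ[ℝ] Plane, IsUnimodular φ ∧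
      ∀ x ∈ S, 0 ≤ φ x 0 ∧ φ x 0 < 2 ∧ 0 ≤ φ x 1 ∧ φ x 0 + φ x 1 ≤ 2 := by
  obtain ⟨hfree, t, ⟨ht, rfl⟩, hvint, h₀₁, h₁₂, h₂₀⟩ := hT
  obtain ⟨j, hj⟩ := hv.exists_notMem_of_subset t hST
  have hrange : range (t ∘ Equiv.addRight j) = range t := (Equiv.addRight j).surjective.range_comp t
  have hside : OneInside (t (1 + j)) (t (2 + j)) ∧ OneInside (t (0 + j)) (t (2 + j)) := by
    fin_cases j
    exacts [⟨h₁₂, h₂₀.symm⟩, ⟨h₂₀, h₀₁.symm⟩, ⟨h₀₁, h₁₂.symm⟩]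
  obtain ⟨φ, hφ, hφ₀, hφ₁, hφ₂⟩ := exists_coords_of_integral_triangle
    (ht.comp_embedding (Equiv.addRight j).toEmbedding) (hrange.symm ▸ hfree)
    (fun i => hvint _) hside.1 hside.2
  refine ⟨φ, hφ, fun x hx => ?_⟩
  have hside (a b c : ℝ) (h₀ : 0 ≤ planeForm a b c ![2, 0]) (h₁ : 0 ≤ planeForm a b c ![0, 2])
      (h₂ : 0 ≤ planeForm a b c 0) : 0 ≤ planeForm a b c (φ x) := by
    refine nonneg_of_mem_convexHull (g := (planeForm a b c).comp φ.toAffineMap) ?_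
      (hrange.symm ▸ hST hx)
    rintro _ ⟨i, rfl⟩
    fin_cases i
    exacts [h₀.trans_eq (congrArg _ hφ₀.symm), h₁.trans_eq (congrArg _ hφ₁.symm),
      h₂.trans_eq (congrArg _ hφ₂.symm)]
  have hx₀ := hside 1 0 0 (by simp [planeForm_apply]) (by simp [planeForm_apply])
    (by simp [planeForm_apply])
  have hx₁ := hside 0 1 0 (by simp [planeForm_apply]) (by simp [planeForm_apply])
    (by simp [planeForm_apply])
  have hx₂ := hside (-1) (-1) 2 (by simp [planeForm_apply]) (by simp [planeForm_apply])
    (by simp [planeForm_apply])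
  rw [planeForm_apply] at hx₀ hx₁ hx₂
  refine ⟨by linarith, lt_of_not_ge fun hx₃ => hj ?_, by linarith, by linarith⟩
  have hcorner : φ x = φ (t (0 + j)) := by
    rw [show φ (t (0 + j)) = ![2, 0] from hφ₀]
    ext i
    fin_cases i <;> simp <;> linarith
  rwa [← zero_add j, ← φ.injective hcorner]

lemma exists_rat_forall_mem_le {X : Type*} [TopologicalSpace X] {S : Set X} (hS : IsCompact S)
    {g : X → ℝ} (hg : ContinuousOn g S) {a b : ℝ} (hab : a < b) (h : ∀ x ∈ S, g x < b) :
    ∃ c : ℚ, a < c ∧ (c : ℝ) < b ∧ ∀ x ∈ S, g x ≤ c := by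
  rcases S.eq_empty_or_nonempty with rfl | hne
  · obtain ⟨c, hac, hcb⟩ := exists_rat_btwn hab
    exact ⟨c, hac, hcb, by simp⟩
  · obtain ⟨y, hy, hmax⟩ := hS.exists_isMaxOn hne hg
    obtain ⟨c, hc, hcb⟩ := exists_rat_btwn (max_lt hab (h y hy))
    exact ⟨c, (le_max_left _ _).trans_lt hc, hcb,
      fun x hx => (hmax hx).trans ((le_max_right _ _).trans hc.le)⟩

section T1

variable {k : ℕ} {f : Plane} {R : Fin k → Plane} {α : Fin k → ℝ} {φ : Plane ≃ᵃ[ℝ] Plane}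
  {T : Set Plane} {v : Fin 4 → Plane}

lemma coords_pos_of_hull_eq_top (hR : PointedCone.hull ℝ (range R) = ⊤) (hα : ∀ i, 0 < α i)
    (h : ∀ x ∈ inducedSet f R α, 0 ≤ φ x 0 ∧ φ x 0 < 2 ∧ 0 ≤ φ x 1 ∧ φ x 0 + φ x 1 ≤ 2) :
    0 < φ f 0 ∧ 0 < φ f 1 ∧ φ f 0 + φ f 1 < 2 := by
  have hmem (i : Fin k) := h _ (mem_inducedSet_of_pos (f := f) (R := R) hα i)
  have hside (a b c : ℝ) (hab : a ≠ 0 ∨ b ≠ 0)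
      (h : ∀ i, 0 ≤ planeForm a b c (φ (f + (α i)⁻¹ • R i))) : 0 < planeForm a b c (φ f) :=
    planeForm_pos_of_hull_eq_top hR hα hab h
  simp only [planeForm_apply] at hside
  have h₀ := hside 1 0 0 (by norm_num) fun i => by linarith [hmem i]
  have h₁ := hside 0 1 0 (by norm_num) fun i => by linarith [hmem i]
  have h₂ := hside (-1) (-1) 2 (by norm_num) fun i => by linarith [hmem i]
  exact ⟨by linarith, by linarith, by linarith⟩

lemma convexHull_range_subset_inducedSet (f : Plane) (q : Fin k → Plane) :
    convexHull ℝ (range q) ⊆ inducedSet f (fun j => q j - f) fun _ => 1 := by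
  rw [inducedSet_of_pos fun _ => one_pos]
  exact convexHull_mono (subset_union_of_subset_left (by simp) _)

/-- The standard quadrilateral is cut off from the triangle `(0, 0)`, `(2, 0)`, `(0, 2)` by the line
through `(γ, 0)` and `(1 + δ, 1 - δ)`. With `δ = γ - 1` that line is vertical, and every rational
`γ < 2` close to `2` keeps the image of the induced set on its left. -/
lemma exists_isStandardQ1_of_coords (hf : IsRationalVec f) (hf' : f ∉ latticePoints)
    (hR : PointedCone.hull ℝ (range R) = ⊤) (hα : ∀ i, 0 < α i)
    (hφ : IsUnimodular φ) (hL : IsCompact (inducedSet f R α))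
    (h : ∀ x ∈ inducedSet f R α, 0 ≤ φ x 0 ∧ φ x 0 < 2 ∧ 0 ≤ φ x 1 ∧ φ x 0 + φ x 1 ≤ 2) :
    ∃ R' α', IsStandardQ1 (φ f) R' α' ∧ φ '' inducedSet f R α ⊆ inducedSet (φ f) R' α' := by
  obtain ⟨hf₀, hf₁, hsum⟩ := coords_pos_of_hull_eq_top hR hα h
  have hcont : Continuous fun x => φ x 0 :=
    (continuous_apply 0).comp φ.toAffineMap.continuous_of_finiteDimensional
  obtain ⟨γ, hγ, hγ₂, hle⟩ := exists_rat_forall_mem_le hL hcont.continuousOn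
    (a := max 1 (max (φ f 0 + φ f 1) (2 - φ f 1)))
    (max_lt one_lt_two (max_lt hsum (by linarith))) fun x hx => (h x hx).2.1
  obtain ⟨hγ₁, hγsum, hγheight⟩ : 1 < (γ : ℝ) ∧ φ f 0 + φ f 1 < γ ∧ 2 - φ f 1 < γ := by
    simpa only [max_lt_iff] using hγ
  refine ⟨_, _, isStandardQ1_of_coords (hφ.isRationalVec hf)
    ((hφ f).not.2 hf') hγ₁ hγ₂ hf₀ hf₁ hγsum hγheight, ?_⟩
  rintro _ ⟨x, hx, rfl⟩
  obtain ⟨hx₀, -, hx₁, hx₂⟩ := h x hx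
  exact convexHull_range_subset_inducedSet _ _
    (mem_convexHull_standardVertex (by linarith) hγ₂ hx₀ (hle x hx) hx₁ hx₂)

theorem exists_isStandardQ1_of_isT1 (hf : IsRationalVec f) (hf' : f ∉ latticePoints)
    (hR : PointedCone.hull ℝ (range R) = ⊤) (hα : ∀ i, 0 < α i)
    (hv : IsQuadrilateral (inducedSet f R α) v) (hT : IsT1 T) (hsub : inducedSet f R α ⊆ T) :
    ∃ (M : Matrix (Fin 2) (Fin 2) ℤ) (w : Fin 2 → ℤ) (R' : Fin 4 → Plane) (α' : Fin 4 → ℝ),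
      IsUnit M.det ∧ IsStandardQ1 (intAffine M w f) R' α' ∧
      intAffine M w '' inducedSet f R α ⊆ inducedSet (intAffine M w f) R' α' ∧
      cutRank f R α ≤ cutRank (intAffine M w f) R' α' := by
  obtain ⟨φ, hφ, hcoord⟩ := hT.exists_coords hv hsub
  obtain ⟨R', α', hstd, himage⟩ := exists_isStandardQ1_of_coords hf hf' hR hα hφ
    (hv.2 ▸ (finite_range v).isCompact_convexHull ℝ) hcoord
  have hrank := cutRank_le_of_mem_inducedSet hα hstd.pos hφ fun i =>
    himage (mem_image_of_mem φ (mem_inducedSet_of_pos hα i))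
  obtain ⟨M, w, hM, hMw⟩ := hφ.exists_intAffine
  rw [hMw] at hstd himage hrank
  exact ⟨M, w, R', α', hM, hstd, himage, hrank⟩

lemma exists_triangles_of_isT1 (hf : IsRationalVec f) (hf' : f ∉ latticePoints)
    (hR : PointedCone.hull ℝ (range R) = ⊤) (hα : ∀ i, 0 < α i)
    (hv : IsQuadrilateral (inducedSet f R α) v) (hT : IsT1 T) (hsub : inducedSet f R α ⊆ T) :
    ∃ (M : Matrix (Fin 2) (Fin 2) ℤ) (w : Fin 2 → ℤ) (R' : Fin 4 → Plane) (α' : Fin 4 → ℝ)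
      (U V : Set Plane),
      IsUnit M.det ∧ IsStandardQ1 (intAffine M w f) R' α' ∧
      intAffine M w '' inducedSet f R α ⊆ inducedSet (intAffine M w f) R' α' ∧
      cutRank f R α ≤ cutRank (intAffine M w f) R' α' ∧
      IsTriangleU (intAffine M w f) R' U ∧ IsTriangleV (intAffine M w f) R' V ∧
      cutRank f R α ≤
        max (cutRank (intAffine M w f) R' (phi (intAffine M w f) R' U))
          (cutRank (intAffine M w f) R' (phi (intAffine M w f) R' V)) + 1 ∧
      cutRank f R α < ⊤ := by
  obtain ⟨M, w, R', α', hM, hstd, himage, hrank⟩ :=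
    exists_isStandardQ1_of_isT1 hf hf' hR hα hv hT hsub
  obtain ⟨U, V, hU, hV, -, -, -, -, -, -, hrankU, hrankV, -, hmax⟩ := hstd.exists_triangles
  exact ⟨M, w, R', α', U, V, hM, hstd, himage, hrank, hU, hV, hrank.trans hmax,
    (hrank.trans hmax).trans_lt <|
      ENat.add_lt_top.2 ⟨max_lt hrankU hrankV, ENat.natCast_lt_top 1⟩⟩

theorem mainTheorem5_general (hf : IsRationalVec f) (hf' : f ∉ latticePoints) (hR₀ : ∀ i, R i ≠ 0)
    (hR : PointedCone.hull ℝ (range R) = ⊤) (hα : ∀ i, 0 ≤ α i)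
    (hv : IsQuadrilateral (inducedSet f R α) v)
    (hT : ∃ T, (IsT1 T ∨ IsT2A T) ∧ inducedSet f R α ⊆ T) :
    cutRank f R α < ⊤ ∧
      ((∃ T, IsT1 T ∧ inducedSet f R α ⊆ T) →
        ∃ (M : Matrix (Fin 2) (Fin 2) ℤ) (w : Fin 2 → ℤ)
          (R' : Fin 4 → Plane) (α' : Fin 4 → ℝ) (U V : Set Plane),
          IsUnit M.det ∧
          IsStandardQ1 (intAffine M w f) R' α' ∧
          intAffine M w '' inducedSet f R α ⊆ inducedSet (intAffine M w f) R' α' ∧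
          cutRank f R α ≤ cutRank (intAffine M w f) R' α' ∧
          IsTriangleU (intAffine M w f) R' U ∧ IsTriangleV (intAffine M w f) R' V ∧
          cutRank f R α ≤
            max (cutRank (intAffine M w f) R' (phi (intAffine M w f) R' U))
              (cutRank (intAffine M w f) R' (phi (intAffine M w f) R' V)) + 1) := by
  have hpos := pos_of_isBounded_inducedSet hR₀ hα
    (hv.2 ▸ ((finite_range v).isCompact_convexHull ℝ).isBounded)
  constructor
  · obtain ⟨T, hT₁ | hT₂, hsub⟩ := hT
    · obtain ⟨-, -, -, -, -, -, -, -, -, -, -, -, -, hlt⟩ :=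
        exists_triangles_of_isT1 hf hf' hR hpos hv hT₁ hsub
      exact hlt
    · exact cutRank_lt_top_of_isT2A hR hpos hT₂ fun i =>
        hsub (mem_inducedSet_of_pos hpos i)
  · rintro ⟨T, hT₁, hsub⟩
    obtain ⟨M, w, R', α', U, V, hM, hstd, himage, hrank, hU, hV, hmax, -⟩ :=
      exists_triangles_of_isT1 hf hf' hR hpos hv hT₁ hsub
    exact ⟨M, w, R', α', U, V, hM, hstd, himage, hrank, hU, hV, hmax⟩

end T1

theorem mainTheorem5 :
    -- every inequality of type `Q¹` has finite split rank; inside a `T¹` triangle it is dominated,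
    -- after a unimodular change of coordinates, by one in standard position
    (∀ (k : ℕ) (f : Fin 2 → ℝ) (R : Fin k → Fin 2 → ℝ) (α : Fin k → ℝ),
      IsPlaneData f R → (∀ i, 0 ≤ α i) → CutValidOn (convexHull ℝ (mixedP f R)) α →
      IsQ1 (inducedSet f R α) →
        cutRank f R α < ⊤ ∧
        ((∃ T, IsT1 T ∧ inducedSet f R α ⊆ T) →
          ∃ (M : Matrix (Fin 2) (Fin 2) ℤ) (w : Fin 2 → ℤ)
            (R' : Fin 4 → Fin 2 → ℝ) (α' : Fin 4 → ℝ) (U V : Set (Fin 2 → ℝ)),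
            IsUnit M.det ∧
            IsStandardQ1 (intAffine M w f) R' α' ∧
            intAffine M w '' inducedSet f R α ⊆ inducedSet (intAffine M w f) R' α' ∧
            cutRank f R α ≤ cutRank (intAffine M w f) R' α' ∧
            IsTriangleU (intAffine M w f) R' U ∧ IsTriangleV (intAffine M w f) R' V ∧
            cutRank f R α ≤
              max (cutRank (intAffine M w f) R' (phi (intAffine M w f) R' U))
                (cutRank (intAffine M w f) R' (phi (intAffine M w f) R' V)) + 1)) ∧
    -- the rank bound in standard position, through the disjunction `x₁ ≤ 0 ∨ x₁ ≥ 1`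
    (∀ (f : Fin 2 → ℝ) (R : Fin 4 → Fin 2 → ℝ) (α : Fin 4 → ℝ), IsStandardQ1 f R α →
      ∃ U V : Set (Fin 2 → ℝ),
        IsTriangleU f R U ∧ IsTriangleV f R V ∧
        IsT2B U ∧ IsT2B V ∧ f ∈ interior U ∧ f ∈ interior V ∧
        inducedSet f R (phi f R U) = U ∧ inducedSet f R (phi f R V) = V ∧
        cutRank f R (phi f R U) < ⊤ ∧ cutRank f R (phi f R V) < ⊤ ∧
        CutValidOn
          (splitSet
            {z | z ∈ relaxP f R ∧ 1 ≤ ∑ i, phi f R U i * z.2 i ∧ 1 ≤ ∑ i, phi f R V i * z.2 i}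
            ![1, 0] 0) α ∧
        cutRank f R α ≤ max (cutRank f R (phi f R U)) (cutRank f R (phi f R V)) + 1) :=
  ⟨fun _ _ _ _ ⟨hf, hf', _, hR₀, hR⟩ hα _ ⟨hT, _, hv, _⟩ =>
      mainTheorem5_general hf hf' hR₀ hR hα hv hT,
    fun _ _ _ h => h.exists_triangles⟩
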